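/- Let $n\in\mathbb N$, let $\lambda_1,\lambda_2:[0,1]\to(0,\infty)$ be continuous (for instance continuous and piecewise continuously differentiable), let $A=[A_{ij}]:[0,1]\to\mathbb R^{2\times2}$ be continuous, and let $F\in\mathbb R^{n\times n}$, $b,c\in\mathbb R^n$, $q_0,q_1\in\mathbb R$ with $q_0\neq0$. Put $\Lambda=\operatorname{diag}(\lambda_1,-\lambda_2)$ and consider, for $z\in[0,1]$, the system with input $u$ $$\dot\xi(t)=F\xi(t)+b\,x_1(0,t),\quad x_2(0,t)=q_0x_1(0,t)+c^\top\xi(t),\quad \partial_tx(z,t)=\Lambda(z)\partial_zx(z,t)+A(z)x(z,t),\quad x_1(1,t)=q_1x_2(1,t)+u(t)\qquad(1)$$ with $\xi(0)=\xi_0\in\mathbb R^n$, $x(z,0)=x_0(z)\in\mathbb R^2$. Let $\alpha_i(z)=\int_0^z A_{ii}/\lambda_i\,\mathrm d\zeta$, $E=\operatorname{diag}(e^{\alpha_1},e^{-\alpha_2})$, $\tilde A_{12}=A_{12}e^{\alpha_1+\alpha_2}$, $\tilde A_{21}=A_{21}e^{-\alpha_1-\alpha_2}$, $\tilde A_{11}=\tilde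 A_{22}=0$, and $\bar q_1=q_1e^{\alpha_1(1)+\alpha_2(1)}$. States are bounded measurable functions $[0,1]\to\mathbb R^2$ (e.g. piecewise continuous ones), trajectories $x$ are measurable on $[0,1]\times[0,\infty)$ and bounded on $[0,1]\times[0,T]$ for every $T$; the ODE is understood in integrated form with $\xi$ continuous, and the boundary conditions hold for $t>0$. PDEs are understood along characteristics: a PDE $\partial_tx=\Lambda\partial_zx+f$ means that along every curve $s\mapsto(\gamma(s),s)$ in $[0,1]\times[0,\infty)$ with $\gamma'=-\Lambda_{ii}(\gamma)$ the increment of $x_i$ is the integral of $f_i$, and the kernel PDE below means that along every curve $(p,r)$ in the triangle with $p'=\Lambda_{ii}(p)$, $r'=\Lambda_{jj}(r)$ the function $K_{ij}(p,r)\Lambda_{jj}(r)$ has the derivative $\Lambda_{jj}(r)\,(K(p,r)\tilde A(r))_{ij}$ (for continuously differentiable functions and velocities these are the pointwise equations). Then the kernel equations $$\Lambda(z)\partial_zK(z,\zeta)+\partial_\zeta\big(K(z,\zeta)\Lambda(\zeta)\big)=K(z,\zeta)\tilde A(\zeta),\qquad 0\le\zeta\le z\le1,$$ $$K_{11}(z,0)=\tfrac{q_0\lambda_2(0)}{\lambda_1(0)}K_{12}(z,0),\quad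 K_{12}(z,z)=-\tfrac{\tilde A_{12}(z)}{\lambda_1(z)+\lambda_2(z)},\quad K_{21}(z,z)=\tfrac{\tilde A_{21}(z)}{\lambda_1(z)+\lambda_2(z)},\quad K_{22}(z,0)=\tfrac{\lambda_1(0)}{q_0\lambda_2(0)}K_{21}(z,0)$$ have a continuous solution $K$ with values in $\mathbb R^{2\times2}$. For every such $K$, with $C(z)=K(z,0)\Lambda(0)e_2c^\top$, the transformation $$(\mathcal Tw)(z)=E(z)w(z)-\int_0^zK(z,\zeta)E(\zeta)w(\zeta)\,\mathrm d\zeta$$ is a bijection of the state space onto itself that is bounded in both directions (sup norm), and (1) is equivalent to the transport form $$\dot\xi(t)=F\xi(t)+b\,\bar x_1(0,t),\quad \bar x_2(0,t)=q_0\bar x_1(0,t)+c^\top\xi(t),\quad \partial_t\bar x(z,t)=\Lambda(z)\partial_z\bar x(z,t)+C(z)\xi(t),\quad \bar x_1(1,t)=\bar q_1\bar x_2(1,t)+\bar u(t)\qquad(2)$$ with $\xi(0)=\xi_0$, $\bar x(\cdot,0)=\bar x_0$, in the following sense. If $(\xi,x)$ solves (1) with input $u$ and initial values $(\xi_0,x_0)$,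 then $(\xi,\bar x)$ with $\bar x(\cdot,t)=\mathcal Tx(\cdot,t)$ solves (2) with initial values $(\xi_0,\mathcal Tx_0)$ and input $$\bar u(t)=e^{\alpha_1(1)}u(t)+\int_0^1(\bar q_1e_2^\top-e_1^\top)K(1,z)E(z)x(z,t)\,\mathrm dz.\qquad(3)$$ Conversely, for every solution $(\xi,\bar x)$ of (2) with input $\bar u$ and initial values $(\xi_0,\bar x_0)$ there is exactly one triple of an initial state $x_0$, an input $u$ (on $t>0$) and a trajectory $x$ such that $(\xi,x)$ solves (1) with input $u$ and initial values $(\xi_0,x_0)$, $\mathcal Tx_0=\bar x_0$, $\mathcal Tx(\cdot,t)=\bar x(\cdot,t)$ for all $t\ge0$, and (3) holds for $t>0$. -/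

import Mathlib

open Set MeasureTheory
open scoped Matrix

/-- Data of a linear heterodirectional hyperbolic PDE-ODE system on the spatial domain `[0, 1]` with
ODE state in `ℝⁿ`. Index `0` of `Fin 2` is the component that travels towards `z = 0`, index `1` the
component that travels towards `z = 1`. Functions of `z` only matter on `[0, 1]`. Continuity of the
velocities suffices; continuous, piecewise continuously differentiable velocities are a special
case. -/
structure PDEODESystem (n : ℕ) where
  /-- the two transport velocities -/
  lam : Fin 2 → ℝ → ℝ
  /-- the in-domain coupling matrix -/
  A : ℝ → Matrix (Fin 2) (Fin 2) ℝ
  F : Matrix (Fin n) (Fin n) ℝ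
  b : Fin n → ℝ
  c : Fin n → ℝ
  q0 : ℝ
  q1 : ℝ
  lam_pos : ∀ i, ∀ z ∈ Icc (0 : ℝ) 1, 0 < lam i z
  lam_cont : ∀ i, ContinuousOn (lam i) (Icc 0 1)
  A_cont : ∀ i j, ContinuousOn (fun z => A z i j) (Icc 0 1)

/-- A distributed state: a bounded measurable function `[0, 1] → ℝ²` (for example a piecewise
continuous one). -/
def IsState (w : ℝ → Fin 2 → ℝ) : Prop :=
  Measurable ((Icc (0 : ℝ) 1).domRestrict w) ∧ ∃ M : ℝ, ∀ z ∈ Icc (0 : ℝ) 1, ‖w z‖ ≤ M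

/-- A trajectory `(z, t) ↦ x z t` of distributed states: measurable on `[0, 1] × [0, ∞)` and bounded on
`[0, 1] × [0, T]` for every `T`. -/
def IsStateTrajectory (x : ℝ → ℝ → Fin 2 → ℝ) : Prop :=
  Measurable ((Icc (0 : ℝ) 1 ×ˢ Ici (0 : ℝ)).domRestrict (fun p : ℝ × ℝ => x p.1 p.2)) ∧
    ∀ T : ℝ, ∃ M : ℝ, ∀ z ∈ Icc (0 : ℝ) 1, ∀ t ∈ Icc (0 : ℝ) T, ‖x z t‖ ≤ M

/-- `x` solves `∂ₜ x(z,t) = Λ(z) ∂_z x(z,t) + f(z,t)` with diagonal `Λ` on `[0, 1] × [0, ∞)` in the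
sense of the method of characteristics: along every curve `s ↦ (γ(s), s)` in the domain with
`γ' = -Λᵢᵢ(γ)`, the increment of `xᵢ` is the integral of `fᵢ`. For a continuously differentiable `x`
this is the pointwise equation, because `d/ds xᵢ(γ(s), s) = (∂ₜ xᵢ - Λᵢᵢ ∂_z xᵢ)(γ(s), s)`; it makes
sense for piecewise continuous states as well. -/
def SolvesTransport (Λ : ℝ → Matrix (Fin 2) (Fin 2) ℝ) (f x : ℝ → ℝ → Fin 2 → ℝ) : Prop :=
  ∀ (i : Fin 2) (a b : ℝ) (γ : ℝ → ℝ), 0 ≤ a → a ≤ b →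
    (∀ s ∈ Icc a b, γ s ∈ Icc (0 : ℝ) 1 ∧
      HasDerivWithinAt γ (-(Λ (γ s) i i)) (Icc a b) s) →
    x (γ b) b i - x (γ a) a i = ∫ s in a..b, f (γ s) s i

namespace PDEODESystem

variable {n : ℕ} (S : PDEODESystem n)

/-- The matrix of (signed) transport velocities. -/
def Lam (z : ℝ) : Matrix (Fin 2) (Fin 2) ℝ :=
  !![S.lam 0 z, 0; 0, -S.lam 1 z]

/-- `(ξ, x)` with input `v` and initial values `ξ₀`, `x₀` solves the PDE-ODE system with the
ODE, the boundary condition at `z = 0` and the velocities of `S`, with source term `f` in the PDE and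
with reflection coefficient `q` at the actuated boundary `z = 1`:
`ξ' = F ξ + b x₁(0,t)`, `x₂(0,t) = q₀ x₁(0,t) + cᵀ ξ`, `∂ₜ x = Λ ∂_z x + f`,
`x₁(1,t) = q x₂(1,t) + v`. The ODE is understood in integrated form as `x₁(0,·)` may jump; the boundary
conditions hold for `t > 0`, so no compatibility of the initial values is presupposed. -/
structure SolvesWith (f : ℝ → ℝ → Fin 2 → ℝ) (q : ℝ) (ξ₀ : Fin n → ℝ) (x₀ : ℝ → Fin 2 → ℝ)
    (v : ℝ → ℝ) (ξ : ℝ → Fin n → ℝ) (x : ℝ → ℝ → Fin 2 → ℝ) : Prop where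
  traj : IsStateTrajectory x
  cont : ContinuousOn ξ (Ici 0)
  init : ∀ z ∈ Icc (0 : ℝ) 1, x z 0 = x₀ z
  ode : ∀ t : ℝ, 0 ≤ t → ξ t = ξ₀ + ∫ s in (0 : ℝ)..t, (S.F *ᵥ ξ s + x 0 s 0 • S.b)
  bc0 : ∀ t : ℝ, 0 < t → x 0 t 1 = S.q0 * x 0 t 0 + S.c ⬝ᵥ ξ t
  pde : SolvesTransport S.Lam f x
  bc1 : ∀ t : ℝ, 0 < t → x 1 t 0 = q * x 1 t 1 + v t

/-- Solutions of the original system, with the coupled PDE `∂ₜ x = Λ ∂_z x + A x`. -/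
def IsSolution (ξ₀ : Fin n → ℝ) (x₀ : ℝ → Fin 2 → ℝ) (u : ℝ → ℝ) (ξ : ℝ → Fin n → ℝ)
    (x : ℝ → ℝ → Fin 2 → ℝ) : Prop :=
  S.SolvesWith (fun z t => S.A z *ᵥ x z t) S.q1 ξ₀ x₀ u ξ x

/-- The exponents `αᵢ(z) = ∫₀ᶻ Aᵢᵢ / λᵢ`. -/
noncomputable def alpha (i : Fin 2) (z : ℝ) : ℝ :=
  ∫ ζ in (0 : ℝ)..z, S.A ζ i i / S.lam i ζ

/-- The exponential scaling matrix. -/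
noncomputable def E (z : ℝ) : Matrix (Fin 2) (Fin 2) ℝ :=
  !![Real.exp (S.alpha 0 z), 0; 0, Real.exp (-S.alpha 1 z)]

/-- The coupling matrix after the exponential scaling. -/
noncomputable def Atilde (z : ℝ) : Matrix (Fin 2) (Fin 2) ℝ :=
  !![0, S.A z 0 1 * Real.exp (S.alpha 0 z + S.alpha 1 z);
    S.A z 1 0 * Real.exp (-S.alpha 0 z - S.alpha 1 z), 0]

/-- `K` is a continuous solution of the kernel equations
`Λ(z) ∂_z K(z,ζ) + ∂_ζ (K(z,ζ) Λ(ζ)) = K(z,ζ) Ã(ζ)` on the triangle `0 ≤ ζ ≤ z ≤ 1` with their four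
boundary conditions. As `K` is only continuous, the PDE is meant in the sense of the method of
characteristics: for `N = Kᵢⱼ(z,ζ) Λⱼⱼ(ζ)` it reads
`Λᵢᵢ(z) ∂_z N + Λⱼⱼ(ζ) ∂_ζ N = Λⱼⱼ(ζ) (K Ã)ᵢⱼ`, and the left-hand side is the derivative of `N` along the
curves `(p, r)` with `p' = Λᵢᵢ(p)`, `r' = Λⱼⱼ(r)`. -/
structure IsKernel (K : ℝ → ℝ → Matrix (Fin 2) (Fin 2) ℝ) : Prop where
  cont : ∀ i j, ContinuousOn (fun y : ℝ × ℝ => K y.1 y.2 i j)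
    {y : ℝ × ℝ | 0 ≤ y.2 ∧ y.2 ≤ y.1 ∧ y.1 ≤ 1}
  pde : ∀ (i j : Fin 2) (a b : ℝ) (p r : ℝ → ℝ), a ≤ b →
    (∀ s ∈ Icc a b, (0 ≤ r s ∧ r s ≤ p s ∧ p s ≤ 1) ∧
      HasDerivWithinAt p (S.Lam (p s) i i) (Icc a b) s ∧
      HasDerivWithinAt r (S.Lam (r s) j j) (Icc a b) s) →
    ∀ s ∈ Icc a b, HasDerivWithinAt (fun s => K (p s) (r s) i j * S.Lam (r s) j j)
      (S.Lam (r s) j j * (K (p s) (r s) * S.Atilde (r s)) i j) (Icc a b) s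
  bc11 : ∀ z ∈ Icc (0 : ℝ) 1, K z 0 0 0 = S.q0 * S.lam 1 0 / S.lam 0 0 * K z 0 0 1
  bc12 : ∀ z ∈ Icc (0 : ℝ) 1, K z z 0 1 = -S.Atilde z 0 1 / (S.lam 0 z + S.lam 1 z)
  bc21 : ∀ z ∈ Icc (0 : ℝ) 1, K z z 1 0 = S.Atilde z 1 0 / (S.lam 0 z + S.lam 1 z)
  bc22 : ∀ z ∈ Icc (0 : ℝ) 1, K z 0 1 1 = S.lam 0 0 / (S.q0 * S.lam 1 0) * K z 0 1 0

/-- The state transformation: the scaling `w̃ = E w` followed by the Volterra transformation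
`w̃(z) - ∫₀ᶻ K(z,ζ) w̃(ζ) dζ`. -/
noncomputable def transform (K : ℝ → ℝ → Matrix (Fin 2) (Fin 2) ℝ) (w : ℝ → Fin 2 → ℝ) (z : ℝ) :
    Fin 2 → ℝ :=
  S.E z *ᵥ w z - ∫ ζ in (0 : ℝ)..z, K z ζ *ᵥ (S.E ζ *ᵥ w ζ)

/-- The reflection coefficient `q̄₁` of the transport form. -/
noncomputable def q1bar : ℝ := S.q1 * Real.exp (S.alpha 0 1 + S.alpha 1 1)

/-- The new input `ū(t) = e^{α₁(1)} u(t) + ∫₀¹ (q̄₁ e₂ᵀ - e₁ᵀ) K(1,z) E(z) x(z,t) dz`. -/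
noncomputable def newInput (K : ℝ → ℝ → Matrix (Fin 2) (Fin 2) ℝ) (u : ℝ → ℝ)
    (x : ℝ → ℝ → Fin 2 → ℝ) (t : ℝ) : ℝ :=
  Real.exp (S.alpha 0 1) * u t +
    ∫ z in (0 : ℝ)..1, (![-1, S.q1bar] : Fin 2 → ℝ) ⬝ᵥ (K 1 z *ᵥ (S.E z *ᵥ x z t))

/-- The matrix `C(z) = K(z,0) Λ(0) e₂ cᵀ`. -/
def Cmat (K : ℝ → ℝ → Matrix (Fin 2) (Fin 2) ℝ) (z : ℝ) : Matrix (Fin 2) (Fin n) ℝ :=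
  K z 0 * S.Lam 0 * Matrix.vecMulVec ![0, 1] S.c

/-- Solutions of the transport form, with the PDE `∂ₜ x̄ = Λ ∂_z x̄ + C ξ` and the boundary condition
`x̄₁(1,t) = q̄₁ x̄₂(1,t) + ū(t)`. -/
def IsTransportSolution (K : ℝ → ℝ → Matrix (Fin 2) (Fin 2) ℝ) (ξ₀ : Fin n → ℝ)
    (xb₀ : ℝ → Fin 2 → ℝ) (ub : ℝ → ℝ) (ξ : ℝ → Fin n → ℝ) (xb : ℝ → ℝ → Fin 2 → ℝ) : Prop :=
  S.SolvesWith (fun z t => S.Cmat K z *ᵥ ξ t) S.q1bar ξ₀ xb₀ ub ξ xb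

/-- The initial state, input and trajectory `(xb₀, ub, xb)` are the transforms of `(x₀, u, x)`. -/
def Corresponds (K : ℝ → ℝ → Matrix (Fin 2) (Fin 2) ℝ)
    (x₀ : ℝ → Fin 2 → ℝ) (u : ℝ → ℝ) (x : ℝ → ℝ → Fin 2 → ℝ)
    (xb₀ : ℝ → Fin 2 → ℝ) (ub : ℝ → ℝ) (xb : ℝ → ℝ → Fin 2 → ℝ) : Prop :=
  (∀ z ∈ Icc (0 : ℝ) 1, xb₀ z = S.transform K x₀ z) ∧
  (∀ t : ℝ, 0 < t → ub t = S.newInput K u x t) ∧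
  (∀ z ∈ Icc (0 : ℝ) 1, ∀ t : ℝ, 0 ≤ t → xb z t = S.transform K (fun ζ => x ζ t) z)

end PDEODESystem

/-! Everything is done along characteristics, because states are only bounded and measurable and
cannot be differentiated. The travel times `phi i`, with derivative 1/λᵢ, straighten the
characteristics: each is determined by a label φᵢ(z) ± t. A curve of the prescribed velocity is
affine in this coordinate, so continuity of the velocities suffices.

From (1) to (2): the scaling y = E x removes the diagonal coupling (`transports_scaledTrajectory`),
so y has the source Ãy. Along a characteristic γ of component i, the change of ∫₀^γ Kᵢⱼ(γ,ζ) yⱼ(ζ,s)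
dζ is needed. Formally one differentiates under the integral and integrates by parts. Here ζ is
replaced by the label of the j-th characteristic through (ζ,s). For a fixed label, λⱼKᵢⱼyⱼ is the
product of a factor governed by the kernel equation and a factor governed by transport. Fubini sums
over the labels, and those crossing an end of the interval produce the boundary fluxes
(`integral_labels_sub_eq`, `integral_moving_interval_sub_eq`). In `IsKernel.transports_sub_volterra`
the interior terms cancel, the flux on the diagonal cancels Ãy by the conditions on K₁₂ and K₂₁, and
K(z,0)Λ(0)y(0,t) remains. The conditions on K₁₁ and K₂₂ together with the boundary condition at z =
0 reduce it to Cξ (`IsKernel.boundarySource_eq`). At z = 0 the transformation is the identity, which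
leaves the ODE and that boundary condition unchanged. At z = 1 the defects of the two boundary
conditions are proportional (`IsKernel.boundary_residual_eq`).

Bijectivity and bounds come from the Volterra equation, whose operator is a contraction in a norm
weighted by exp(μz) with large μ.

From (2) to (1): the Volterra equation gives a bounded measurable y, but not that y is transported
with the source Ãy. Let w be the trajectory that is transported with the source Ãy and agrees with y
at z = 0, and at t = 0 on characteristics of the second family that start there. By the forward
computation, e = w - y satisfies a homogeneous problem: e - ∫Ke is transported with a source linear
in e, and e vanishes at the data points. A weighted estimate in the z direction gives e = 0
(`IsKernel.eq_zero_of_transports_couplingDefect`). No information from z = 1 enters.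

Existence of K: since Ã has zero diagonal, the two rows of K decouple. In each row the diagonal
entry is integrated from ζ = 0 and the off-diagonal entry from the diagonal ζ = z, and the resulting
integral equations are again contractive in a weighted norm (`exists_row`). -/

/-! ### Integrals, changes of variable and weighted contractions. -/

theorem intervalIntegrable_of_measurable_of_abs_le {f : ℝ → ℝ} {a b B : ℝ} (hf : Measurable f)
    (hB : ∀ x ∈ uIcc a b, |f x| ≤ B) : IntervalIntegrable f volume a b := by
  rw [intervalIntegrable_iff]
  refine Measure.integrableOn_of_bounded (M := B) (by simp) hf.aestronglyMeasurable ?_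
  filter_upwards [ae_restrict_mem measurableSet_uIoc] with x hx
  exact hB x (uIoc_subset_uIcc hx)

/-- A continuous positive density bounded away from zero has an antiderivative that is an order
isomorphism of the real line. -/
theorem exists_orderIso_hasDerivAt {g : ℝ → ℝ} (hg : Continuous g) {δ : ℝ} (hδ : 0 < δ)
    (h : ∀ z, δ ≤ g z) : ∃ e : ℝ ≃o ℝ, e 0 = 0 ∧ ∀ z, HasDerivAt e (g z) z := by
  have hd : ∀ z, HasDerivAt (fun z => ∫ t in (0 : ℝ)..z, g t) (g z) z := fun z =>
    intervalIntegral.integral_hasDerivAt_right (hg.intervalIntegrable _ _)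
      hg.aestronglyMeasurable.stronglyMeasurableAtFilter hg.continuousAt
  set Φ : ℝ → ℝ := fun z => ∫ t in (0 : ℝ)..z, g t with hΦ
  have h0 : Φ 0 = 0 := by simp [hΦ]
  have hmono : StrictMono Φ := by
    refine strictMono_of_deriv_pos fun z => ?_
    rw [(hd z).deriv]; linarith [h z]
  have hcont : Continuous Φ := continuous_iff_continuousAt.2 fun z => (hd z).continuousAt
  -- Comparison with the line δz gives the divergence at both ends that surjectivity requires.
  have hm2 : Monotone fun z => Φ z - δ * z := by
    have hd2 : ∀ z, HasDerivAt (fun z => Φ z - δ * z) (g z - δ) z := fun z => by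
      simpa using (hd z).fun_sub ((hasDerivAt_id z).const_mul δ)
    refine monotone_of_deriv_nonneg (fun z => (hd2 z).differentiableAt) fun z => ?_
    rw [(hd2 z).deriv]; linarith [h z]
  have hsurj : Function.Surjective Φ := by
    refine hcont.surjective ?_ ?_
    · refine Filter.tendsto_atTop_mono' _ ?_
        ((Filter.tendsto_id (α := ℝ) (x := Filter.atTop)).const_mul_atTop hδ)
      filter_upwards [Filter.eventually_ge_atTop (0 : ℝ)] with z hz
      have := hm2 hz
      simp only [h0] at this
      simp only [id]; linarith
    · refine Filter.tendsto_atBot_mono' _ ?_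
        ((Filter.tendsto_id (α := ℝ) (x := Filter.atBot)).const_mul_atBot hδ)
      filter_upwards [Filter.eventually_le_atBot (0 : ℝ)] with z hz
      have := hm2 hz
      simp only [h0] at this
      simp only [id]; linarith
  exact ⟨hmono.orderIsoOfSurjective Φ hsurj, h0, hd⟩

theorem OrderIso.hasDerivAt_symm {e : ℝ ≃o ℝ} {g : ℝ → ℝ} (h : ∀ z, HasDerivAt e (g z) z)
    (hg : ∀ z, g z ≠ 0) (t : ℝ) : HasDerivAt e.symm (g (e.symm t))⁻¹ t :=
  (h (e.symm t)).of_local_left_inverse e.symm.continuous.continuousAt (hg _)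
    (Filter.Eventually.of_forall fun y => e.apply_symm_apply y)

/-- Product rule for two functions that are integrals. -/
theorem mul_sub_mul_eq_integral {U V u v : ℝ → ℝ} {a b : ℝ} (hab : a ≤ b)
    (hu : IntervalIntegrable u volume a b) (hv : IntervalIntegrable v volume a b)
    (hU : ∀ s ∈ Icc a b, U s - U a = ∫ t in a..s, u t)
    (hV : ∀ s ∈ Icc a b, V s - V a = ∫ t in a..s, v t) :
    U b * V b - U a * V a = ∫ s in a..b, (u s * V s + U s * v s) := by
  have key := AbsolutelyContinuousOnInterval.integral_deriv_mul_eq_sub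
    (hu.absolutelyContinuousOnInterval_intervalIntegral (c := a) left_mem_uIcc)
    (hv.absolutelyContinuousOnInterval_intervalIntegral (c := a) left_mem_uIcc)
  have acU := hu.absolutelyContinuousOnInterval_intervalIntegral (c := a) left_mem_uIcc
  have acV := hv.absolutelyContinuousOnInterval_intervalIntegral (c := a) left_mem_uIcc
  set U' : ℝ → ℝ := fun x => ∫ t in a..x, u t with hU'
  set V' : ℝ → ℝ := fun x => ∫ t in a..x, v t with hV'
  have hb : b ∈ Icc a b := right_mem_Icc.2 hab
  -- The primitives starting at a are absolutely continuous, and by Lebesgue differentiation their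
  -- derivatives are u and v almost everywhere. The initial values U a and V a are split off as
  -- constants.
  have e1 : ∫ s in a..b, (u s * V s + U s * v s)
      = ∫ s in a..b, ((deriv U' s * V' s + U' s * deriv V' s) + (V a * u s + U a * v s)) := by
    refine intervalIntegral.integral_congr_ae ?_
    filter_upwards [hu.ae_hasDerivAt_integral, hv.ae_hasDerivAt_integral] with s h1 h2 hs
    have hs' := uIoc_subset_uIcc hs
    rw [(h1 hs' a left_mem_uIcc).deriv, (h2 hs' a left_mem_uIcc).deriv]
    rw [uIcc_of_le hab] at hs'
    have := hU s hs'
    have := hV s hs'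
    have hh1 : U s = U a + U' s := by simp only [hU']; linarith
    have hh2 : V s = V a + V' s := by simp only [hV']; linarith
    rw [hh1, hh2]; ring
  rw [e1, intervalIntegral.integral_add, key, intervalIntegral.integral_add,
    intervalIntegral.integral_const_mul, intervalIntegral.integral_const_mul, ← hU b hb, ← hV b hb,
    intervalIntegral.integral_same, intervalIntegral.integral_same]
  · ring
  · exact hu.const_mul _
  · exact hv.const_mul _
  · exact (acU.intervalIntegrable_deriv.mul_continuousOn acV.continuousOn).add
      (acV.intervalIntegrable_deriv.continuousOn_mul acU.continuousOn)
  · exact (hu.const_mul _).add (hv.const_mul _)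

/-- Monotonicity of the substitution is what makes it valid for an arbitrary `G`: neither continuity
nor integrability is required, so it applies to data that are merely measurable. -/
theorem integral_mul_comp_of_deriv_nonneg {m m' : ℝ → ℝ} {a b : ℝ} (hab : a ≤ b)
    (hm : ContinuousOn m (Icc a b)) (hd : ∀ s ∈ Ioo a b, HasDerivAt m (m' s) s)
    (hm' : ∀ s ∈ Ioo a b, 0 ≤ m' s) (G : ℝ → ℝ) :
    ∫ s in a..b, m' s * G (m s) = ∫ η in m a..m b, G η := by
  have hmono : MonotoneOn m (Icc a b) := by
    refine monotoneOn_of_deriv_nonneg (convex_Icc a b) hm ?_ ?_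
    · rw [interior_Icc]; exact fun z hz => (hd z hz).differentiableAt.differentiableWithinAt
    · rw [interior_Icc]; intro z hz; rw [(hd z hz).deriv]; exact hm' z hz
  have := integral_Icc_deriv_smul_of_deriv_nonneg (g := G) hm hd hm' hab
  rw [intervalIntegral.integral_of_le hab, intervalIntegral.integral_of_le
    (hmono (left_mem_Icc.2 hab) (right_mem_Icc.2 hab) hab), ← integral_Icc_eq_integral_Ioc,
    ← integral_Icc_eq_integral_Ioc]
  simpa using this

/-- Variable limits are absorbed into the indicator of a measurable set, which leaves an integral
over the whole line with a jointly measurable integrand. -/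
theorem measurable_intervalIntegral_param {α : Type*} [MeasurableSpace α] {f : α → ℝ → ℝ}
    (hf : Measurable (Function.uncurry f)) {l u : α → ℝ} (hl : Measurable l) (hu : Measurable u) :
    Measurable fun x => ∫ ζ in l x..u x, f x ζ := by
  have key : ∀ {l u : α → ℝ}, Measurable l → Measurable u →
      Measurable fun x => ∫ ζ in Ioc (l x) (u x), f x ζ := by
    intro l u hl hu
    have hs : MeasurableSet {p : α × ℝ | l p.1 < p.2 ∧ p.2 ≤ u p.1} :=
      (measurableSet_lt (hl.comp measurable_fst) measurable_snd).inter
        (measurableSet_le measurable_snd (hu.comp measurable_fst))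
    have h1 : ∀ x, ∫ ζ in Ioc (l x) (u x), f x ζ
        = ∫ ζ, ({p : α × ℝ | l p.1 < p.2 ∧ p.2 ≤ u p.1}.indicator (Function.uncurry f)) (x, ζ) := by
      intro x
      rw [← integral_indicator measurableSet_Ioc]
      rfl
    simp_rw [h1]
    exact ((hf.indicator hs).stronglyMeasurable.integral_prod_right').measurable
  simp only [intervalIntegral]
  exact (key hl hu).sub (key hu hl)

/-- Fixed points of affine maps `f ↦ g + V f` whose linear part contracts a weighted sup norm, in a
class `P` of functions that is closed under limits. -/
theorem exists_fixedPoint_of_weighted_contraction {α E : Type*} [NormedAddCommGroup E]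
    [CompleteSpace E] {w : α → ℝ} {P : (α → E) → Prop} {V : (α → E) → α → E} {g : α → E} {M : ℝ}
    (hw : ∀ x, 0 ≤ w x) (hg : P g) (hPV : ∀ f, P f → P fun x => g x + V f x)
    (hgM : ∀ x, ‖V g x‖ ≤ M * w x)
    (hV : ∀ f h, P f → P h → ∀ B, 0 ≤ B → (∀ x, ‖f x - h x‖ ≤ B * w x) →
      ∀ x, ‖V f x - V h x‖ ≤ B / 2 * w x)
    (hlim : ∀ (F : ℕ → α → E) (f : α → E) (B : ℝ), (∀ n, P (F n)) →
      (∀ n x, ‖F n x - f x‖ ≤ B * (1 / 2) ^ n * w x) → P f) :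
    ∃ f, P f ∧ ∀ x, f x = g x + V f x := by
  wlog hM : 0 ≤ M generalizing M
  · refine this (M := 0) (fun x => (hgM x).trans ?_) le_rfl
    exact mul_le_mul_of_nonneg_right (not_le.1 hM).le (hw x)
  let F : ℕ → α → E := fun n => Nat.rec g (fun _ f x => g x + V f x) n
  have hFs : ∀ n x, F (n + 1) x = g x + V (F n) x := fun n x => rfl
  have hFP : ∀ n, P (F n) := by
    intro n
    induction n with
    | zero => exact hg
    | succ n ih => exact hPV _ ih
  have hstep : ∀ n x, ‖F (n + 1) x - F n x‖ ≤ M * (1 / 2) ^ n * w x := by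
    intro n
    induction n with
    | zero => intro x; rw [hFs]; simpa [F] using hgM x
    | succ n ih =>
      intro x
      have := hV _ _ (hFP (n + 1)) (hFP n) _ (by positivity) ih x
      rw [hFs (n + 1), hFs n, add_sub_add_left_eq_sub]
      refine this.trans (le_of_eq ?_)
      rw [pow_succ]; ring
  have hd : ∀ x n, dist (F n x) (F (n + 1) x) ≤ (2 * M * w x) / 2 / 2 ^ n := by
    intro x n
    rw [dist_comm, dist_eq_norm]
    refine (hstep n x).trans (le_of_eq ?_)
    rw [one_div, inv_pow]; field_simp
  have hlimx : ∀ x, ∃ y, Filter.Tendsto (fun n => F n x) Filter.atTop (nhds y) := fun x =>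
    cauchySeq_tendsto_of_complete (cauchySeq_of_le_geometric_two (hd x))
  choose f hf using hlimx
  have hb : ∀ n x, ‖F n x - f x‖ ≤ (2 * M) * (1 / 2) ^ n * w x := by
    intro n x
    have := dist_le_of_le_geometric_two_of_tendsto (hd x) (hf x) n
    rw [dist_eq_norm] at this
    refine this.trans (le_of_eq ?_)
    rw [one_div, inv_pow]; field_simp
  have hPf : P f := hlim F f _ hFP hb
  refine ⟨f, hPf, fun x => ?_⟩
  have h1 : ∀ n, ‖F (n + 1) x - (g x + V f x)‖ ≤ (2 * M * w x) * (1 / 2) ^ n := by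
    intro n
    rw [hFs, add_sub_add_left_eq_sub]
    refine (hV _ _ (hFP n) hPf _ (by positivity) (hb n) x).trans ?_
    have : 0 ≤ M * w x * (1 / 2) ^ n := by have := hw x; positivity
    nlinarith
  have h2 : Filter.Tendsto (fun n => F (n + 1) x) Filter.atTop (nhds (g x + V f x)) := by
    rw [tendsto_iff_norm_sub_tendsto_zero]
    refine squeeze_zero (fun n => norm_nonneg _) h1 ?_
    simpa using (tendsto_pow_atTop_nhds_zero_of_lt_one (r := (1 / 2 : ℝ)) (by norm_num)
      (by norm_num)).const_mul (2 * M * w x)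
  exact tendsto_nhds_unique ((Filter.tendsto_add_atTop_iff_nat 1).2 (hf x)) h2

/-- The map B ↦ M + B/2 contracts to its fixed point 2M, so iteration forgets the finite bound one
starts from. With M = 0 this is a uniqueness statement. -/
theorem norm_le_two_mul_of_contraction {α E : Type*} [NormedAddCommGroup E] {w : α → ℝ}
    {D : Set α} {f : α → E} {M B : ℝ} (hw : ∀ x ∈ D, 0 ≤ w x) (hM : 0 ≤ M)
    (hB : ∀ x ∈ D, ‖f x‖ ≤ B * w x)
    (hstep : ∀ B, 0 ≤ B → (∀ x ∈ D, ‖f x‖ ≤ B * w x) → ∀ x ∈ D, ‖f x‖ ≤ (M + B / 2) * w x) :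
    ∀ x ∈ D, ‖f x‖ ≤ 2 * M * w x := by
  have hB' : ∀ x ∈ D, ‖f x‖ ≤ |B| * w x := fun x hx =>
    (hB x hx).trans (mul_le_mul_of_nonneg_right (le_abs_self B) (hw x hx))
  have h : ∀ n : ℕ, ∀ x ∈ D, ‖f x‖ ≤ (2 * M + |B| * (1 / 2) ^ n) * w x := by
    intro n
    induction n with
    | zero =>
      intro x hx
      refine (hB' x hx).trans (mul_le_mul_of_nonneg_right ?_ (hw x hx))
      simp; exact hM
    | succ n ih =>
      intro x hx
      refine (hstep _ (by positivity) ih x hx).trans (le_of_eq ?_)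
      rw [pow_succ]; ring
  intro x hx
  have ht : Filter.Tendsto (fun n : ℕ => (2 * M + |B| * (1 / 2 : ℝ) ^ n) * w x) Filter.atTop
      (nhds ((2 * M + |B| * 0) * w x)) :=
    (((tendsto_pow_atTop_nhds_zero_of_lt_one (by norm_num) (by norm_num)).const_mul _).const_add
      _).mul_const _
  rw [mul_zero, add_zero] at ht
  exact ge_of_tendsto' ht fun n => h n x hx

/-! ### Balance laws over moving intervals. -/

/-- A monotone function that takes the same value at `s' < s` has derivative zero at `s`. -/
theorem deriv_eq_zero_of_monotoneOn_of_eq {m : ℝ → ℝ} {a b s s' d : ℝ} (hm : MonotoneOn m (Icc a b))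
    (hs' : s' ∈ Icc a b) (hs : s ∈ Icc a b) (hlt : s' < s) (heq : m s' = m s)
    (hd : HasDerivAt m d s) : d = 0 := by
  have hc : ∀ x ∈ Icc s' s, m x = m s := fun x hx => by
    have hx' : x ∈ Icc a b := ⟨hs'.1.trans hx.1, hx.2.trans hs.2⟩
    exact le_antisymm (hm hx' hs hx.2) (heq ▸ hm hs' hx' hx.1)
  have h1 : HasDerivWithinAt m 0 (Icc s' s) s :=
    (hasDerivWithinAt_const s (Icc s' s) (m s)).congr hc rfl
  exact (uniqueDiffOn_Icc hlt s (right_mem_Icc.2 hlt.le)).eq_deriv _ hd.hasDerivWithinAt h1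

/-- Balance of `∫ F` over the moving interval `[s, m s]` of labels `η`, for a function `F` whose
increments in time are the integrals of `H` as long as the label is present: labels enter at
the upper end and leave at the lower end. -/
theorem integral_labels_sub_eq {m m' : ℝ → ℝ} {F H : ℝ → ℝ → ℝ} {a b B : ℝ} (hab : a ≤ b)
    (hmc : Continuous m) (hd : ∀ s ∈ Ioo a b, HasDerivAt m (m' s) s)
    (hm' : ∀ s ∈ Ioo a b, 0 ≤ m' s) (hsm : ∀ s ∈ Icc a b, s ≤ m s)
    (hF : Measurable (Function.uncurry F)) (hH : Measurable (Function.uncurry H))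
    (hFB : ∀ s ∈ Icc a b, ∀ η ∈ Icc s (m s), |F η s| ≤ B)
    (hHB : ∀ s ∈ Icc a b, ∀ η ∈ Icc s (m s), |H η s| ≤ B)
    (hinc : ∀ η, ∀ s₁ ∈ Icc a b, ∀ s₂ ∈ Icc a b, s₁ ≤ s₂ → s₂ ≤ η → η ≤ m s₁ →
      F η s₂ - F η s₁ = ∫ s in s₁..s₂, H η s) :
    (∫ η in b..m b, F η b) - ∫ η in a..m a, F η a
      = ∫ s in a..b, (m' s * F (m s) s - F s s + ∫ η in s..m s, H η s) := by
  have haI : a ∈ Icc a b := left_mem_Icc.2 hab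
  have hbI : b ∈ Icc a b := right_mem_Icc.2 hab
  have hmono : MonotoneOn m (Icc a b) := by
    refine monotoneOn_of_deriv_nonneg (convex_Icc a b) hmc.continuousOn ?_ ?_
    · rw [interior_Icc]; exact fun z hz => (hd z hz).differentiableAt.differentiableWithinAt
    · rw [interior_Icc]; intro z hz; rw [(hd z hz).deriv]; exact hm' z hz
  have hmab : m a ≤ m b := hmono haI hbI hab
  have hama : a ≤ m a := hsm a haI
  have hbmb : b ≤ m b := hsm b hbI
  have hamb : a ≤ m b := hama.trans hmab
  have hB : 0 ≤ B := (abs_nonneg _).trans (hFB a haI a ⟨le_rfl, hama⟩)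
  -- The pairs (label, time) for which the label is present. Cutting `H` off outside this set allows
  -- Fubini on a rectangle.
  set R : Set (ℝ × ℝ) := {p | (a ≤ p.2 ∧ p.2 ≤ b) ∧ (p.2 ≤ p.1 ∧ p.1 ≤ m p.2)} with hR
  have hRm : MeasurableSet R :=
    ((measurableSet_le measurable_const measurable_snd).inter
      (measurableSet_le measurable_snd measurable_const)).inter
    ((measurableSet_le measurable_snd measurable_fst).inter
      (measurableSet_le measurable_fst (hmc.measurable.comp measurable_snd)))
  set Hx : ℝ → ℝ → ℝ := fun η s => R.indicator (Function.uncurry H) (η, s) with hHx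
  have hHxm : Measurable (Function.uncurry Hx) := hH.indicator hRm
  have hHxin : ∀ {η s}, s ∈ Icc a b → s ≤ η → η ≤ m s → Hx η s = H η s := fun hs h1 h2 =>
    indicator_of_mem (show (_, _) ∈ R from ⟨hs, h1, h2⟩) _
  have hHxout : ∀ {η s}, ¬ (s ≤ η ∧ η ≤ m s) → Hx η s = 0 := fun h =>
    indicator_of_notMem (fun hh : (_, _) ∈ R => h hh.2) _
  have hHxB : ∀ η s, |Hx η s| ≤ B := by
    intro η s
    by_cases h : (η, s) ∈ R
    · rw [hHxin h.1 h.2.1 h.2.2]; exact hHB s h.1 η h.2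
    · rw [show Hx η s = 0 from indicator_of_notMem h _]; simpa using hB
  have hHxs : ∀ η, Measurable (Hx η) := fun η => hHxm.comp measurable_prodMk_left
  have hHxη : ∀ s, Measurable fun η => Hx η s := fun s => hHxm.comp measurable_prodMk_right
  have hHxint : ∀ η c d, IntervalIntegrable (Hx η) volume c d := fun η c d =>
    intervalIntegrable_of_measurable_of_abs_le (hHxs η) fun x _ => hHxB η x
  -- The last value of a label, taken at the final time b or, if earlier, at the time η when the
  -- label leaves through the lower end.
  set T : ℝ → ℝ := fun η => F η (min b η) with hT
  have hTm : Measurable T := hF.comp (measurable_id.prodMk (measurable_const.min measurable_id))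
  have hTB : ∀ η ∈ Icc a (m b), |T η| ≤ B := by
    intro η hη
    rcases le_total η b with h | h
    · rw [hT]; simp only [min_eq_right h]
      exact hFB η ⟨hη.1, h⟩ η ⟨le_rfl, hsm η ⟨hη.1, h⟩⟩
    · rw [hT]; simp only [min_eq_left h]
      exact hFB b hbI η ⟨h, hη.2⟩
  have hTint : ∀ c ∈ Icc a (m b), ∀ d ∈ Icc a (m b), IntervalIntegrable T volume c d := by
    intro c hc d hd
    exact intervalIntegrable_of_measurable_of_abs_le hTm fun x hx =>
      hTB x (Set.uIcc_subset_Icc hc hd hx)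
  -- The total increment of a label while it is present. For labels that enter after time a, T - Q
  -- is the value at entry.
  set Q : ℝ → ℝ := fun η => ∫ s in a..b, Hx η s with hQ
  have hQm : Measurable Q := measurable_intervalIntegral_param hHxm measurable_const measurable_const
  have hQB : ∀ η, |Q η| ≤ B * |b - a| := fun η => by
    rw [← Real.norm_eq_abs]
    exact intervalIntegral.norm_integral_le_of_norm_le_const fun x _ => hHxB η x
  have hQint : ∀ c d, IntervalIntegrable Q volume c d := fun c d =>
    intervalIntegrable_of_measurable_of_abs_le hQm fun x _ => hQB x
  -- the value at any time in terms of the last value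
  have hval : ∀ η, ∀ s ∈ Icc a b, s ≤ η → η ≤ m s → F η s = T η - ∫ t in s..b, Hx η t := by
    intro η s hs h1 h2
    have hmem : min b η ∈ Icc a b := ⟨le_min hab (hs.1.trans h1), min_le_left _ _⟩
    have h3 := hinc η s hs (min b η) hmem (le_min hs.2 h1) (min_le_right _ _) h2
    have h4 : ∫ t in s..b, Hx η t = ∫ t in s..min b η, H η t := by
      rw [← intervalIntegral.integral_add_adjacent_intervals (hHxint η s (min b η))
        (hHxint η (min b η) b)]
      have e2 : ∫ t in min b η..b, Hx η t = 0 := by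
        refine intervalIntegral.integral_zero_ae (Filter.Eventually.of_forall fun t ht => ?_)
        rw [uIoc_of_le (min_le_left _ _)] at ht
        refine hHxout fun hh => ?_
        have := min_lt_iff.1 ht.1
        rcases this with h | h
        · exact absurd ht.2 (not_le.2 h)
        · exact absurd hh.1 (not_le.2 h)
      rw [e2, add_zero]
      refine intervalIntegral.integral_congr fun t ht => ?_
      rw [uIcc_of_le (le_min hs.2 h1)] at ht
      have htI : t ∈ Icc a b := ⟨hs.1.trans ht.1, ht.2.trans (min_le_left _ _)⟩
      exact hHxin htI (ht.2.trans (min_le_right _ _)) (h2.trans (hmono hs htI ht.1))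
    rw [h4, ← h3]; simp only [hT]; ring
  have hL1 : ∫ η in b..m b, F η b = ∫ η in b..m b, T η := by
    refine intervalIntegral.integral_congr fun η hη => ?_
    rw [uIcc_of_le hbmb] at hη
    simp only [hT, min_eq_left hη.1]
  have hL2 : ∫ η in a..m a, F η a = (∫ η in a..m a, T η) - ∫ η in a..m a, Q η := by
    rw [← intervalIntegral.integral_sub (hTint _ ⟨le_rfl, hamb⟩ _ ⟨hama, hmab⟩) (hQint _ _)]
    refine intervalIntegral.integral_congr fun η hη => ?_
    rw [uIcc_of_le hama] at hη
    exact hval η a haI hη.1 hη.2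
  have hentry : ∀ s ∈ Ioo a b, m' s * F (m s) s = m' s * (T (m s) - Q (m s)) := by
    intro s hs
    have hsI := Ioo_subset_Icc_self hs
    rw [hval (m s) s hsI (hsm s hsI) le_rfl]
    -- Where m' is nonzero, the label m s cannot have been present earlier: m would then be constant
    -- on an interval ending at s. Hence no increment has accumulated before s.
    rcases eq_or_ne (m' s) 0 with h0 | h0
    · simp [h0]
    · have : ∫ t in a..s, Hx (m s) t = 0 := by
        rw [intervalIntegral.integral_of_le hs.1.le, ← integral_Icc_eq_integral_Ioc,
          integral_Icc_eq_integral_Ioo]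
        refine setIntegral_eq_zero_of_forall_eq_zero fun t ht => hHxout fun hh => h0 ?_
        have htI : t ∈ Icc a b := ⟨ht.1.le, ht.2.le.trans hs.2.le⟩
        exact deriv_eq_zero_of_monotoneOn_of_eq hmono htI hsI ht.2
          (le_antisymm (hmono htI hsI ht.2.le) hh.2) (hd s hs)
      have h5 := intervalIntegral.integral_add_adjacent_intervals (hHxint (m s) a s)
        (hHxint (m s) s b)
      rw [this, zero_add] at h5
      rw [h5]
  have hbulk : ∀ s ∈ Icc a b, ∫ η in s..m s, H η s = ∫ η in a..m b, Hx η s := by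
    intro s hs
    have hi : ∀ c d, IntervalIntegrable (fun η => Hx η s) volume c d := fun c d =>
      intervalIntegrable_of_measurable_of_abs_le (hHxη s) fun x _ => hHxB x s
    rw [← intervalIntegral.integral_add_adjacent_intervals (hi a s) (hi s (m b)),
      ← intervalIntegral.integral_add_adjacent_intervals (hi s (m s)) (hi (m s) (m b))]
    have e1 : ∫ η in a..s, Hx η s = 0 := by
      rw [intervalIntegral.integral_of_le hs.1, ← integral_Icc_eq_integral_Ioc,
          integral_Icc_eq_integral_Ioo]
      exact setIntegral_eq_zero_of_forall_eq_zero fun t ht => hHxout fun hh =>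
        absurd hh.1 (not_le.2 ht.2)
    have e2 : ∫ η in m s..m b, Hx η s = 0 := by
      refine intervalIntegral.integral_zero_ae (Filter.Eventually.of_forall fun t ht => ?_)
      rw [uIoc_of_le (hmono hs hbI hs.2)] at ht
      exact hHxout fun hh => absurd hh.2 (not_le.2 ht.1)
    rw [e1, e2, zero_add, add_zero]
    refine intervalIntegral.integral_congr fun η hη => ?_
    rw [uIcc_of_le (hsm s hs)] at hη
    exact (hHxin hs hη.1 hη.2).symm
  have hsub := integral_mul_comp_of_deriv_nonneg hab hmc.continuousOn hd hm' fun η => T η - Q η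
  have hTQ : IntervalIntegrable (fun η => T η - Q η) volume (m a) (m b) :=
    (hTint _ ⟨hama, hmab⟩ _ ⟨hamb, le_rfl⟩).sub (hQint _ _)
  have hsubint : IntervalIntegrable (fun s => m' s * (T (m s) - Q (m s))) volume a b := by
    rw [intervalIntegrable_iff_integrableOn_Icc_of_le hab]
    have := (integrableOn_Icc_deriv_smul_iff_of_deriv_nonneg (g := fun η => T η - Q η)
      hmc.continuousOn hd hm' hab).2
      ((intervalIntegrable_iff_integrableOn_Icc_of_le hmab).1 hTQ)
    simpa using this
  have hswap : ∫ s in a..b, ∫ η in a..m b, Hx η s = ∫ η in a..m b, Q η := by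
    refine intervalIntegral_intervalIntegral_swap (F := fun s η => Hx η s) ?_
    refine Measure.integrableOn_of_bounded (M := B) ?_ ?_ ?_
    · rw [Measure.volume_eq_prod, Measure.prod_prod]
      exact (ENNReal.mul_lt_top (by simp [uIoc]) (by simp [uIoc])).ne
    · exact (hHxm.comp measurable_swap).aestronglyMeasurable
    · exact Filter.Eventually.of_forall fun p => hHxB p.2 p.1
  have hRint : IntervalIntegrable (fun s => ∫ η in a..m b, Hx η s) volume a b := by
    refine intervalIntegrable_of_measurable_of_abs_le (B := B * |m b - a|)
      (measurable_intervalIntegral_param (f := fun s η => Hx η s) (hHxm.comp measurable_swap)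
        measurable_const measurable_const) fun s _ => ?_
    rw [← Real.norm_eq_abs]
    exact intervalIntegral.norm_integral_le_of_norm_le_const fun x _ => hHxB x s
  have hrhs : ∫ s in a..b, (m' s * F (m s) s - F s s + ∫ η in s..m s, H η s)
      = ∫ s in a..b, (m' s * (T (m s) - Q (m s)) - T s + ∫ η in a..m b, Hx η s) := by
    rw [intervalIntegral.integral_of_le hab, intervalIntegral.integral_of_le hab,
      ← integral_Icc_eq_integral_Ioc, ← integral_Icc_eq_integral_Ioc,
      integral_Icc_eq_integral_Ioo, integral_Icc_eq_integral_Ioo]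
    refine setIntegral_congr_fun measurableSet_Ioo fun s hs => ?_
    rw [hentry s hs, hbulk s (Ioo_subset_Icc_self hs)]
    simp only [hT, min_eq_right hs.2.le]
  have hTab := hTint a ⟨le_rfl, hamb⟩ b ⟨hab, hbmb⟩
  rw [hrhs, intervalIntegral.integral_add (hsubint.sub hTab) hRint,
    intervalIntegral.integral_sub hsubint hTab, hsub, hswap, hL1, hL2,
    intervalIntegral.integral_sub (hTint _ ⟨hama, hmab⟩ _ ⟨hamb, le_rfl⟩) (hQint _ _)]
  have t1 := intervalIntegral.integral_add_adjacent_intervals hTab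
    (hTint b ⟨hab, hbmb⟩ (m b) ⟨hamb, le_rfl⟩)
  have t2 := intervalIntegral.integral_add_adjacent_intervals
    (hTint a ⟨le_rfl, hamb⟩ (m a) ⟨hama, hmab⟩) (hTint (m a) ⟨hama, hmab⟩ (m b) ⟨hamb, le_rfl⟩)
  have t3 := intervalIntegral.integral_add_adjacent_intervals (hQint a (m a)) (hQint (m a) (m b))
  linarith

/-- The label η = φ ζ + s is constant along curves of speed -lam, and the substitution has the
Jacobian lam. It turns [0, γ s] into [s, φ (γ s) + s]. The upper end is nondecreasing exactly
because lam + γ' ≥ 0, so `integral_labels_sub_eq` applies. -/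
theorem integral_moving_interval_sub_eq_of_left {lam : ℝ → ℝ} {φ : ℝ ≃o ℝ} {γ γ' : ℝ → ℝ}
    {g h : ℝ → ℝ → ℝ} {a b B Λ : ℝ} (hab : a ≤ b) (hlam : Continuous lam)
    (hpos : ∀ z, 0 < lam z) (hΛ : ∀ z, lam z ≤ Λ) (hφ0 : φ 0 = 0)
    (hφ : ∀ z, HasDerivAt φ (lam z)⁻¹ z) (hγ : ∀ s, HasDerivAt γ (γ' s) s)
    (hγ0 : ∀ s ∈ Icc a b, 0 ≤ γ s) (hmono : ∀ s ∈ Icc a b, 0 ≤ lam (γ s) + γ' s)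
    (hg : Measurable (Function.uncurry g)) (hh : Measurable (Function.uncurry h))
    (hgB : ∀ s ∈ Icc a b, ∀ ζ ∈ Icc 0 (γ s), |g ζ s| ≤ B)
    (hhB : ∀ s ∈ Icc a b, ∀ ζ ∈ Icc 0 (γ s), |h ζ s| ≤ B)
    (hinc : ∀ c, ∀ s₁ ∈ Icc a b, ∀ s₂ ∈ Icc a b, s₁ ≤ s₂ →
      (∀ s ∈ Icc s₁ s₂, φ.symm (c - s) ∈ Icc 0 (γ s)) →
      lam (φ.symm (c - s₂)) * g (φ.symm (c - s₂)) s₂ - lam (φ.symm (c - s₁)) * g (φ.symm (c - s₁)) s₁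
        = ∫ s in s₁..s₂, lam (φ.symm (c - s)) * h (φ.symm (c - s)) s) :
    (∫ ζ in 0..γ b, g ζ b) - ∫ ζ in 0..γ a, g ζ a
      = ∫ s in a..b, ((lam (γ s) + γ' s) * g (γ s) s - lam 0 * g 0 s + ∫ ζ in 0..γ s, h ζ s) := by
  have hX : ∀ t, HasDerivAt φ.symm (lam (φ.symm t)) t := fun t => by
    simpa using OrderIso.hasDerivAt_symm hφ (fun z => inv_ne_zero (hpos z).ne') t
  have hX0 : φ.symm 0 = 0 := φ.symm_apply_eq.2 hφ0.symm
  have hXc : Continuous φ.symm := φ.symm.continuous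
  have hB : 0 ≤ B := (abs_nonneg _).trans (hgB a (left_mem_Icc.2 hab) 0
    ⟨le_rfl, hγ0 a (left_mem_Icc.2 hab)⟩)
  have hγc : Continuous γ := continuous_iff_continuousAt.2 fun z => (hγ z).continuousAt
  set m : ℝ → ℝ := fun s => φ (γ s) + s with hm
  have hmc : Continuous m := (φ.continuous.comp hγc).add continuous_id
  have hmd : ∀ s, HasDerivAt m ((lam (γ s))⁻¹ * γ' s + 1) s := fun s =>
    ((hφ (γ s)).comp s (hγ s)).add (hasDerivAt_id s)
  have hm1 : ∀ s, (lam (γ s))⁻¹ * γ' s + 1 = (lam (γ s) + γ' s) / lam (γ s) := fun s => by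
    field_simp [(hpos (γ s)).ne']; ring
  have hsub : ∀ (q : ℝ → ℝ), ∀ s ∈ Icc a b,
      ∫ η in s..m s, lam (φ.symm (η - s)) * q (φ.symm (η - s)) = ∫ ζ in 0..γ s, q ζ := by
    intro q s hs
    have hsm : s ≤ m s := by
      have : φ 0 ≤ φ (γ s) := φ.monotone (hγ0 s hs)
      simp only [hm]; linarith
    have hd : ∀ η, HasDerivAt (fun η => φ.symm (η - s)) (lam (φ.symm (η - s))) η := fun η =>
      (hX (η - s)).comp_sub_const η s
    rw [integral_mul_comp_of_deriv_nonneg hsm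
      (continuous_iff_continuousAt.2 fun z => (hd z).continuousAt).continuousOn
      (fun η _ => hd η) (fun η _ => (hpos _).le)]
    simp [hm, hX0]
  have hmemReg : ∀ s, ∀ η ∈ Icc s (m s), φ.symm (η - s) ∈ Icc 0 (γ s) := by
    intro s η hη
    constructor
    · rw [← hX0]; exact φ.symm.monotone (by linarith [hη.1])
    · rw [← φ.symm_apply_apply (γ s)]
      refine φ.symm.monotone ?_
      have := hη.2
      simp only [hm] at this; linarith
  have hmeas : ∀ {q : ℝ → ℝ → ℝ}, Measurable (Function.uncurry q) →
      Measurable (Function.uncurry fun η s => lam (φ.symm (η - s)) * q (φ.symm (η - s)) s) := by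
    intro q hq
    have h1 : Measurable fun p : ℝ × ℝ => φ.symm (p.1 - p.2) :=
      hXc.measurable.comp (measurable_fst.sub measurable_snd)
    exact (hlam.measurable.comp h1).mul (hq.comp (h1.prodMk measurable_snd))
  have hmonoOn : MonotoneOn m (Icc a b) := by
    refine monotoneOn_of_deriv_nonneg (convex_Icc a b) hmc.continuousOn
      (fun z _ => (hmd z).differentiableAt.differentiableWithinAt) fun z hz => ?_
    rw [(hmd z).deriv, hm1]
    exact div_nonneg (hmono z (interior_subset hz)) (hpos _).le
  have key := integral_labels_sub_eq (m := m) (m' := fun s => (lam (γ s))⁻¹ * γ' s + 1)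
    (F := fun η s => lam (φ.symm (η - s)) * g (φ.symm (η - s)) s)
    (H := fun η s => lam (φ.symm (η - s)) * h (φ.symm (η - s)) s) (B := Λ * B) hab hmc
    (fun s _ => hmd s)
    (fun s hs => by
      rw [hm1]; exact div_nonneg (hmono s (Ioo_subset_Icc_self hs)) (hpos _).le)
    (fun s hs => by
      have : φ 0 ≤ φ (γ s) := φ.monotone (hγ0 s hs)
      simp only [hm]; linarith)
    (hmeas hg) (hmeas hh)
    (fun s hs η hη => by
      rw [abs_mul, abs_of_pos (hpos _)]
      exact mul_le_mul (hΛ _) (hgB s hs _ (hmemReg s η hη)) (abs_nonneg _)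
        ((hpos 0).le.trans (hΛ 0)))
    (fun s hs η hη => by
      rw [abs_mul, abs_of_pos (hpos _)]
      exact mul_le_mul (hΛ _) (hhB s hs _ (hmemReg s η hη)) (abs_nonneg _)
        ((hpos 0).le.trans (hΛ 0)))
    (fun η s₁ h₁ s₂ h₂ h12 hη1 hη2 => by
      refine hinc η s₁ h₁ s₂ h₂ h12 fun s hs => hmemReg s η ⟨hs.2.trans hη1, hη2.trans ?_⟩
      exact hmonoOn h₁ ⟨h₁.1.trans hs.1, hs.2.trans h₂.2⟩ hs.1)
  rw [hsub (fun ζ => g ζ b) b (right_mem_Icc.2 hab), hsub (fun ζ => g ζ a) a (left_mem_Icc.2 hab)]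
    at key
  rw [key]
  refine intervalIntegral.integral_congr fun s hs => ?_
  rw [uIcc_of_le hab] at hs
  rw [hsub (fun ζ => h ζ s) s hs, hm1]
  simp only [hm, add_sub_cancel_right, sub_self, hX0, φ.symm_apply_apply]
  field_simp [(hpos (γ s)).ne']

/-- Reynolds' transport theorem along characteristics: if `lam * g` has the increments `∫ lam * h`
along the curves `φ.symm (c - σ s)`, of speed `-σ lam`, then `∫ g` over the moving interval
`[0, γ s]` changes by the flux through its ends and by `∫ h`. -/
theorem integral_moving_interval_sub_eq {lam : ℝ → ℝ} {φ : ℝ ≃o ℝ} {γ γ' : ℝ → ℝ}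
    {g h : ℝ → ℝ → ℝ} {a b B Λ σ : ℝ} (hσ : σ = 1 ∨ σ = -1) (hab : a ≤ b) (hlam : Continuous lam)
    (hpos : ∀ z, 0 < lam z) (hΛ : ∀ z, lam z ≤ Λ) (hφ0 : φ 0 = 0)
    (hφ : ∀ z, HasDerivAt φ (lam z)⁻¹ z) (hγ : ∀ s, HasDerivAt γ (γ' s) s)
    (hγ0 : ∀ s ∈ Icc a b, 0 ≤ γ s) (hmono : ∀ s ∈ Icc a b, 0 ≤ lam (γ s) + σ * γ' s)
    (hg : Measurable (Function.uncurry g)) (hh : Measurable (Function.uncurry h))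
    (hgB : ∀ s ∈ Icc a b, ∀ ζ ∈ Icc 0 (γ s), |g ζ s| ≤ B)
    (hhB : ∀ s ∈ Icc a b, ∀ ζ ∈ Icc 0 (γ s), |h ζ s| ≤ B)
    (hinc : ∀ c, ∀ s₁ ∈ Icc a b, ∀ s₂ ∈ Icc a b, s₁ ≤ s₂ →
      (∀ s ∈ Icc s₁ s₂, φ.symm (c - σ * s) ∈ Icc 0 (γ s)) →
      lam (φ.symm (c - σ * s₂)) * g (φ.symm (c - σ * s₂)) s₂
          - lam (φ.symm (c - σ * s₁)) * g (φ.symm (c - σ * s₁)) s₁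
        = ∫ s in s₁..s₂, lam (φ.symm (c - σ * s)) * h (φ.symm (c - σ * s)) s) :
    (∫ ζ in 0..γ b, g ζ b) - ∫ ζ in 0..γ a, g ζ a
      = ∫ s in a..b, ((σ * lam (γ s) + γ' s) * g (γ s) s - σ * lam 0 * g 0 s
          + ∫ ζ in 0..γ s, h ζ s) := by
  rcases hσ with rfl | rfl
  · simp only [one_mul] at *
    exact integral_moving_interval_sub_eq_of_left hab hlam hpos hΛ hφ0 hφ hγ hγ0 hmono hg hh hgB hhB
      hinc
  -- Time reversal reduces this direction of travel to the other one. It changes the signs of γ' and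
  -- of the source.
  · have hneg : ∀ {s}, s ∈ Icc (-b) (-a) → -s ∈ Icc a b := fun hs =>
      ⟨by linarith [hs.2], by linarith [hs.1]⟩
    have hmeas : ∀ {q : ℝ → ℝ → ℝ}, Measurable (Function.uncurry q) →
        Measurable (Function.uncurry fun ζ s => q ζ (-s)) := fun hq =>
      hq.comp (measurable_fst.prodMk measurable_snd.neg)
    have key := integral_moving_interval_sub_eq_of_left (γ := fun s => γ (-s))
      (γ' := fun s => -γ' (-s)) (g := fun ζ s => g ζ (-s)) (h := fun ζ s => -h ζ (-s))
      (neg_le_neg hab) hlam hpos hΛ hφ0 hφ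
      (fun s => by simpa [Function.comp_def] using (hγ (-s)).comp s (hasDerivAt_neg s))
      (fun s hs => hγ0 _ (hneg hs))
      (fun s hs => by have := hmono _ (hneg hs); linarith)
      (hmeas hg) (hmeas hh).neg (fun s hs => hgB _ (hneg hs))
      (fun s hs ζ hζ => by rw [abs_neg]; exact hhB _ (hneg hs) ζ hζ)
      (fun c s₁ h₁ s₂ h₂ h12 hr => by
        have := hinc c (-s₂) (hneg h₂) (-s₁) (hneg h₁) (neg_le_neg h12) (fun s hs => by
          have := hr (-s) ⟨by linarith [hs.2], by linarith [hs.1]⟩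
          simpa using this)
        simp only [neg_mul, one_mul, sub_neg_eq_add, ← sub_eq_add_neg] at this
        rw [← intervalIntegral.integral_comp_neg] at this
        simp only [← sub_eq_add_neg] at this
        simp only [mul_neg, intervalIntegral.integral_neg]
        linarith)
    simp only [neg_neg] at key
    have hflip := intervalIntegral.integral_comp_neg (a := -b) (b := -a)
      (fun s => (-1 * lam (γ s) + γ' s) * g (γ s) s - -1 * lam 0 * g 0 s + ∫ ζ in 0..γ s, h ζ s)
    rw [neg_neg, neg_neg] at hflip
    rw [← hflip, ← neg_sub (∫ ζ in 0..γ a, g ζ a), key,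
      ← intervalIntegral.integral_neg]
    refine intervalIntegral.integral_congr fun s _ => ?_
    simp only [intervalIntegral.integral_neg]
    ring

/-! ### Extension of states and trajectories to the plane. -/

/-- The retraction of the real line onto the unit interval. -/
def unitClamp (z : ℝ) : ℝ := max 0 (min 1 z)

theorem unitClamp_mem (z : ℝ) : unitClamp z ∈ Icc (0 : ℝ) 1 :=
  ⟨le_max_left _ _, max_le zero_le_one (min_le_left _ _)⟩

theorem unitClamp_of_mem {z : ℝ} (hz : z ∈ Icc (0 : ℝ) 1) : unitClamp z = z := by
  rw [unitClamp, min_eq_right hz.2, max_eq_right hz.1]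

theorem continuous_unitClamp : Continuous unitClamp := by unfold unitClamp; fun_prop

theorem ContinuousOn.comp_unitClamp {f : ℝ → ℝ} (hf : ContinuousOn f (Icc 0 1)) :
    Continuous fun z => f (unitClamp z) :=
  hf.comp_continuous continuous_unitClamp unitClamp_mem

theorem ContinuousOn.exists_abs_comp_unitClamp_le {f : ℝ → ℝ} (hf : ContinuousOn f (Icc 0 1)) :
    ∃ M, ∀ z, |f (unitClamp z)| ≤ M := by
  obtain ⟨M, hM⟩ := isCompact_Icc.exists_bound_of_continuousOn hf
  exact ⟨M, fun z => hM _ (unitClamp_mem z)⟩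

/-- A distributed trajectory that is measurable on the whole plane and bounded on bounded time
intervals. -/
def IsExtendedTrajectory (y : ℝ → ℝ → Fin 2 → ℝ) : Prop :=
  Measurable (Function.uncurry y) ∧ ∀ T : ℝ, ∃ M : ℝ, ∀ z, ∀ t ≤ T, ‖y z t‖ ≤ M

theorem IsExtendedTrajectory.measurable_coord {y : ℝ → ℝ → Fin 2 → ℝ} (hy : IsExtendedTrajectory y)
    (i : Fin 2) : Measurable (Function.uncurry fun z t => y z t i) :=
  (measurable_pi_apply i).comp hy.1

theorem IsExtendedTrajectory.of_coord {y : ℝ → ℝ → Fin 2 → ℝ}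
    (hm : ∀ i, Measurable (Function.uncurry fun z t => y z t i))
    (hb : ∀ i, ∀ T : ℝ, ∃ M : ℝ, ∀ z, ∀ t ≤ T, |y z t i| ≤ M) : IsExtendedTrajectory y := by
  refine ⟨measurable_pi_iff.2 hm, fun T => ?_⟩
  choose M hM using fun i => hb i T
  refine ⟨max (M 0) (M 1), fun z t ht => ?_⟩
  have h0 : (0 : ℝ) ≤ max (M 0) (M 1) := ((abs_nonneg _).trans (hM 0 z t ht)).trans (le_max_left _ _)
  rw [pi_norm_le_iff_of_nonneg h0]
  intro i
  fin_cases i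
  · exact (hM 0 z t ht).trans (le_max_left _ _)
  · exact (hM 1 z t ht).trans (le_max_right _ _)

/-- The extension of a trajectory from `[0, 1] × [0, ∞)` to the plane by retraction. -/
def extendTrajectory (x : ℝ → ℝ → Fin 2 → ℝ) (z t : ℝ) : Fin 2 → ℝ := x (unitClamp z) (max 0 t)

theorem extendTrajectory_of_mem (x : ℝ → ℝ → Fin 2 → ℝ) {z t : ℝ} (hz : z ∈ Icc (0 : ℝ) 1)
    (ht : 0 ≤ t) : extendTrajectory x z t = x z t := by
  rw [extendTrajectory, unitClamp_of_mem hz, max_eq_right ht]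

theorem IsStateTrajectory.extend {x : ℝ → ℝ → Fin 2 → ℝ} (hx : IsStateTrajectory x) :
    IsExtendedTrajectory (extendTrajectory x) := by
  constructor
  · have h : Measurable fun p : ℝ × ℝ =>
        (⟨(unitClamp p.1, max 0 p.2), unitClamp_mem _, mem_Ici.2 (le_max_left _ _)⟩ :
          (Icc (0 : ℝ) 1 ×ˢ Ici (0 : ℝ) : Set (ℝ × ℝ))) := by
      refine Measurable.subtype_mk ?_
      exact ((continuous_unitClamp.comp continuous_fst).prodMk
        (continuous_const.max continuous_snd)).measurable
    exact hx.1.comp h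
  · intro T
    obtain ⟨M, hM⟩ := hx.2 (max 0 T)
    exact ⟨M, fun z t ht => hM _ (unitClamp_mem z) _ ⟨le_max_left _ _, max_le_max le_rfl ht⟩⟩

theorem IsExtendedTrajectory.isStateTrajectory {y x : ℝ → ℝ → Fin 2 → ℝ}
    (hy : IsExtendedTrajectory y)
    (hxy : ∀ z ∈ Icc (0 : ℝ) 1, ∀ t, 0 ≤ t → x z t = y z t) : IsStateTrajectory x := by
  constructor
  · have : (Icc (0 : ℝ) 1 ×ˢ Ici (0 : ℝ)).domRestrict (fun p : ℝ × ℝ => x p.1 p.2)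
        = fun p : (Icc (0 : ℝ) 1 ×ˢ Ici (0 : ℝ) : Set (ℝ × ℝ)) => Function.uncurry y p.1 :=
      funext fun p => hxy _ p.2.1 _ p.2.2
    rw [this]
    exact hy.1.comp measurable_subtype_coe
  · intro T
    obtain ⟨M, hM⟩ := hy.2 T
    exact ⟨M, fun z hz t ht => by rw [hxy z hz t ht.1]; exact hM z t ht.2⟩

theorem IsState.isStateTrajectory {w : ℝ → Fin 2 → ℝ} (hw : IsState w) :
    IsStateTrajectory fun z _ => w z := by
  obtain ⟨M, hM⟩ := hw.2
  refine ⟨?_, fun T => ⟨M, fun z hz t _ => hM z hz⟩⟩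
  have h : Measurable fun p : (Icc (0 : ℝ) 1 ×ˢ Ici (0 : ℝ) : Set (ℝ × ℝ)) =>
      (⟨p.1.1, p.2.1⟩ : Icc (0 : ℝ) 1) :=
    Measurable.subtype_mk (measurable_fst.comp measurable_subtype_coe)
  exact hw.1.comp h

theorem IsStateTrajectory.isState {x : ℝ → ℝ → Fin 2 → ℝ} (hx : IsStateTrajectory x) {t : ℝ}
    (ht : 0 ≤ t) : IsState fun z => x z t := by
  obtain ⟨M, hM⟩ := hx.2 t
  refine ⟨?_, M, fun z hz => hM z hz t ⟨ht, le_rfl⟩⟩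
  have h : Measurable fun z : Icc (0 : ℝ) 1 =>
      (⟨(z.1, t), z.2, ht⟩ : (Icc (0 : ℝ) 1 ×ˢ Ici (0 : ℝ) : Set (ℝ × ℝ))) :=
    Measurable.subtype_mk (measurable_subtype_coe.prodMk measurable_const)
  exact hx.1.comp h

theorem IsState.congr {v w : ℝ → Fin 2 → ℝ} (hw : IsState w) (h : EqOn v w (Icc 0 1)) :
    IsState v := by
  obtain ⟨M, hM⟩ := hw.2
  refine ⟨?_, M, fun z hz => by rw [h hz]; exact hM z hz⟩
  have : (Icc (0 : ℝ) 1).domRestrict v = (Icc (0 : ℝ) 1).domRestrict w :=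
    funext fun z => h z.2
  rw [this]; exact hw.1

/-! ### Travel times, characteristics and scaled coefficients. -/

/-- The sign of the transport direction. -/
def travelSign : Fin 2 → ℝ := ![1, -1]

theorem travelSign_eq (i : Fin 2) : travelSign i = 1 ∨ travelSign i = -1 := by
  fin_cases i <;> simp [travelSign]

theorem travelSign_mul_self (i : Fin 2) : travelSign i * travelSign i = 1 := by
  fin_cases i <;> simp [travelSign]

namespace PDEODESystem

variable {n : ℕ} (S : PDEODESystem n)

/-- The velocities, extended to the real line. -/
def speed (i : Fin 2) (z : ℝ) : ℝ := S.lam i (unitClamp z)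

theorem speed_of_mem (i : Fin 2) {z : ℝ} (hz : z ∈ Icc (0 : ℝ) 1) : S.speed i z = S.lam i z := by
  rw [speed, unitClamp_of_mem hz]

theorem speed_pos (i : Fin 2) (z : ℝ) : 0 < S.speed i z := S.lam_pos i _ (unitClamp_mem z)

theorem continuous_speed (i : Fin 2) : Continuous (S.speed i) := (S.lam_cont i).comp_unitClamp

theorem exists_speed_le : ∃ Λ : ℝ, ∀ i z, S.speed i z ≤ Λ := by
  choose M hM using fun i => (S.lam_cont i).exists_abs_comp_unitClamp_le
  refine ⟨max (M 0) (M 1), fun i z => ?_⟩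
  have := (le_abs_self _).trans (hM i z)
  fin_cases i
  · exact this.trans (le_max_left _ _)
  · exact this.trans (le_max_right _ _)

theorem exists_inv_speed_le : ∃ Λ : ℝ, 0 < Λ ∧ ∀ i z, (S.speed i z)⁻¹ ≤ Λ := by
  choose M hM using fun i => ((S.lam_cont i).inv₀
    fun z hz => (S.lam_pos i z hz).ne').exists_abs_comp_unitClamp_le
  refine ⟨max (max (M 0) (M 1)) 1, by positivity, fun i z => ?_⟩
  have := (le_abs_self _).trans (hM i z)
  fin_cases i
  · exact this.trans ((le_max_left _ _).trans (le_max_left _ _))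
  · exact this.trans ((le_max_right _ _).trans (le_max_left _ _))

theorem exists_phi (i : Fin 2) : ∃ e : ℝ ≃o ℝ, e 0 = 0 ∧ ∀ z, HasDerivAt e (S.speed i z)⁻¹ z := by
  obtain ⟨Λ, hΛ⟩ := S.exists_speed_le
  have hpos : 0 < Λ := (S.speed_pos i 0).trans_le (hΛ i 0)
  exact exists_orderIso_hasDerivAt ((S.continuous_speed i).inv₀ fun z => (S.speed_pos i z).ne')
    (inv_pos.2 hpos) fun z => inv_anti₀ (S.speed_pos i z) (hΛ i z)

/-- The travel time from the boundary `z = 0`. -/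
noncomputable def phi (i : Fin 2) : ℝ ≃o ℝ := (S.exists_phi i).choose

theorem phi_zero (i : Fin 2) : S.phi i 0 = 0 := (S.exists_phi i).choose_spec.1

theorem phi_symm_zero (i : Fin 2) : (S.phi i).symm 0 = 0 :=
  (S.phi i).symm_apply_eq.2 (S.phi_zero i).symm

theorem hasDerivAt_phi (i : Fin 2) (z : ℝ) : HasDerivAt (S.phi i) (S.speed i z)⁻¹ z :=
  (S.exists_phi i).choose_spec.2 z

theorem hasDerivAt_phi_symm (i : Fin 2) (t : ℝ) :
    HasDerivAt (S.phi i).symm (S.speed i ((S.phi i).symm t)) t := by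
  simpa using OrderIso.hasDerivAt_symm (S.hasDerivAt_phi i)
    (fun z => inv_ne_zero (S.speed_pos i z).ne') t

theorem phi_nonneg (i : Fin 2) {z : ℝ} (hz : 0 ≤ z) : 0 ≤ S.phi i z := by
  rw [← S.phi_zero i]; exact (S.phi i).monotone hz

theorem phi_symm_nonneg (i : Fin 2) {t : ℝ} (ht : 0 ≤ t) : 0 ≤ (S.phi i).symm t := by
  rw [← S.phi_symm_zero i]; exact (S.phi i).symm.monotone ht

theorem Lam_diag (i : Fin 2) {z : ℝ} (hz : z ∈ Icc (0 : ℝ) 1) :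
    S.Lam z i i = travelSign i * S.speed i z := by
  fin_cases i <;> simp [Lam, travelSign, S.speed_of_mem _ hz]

/-- The characteristic curves `s ↦ (characteristic i c s, s)` of the `i`-th transport equation. -/
noncomputable def characteristic (i : Fin 2) (c s : ℝ) : ℝ := (S.phi i).symm (c - travelSign i * s)

theorem hasDerivAt_characteristic (i : Fin 2) (c s : ℝ) :
    HasDerivAt (S.characteristic i c)
      (-(travelSign i * S.speed i (S.characteristic i c s))) s := by
  have h : HasDerivAt (fun s => c - travelSign i * s) (-travelSign i) s := by
    simpa using ((hasDerivAt_id s).const_mul (travelSign i)).const_sub c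
  have := (S.hasDerivAt_phi_symm i (c - travelSign i * s)).comp s h
  rw [mul_comm, neg_mul] at this
  exact this

theorem continuous_characteristic (i : Fin 2) (c : ℝ) : Continuous (S.characteristic i c) :=
  continuous_iff_continuousAt.2 fun s => (S.hasDerivAt_characteristic i c s).continuousAt

/-- A curve of velocity `θ λᵢ` has travel time coordinate of slope `θ`. -/
theorem phi_eq_of_hasDerivWithinAt {i : Fin 2} {θ a b : ℝ} {p : ℝ → ℝ}
    (hp : ∀ s ∈ Icc a b, HasDerivWithinAt p (θ * S.speed i (p s)) (Icc a b) s) :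
    ∀ s ∈ Icc a b, S.phi i (p s) = S.phi i (p a) + θ * (s - a) := by
  intro s hs
  have hab : a ≤ b := hs.1.trans hs.2
  have hd : ∀ s ∈ Icc a b, HasDerivWithinAt (fun s => S.phi i (p s) - θ * s) 0 (Icc a b) s := by
    intro s hs
    have h1 := (S.hasDerivAt_phi i (p s)).comp_hasDerivWithinAt s (hp s hs)
    have h2 := h1.sub (((hasDerivAt_id s).const_mul θ).hasDerivWithinAt (s := Icc a b))
    have e : (S.speed i (p s))⁻¹ * (θ * S.speed i (p s)) - θ * 1 = 0 := by
      field_simp [(S.speed_pos i (p s)).ne']; ring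
    rw [e] at h2
    exact h2
  have := constant_of_has_deriv_right_zero (f := fun s => S.phi i (p s) - θ * s)
    (fun s hs => (hd s hs).continuousWithinAt)
    (fun s hs => ((hd s (Ico_subset_Icc_self hs)).mono_of_mem_nhdsWithin
      (Icc_mem_nhdsGE_of_mem hs))) s hs
  linarith

/-- The transport equations, along the explicit characteristics. -/
def Transports (f y : ℝ → ℝ → Fin 2 → ℝ) : Prop :=
  ∀ (i : Fin 2) (c a b : ℝ), 0 ≤ a → a ≤ b →
    (∀ s ∈ Icc a b, S.characteristic i c s ∈ Icc (0 : ℝ) 1) →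
    y (S.characteristic i c b) b i - y (S.characteristic i c a) a i
      = ∫ s in a..b, f (S.characteristic i c s) s i

/-- In the travel time coordinate every admissible curve is affine with the prescribed slope, hence
it is one of the explicit characteristics. This replaces a uniqueness theorem for γ' = -Λᵢᵢ(γ),
which could not rely on a Lipschitz condition here. -/
theorem solvesTransport_iff (f y : ℝ → ℝ → Fin 2 → ℝ) :
    SolvesTransport S.Lam f y ↔ S.Transports f y := by
  constructor
  · intro h i c a b ha hab hc
    refine h i a b _ ha hab fun s hs => ⟨hc s hs, ?_⟩
    rw [S.Lam_diag i (hc s hs)]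
    exact (S.hasDerivAt_characteristic i c s).hasDerivWithinAt
  · intro h i a b γ ha hab hγ
    have hphi := S.phi_eq_of_hasDerivWithinAt (i := i) (θ := -travelSign i) (p := γ) (a := a)
      (b := b) fun s hs => by
        have := (hγ s hs).2
        rw [S.Lam_diag i (hγ s hs).1] at this
        simpa using this
    set c := S.phi i (γ a) + travelSign i * a with hc
    have heq : ∀ s ∈ Icc a b, γ s = S.characteristic i c s := by
      intro s hs
      rw [characteristic, eq_comm, OrderIso.symm_apply_eq, hphi s hs]
      ring
    have := h i c a b ha hab fun s hs => heq s hs ▸ (hγ s hs).1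
    rw [heq b (right_mem_Icc.2 hab), heq a (left_mem_Icc.2 hab), this]
    refine intervalIntegral.integral_congr fun s hs => ?_
    rw [uIcc_of_le hab] at hs
    simp only [heq s hs]

/-- A single instant does not contribute to the integral, so the sources may differ at t = 0. This
is why a boundary condition imposed only for t > 0 is enough to rewrite the source. -/
theorem Transports.congr {f f' y y' : ℝ → ℝ → Fin 2 → ℝ} (h : S.Transports f y)
    (hf : ∀ z ∈ Icc (0 : ℝ) 1, ∀ t, 0 < t → f' z t = f z t)
    (hy : ∀ z ∈ Icc (0 : ℝ) 1, ∀ t, 0 ≤ t → y' z t = y z t) : S.Transports f' y' := by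
  intro i c a b ha hab hc
  rw [hy _ (hc b (right_mem_Icc.2 hab)) b (ha.trans hab), hy _ (hc a (left_mem_Icc.2 hab)) a ha,
    h i c a b ha hab hc]
  refine intervalIntegral.integral_congr_ae (Filter.Eventually.of_forall fun s hs => ?_)
  rw [uIoc_of_le hab] at hs
  rw [hf _ (hc s (Ioc_subset_Icc_self hs)) s (ha.trans_lt hs.1)]

/-- The coupling coefficients, extended to the real line. -/
def coupling (i j : Fin 2) (z : ℝ) : ℝ := S.A (unitClamp z) i j

theorem continuous_coupling (i j : Fin 2) : Continuous (S.coupling i j) :=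
  (S.A_cont i j).comp_unitClamp

theorem hasDerivAt_alphaExt (i : Fin 2) (z : ℝ) :
    HasDerivAt (fun z => ∫ ζ in (0 : ℝ)..z, S.coupling i i ζ / S.speed i ζ)
      (S.coupling i i z / S.speed i z) z := by
  have hc : Continuous fun ζ => S.coupling i i ζ / S.speed i ζ :=
    (S.continuous_coupling i i).div (S.continuous_speed i) fun z => (S.speed_pos i z).ne'
  exact intervalIntegral.integral_hasDerivAt_right (hc.intervalIntegrable _ _)
    hc.aestronglyMeasurable.stronglyMeasurableAtFilter hc.continuousAt

theorem alpha_eq (i : Fin 2) {z : ℝ} (hz : z ∈ Icc (0 : ℝ) 1) :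
    S.alpha i z = ∫ ζ in (0 : ℝ)..z, S.coupling i i ζ / S.speed i ζ := by
  refine intervalIntegral.integral_congr fun ζ hζ => ?_
  rw [uIcc_of_le hz.1] at hζ
  have : ζ ∈ Icc (0 : ℝ) 1 := ⟨hζ.1, hζ.2.trans hz.2⟩
  simp only [coupling, speed, unitClamp_of_mem this]

theorem continuousOn_alpha (i : Fin 2) : ContinuousOn (S.alpha i) (Icc 0 1) :=
  (continuous_iff_continuousAt.2 fun z => (S.hasDerivAt_alphaExt i z).continuousAt).continuousOn.congr
    fun _ hz => S.alpha_eq i hz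

/-- The diagonal entries of `E`, extended to the real line. -/
noncomputable def scaling (i : Fin 2) (z : ℝ) : ℝ :=
  Real.exp (travelSign i * ∫ ζ in (0 : ℝ)..z, S.coupling i i ζ / S.speed i ζ)

theorem scaling_pos (i : Fin 2) (z : ℝ) : 0 < S.scaling i z := Real.exp_pos _

theorem hasDerivAt_scaling (i : Fin 2) (z : ℝ) :
    HasDerivAt (S.scaling i)
      (S.scaling i z * (travelSign i * (S.coupling i i z / S.speed i z))) z :=
  ((S.hasDerivAt_alphaExt i z).const_mul (travelSign i)).exp

theorem continuous_scaling (i : Fin 2) : Continuous (S.scaling i) :=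
  continuous_iff_continuousAt.2 fun s => (S.hasDerivAt_scaling i s).continuousAt

theorem scaling_zero (i : Fin 2) : S.scaling i 0 = 1 := by simp [scaling]

theorem E_mulVec (v : Fin 2 → ℝ) (i : Fin 2) {z : ℝ} (hz : z ∈ Icc (0 : ℝ) 1) :
    (S.E z *ᵥ v) i = S.scaling i z * v i := by
  fin_cases i <;>
    simp [E, scaling, travelSign, S.alpha_eq _ hz, Matrix.mulVec, dotProduct, Fin.sum_univ_two]

/-- The scaled coupling coefficients, extended to the real line. -/
noncomputable def scaledCoupling (i j : Fin 2) (z : ℝ) : ℝ := S.Atilde (unitClamp z) i j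

theorem continuousOn_Atilde (i j : Fin 2) : ContinuousOn (fun z => S.Atilde z i j) (Icc 0 1) := by
  have h0 := S.continuousOn_alpha 0
  have h1 := S.continuousOn_alpha 1
  fin_cases i <;> fin_cases j
  · simpa [Atilde] using continuousOn_const
  · simpa [Atilde] using (S.A_cont 0 1).fun_mul (h0.add h1).rexp
  · simpa [Atilde] using (S.A_cont 1 0).fun_mul (h0.neg.sub h1).rexp
  · simpa [Atilde] using continuousOn_const

theorem continuous_scaledCoupling (i j : Fin 2) : Continuous (S.scaledCoupling i j) :=
  (S.continuousOn_Atilde i j).comp_unitClamp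

theorem exists_scaledCoupling_le : ∃ M : ℝ, 0 ≤ M ∧ ∀ i j z, |S.scaledCoupling i j z| ≤ M := by
  choose M hM using fun i j => (S.continuousOn_Atilde i j).exists_abs_comp_unitClamp_le
  have h0 : ∀ i j, 0 ≤ M i j := fun i j => (abs_nonneg _).trans (hM i j 0)
  refine ⟨∑ i, ∑ j, M i j, Finset.sum_nonneg fun i _ => Finset.sum_nonneg fun j _ => h0 i j,
    fun i j z => (hM i j z).trans ?_⟩
  refine (Finset.single_le_sum (f := fun j => M i j) (fun j _ => h0 i j) (Finset.mem_univ j)).trans ?_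
  exact Finset.single_le_sum (f := fun i => ∑ j, M i j)
    (fun i _ => Finset.sum_nonneg fun j _ => h0 i j) (Finset.mem_univ i)

end PDEODESystem

/-! ### The kernel equations along pairs of characteristics. -/

/-- A kernel on the triangle `0 ≤ ζ ≤ z ≤ 1`, extended to the plane by retraction. -/
def kernelExt (K : ℝ → ℝ → Matrix (Fin 2) (Fin 2) ℝ) (i j : Fin 2) (z ζ : ℝ) : ℝ :=
  K (unitClamp z) (max 0 (min ζ (unitClamp z))) i j

theorem kernelExt_of_mem (K : ℝ → ℝ → Matrix (Fin 2) (Fin 2) ℝ) (i j : Fin 2) {z ζ : ℝ}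
    (h0 : 0 ≤ ζ) (h1 : ζ ≤ z) (h2 : z ≤ 1) : kernelExt K i j z ζ = K z ζ i j := by
  rw [kernelExt, unitClamp_of_mem ⟨h0.trans h1, h2⟩, min_eq_left h1, max_eq_right h0]

namespace PDEODESystem

variable {n : ℕ} {S : PDEODESystem n} {K : ℝ → ℝ → Matrix (Fin 2) (Fin 2) ℝ}

theorem IsKernel.continuous_kernelExt (hK : S.IsKernel K) (i j : Fin 2) :
    Continuous (Function.uncurry (kernelExt K i j)) := by
  have hc : Continuous fun p : ℝ × ℝ =>
      (unitClamp p.1, max 0 (min p.2 (unitClamp p.1))) := by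
    have := continuous_unitClamp
    fun_prop
  exact (hK.cont i j).comp_continuous hc fun p =>
    ⟨le_max_left _ _, max_le (unitClamp_mem _).1 (min_le_right _ _), (unitClamp_mem _).2⟩

theorem IsKernel.exists_kernelExt_le (hK : S.IsKernel K) :
    ∃ M : ℝ, 0 ≤ M ∧ ∀ i j z ζ, |kernelExt K i j z ζ| ≤ M := by
  have hcomp : IsCompact ((Icc (0 : ℝ) 1) ×ˢ (Icc (0 : ℝ) 1)) := isCompact_Icc.prod isCompact_Icc
  choose M hM using fun i j => hcomp.exists_bound_of_continuousOn
    (hK.continuous_kernelExt i j).continuousOn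
  have hred : ∀ i j z ζ, |kernelExt K i j z ζ| ≤ M i j := by
    intro i j z ζ
    have h1 : 0 ≤ max 0 (min ζ (unitClamp z)) := le_max_left _ _
    have h2 : max 0 (min ζ (unitClamp z)) ≤ unitClamp z :=
      max_le (unitClamp_mem z).1 (min_le_right _ _)
    have h3 := hM i j (unitClamp z, max 0 (min ζ (unitClamp z)))
      ⟨unitClamp_mem z, h1, h2.trans (unitClamp_mem z).2⟩
    simp only [Function.uncurry] at h3
    rw [kernelExt_of_mem K i j h1 h2 (unitClamp_mem z).2] at h3
    exact h3
  have h0 : ∀ i j, 0 ≤ M i j := fun i j => (abs_nonneg _).trans (hred i j 0 0)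
  refine ⟨∑ i, ∑ j, M i j, Finset.sum_nonneg fun i _ => Finset.sum_nonneg fun j _ => h0 i j,
    fun i j z ζ => (hred i j z ζ).trans ?_⟩
  refine (Finset.single_le_sum (f := fun j => M i j) (fun j _ => h0 i j) (Finset.mem_univ j)).trans ?_
  exact Finset.single_le_sum (f := fun i => ∑ j, M i j)
    (fun i _ => Finset.sum_nonneg fun j _ => h0 i j) (Finset.mem_univ i)

/-- The product of kernel and scaled coupling matrix, extended to the plane. -/
noncomputable def kernelCoupling (S : PDEODESystem n) (K : ℝ → ℝ → Matrix (Fin 2) (Fin 2) ℝ)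
    (i j : Fin 2) (z ζ : ℝ) : ℝ :=
  ∑ l, kernelExt K i l z ζ * S.scaledCoupling l j ζ

theorem IsKernel.continuous_kernelCoupling (hK : S.IsKernel K) (i j : Fin 2) :
    Continuous (Function.uncurry (S.kernelCoupling K i j)) := by
  unfold kernelCoupling Function.uncurry
  exact continuous_finsetSum _ fun l _ =>
    (hK.continuous_kernelExt i l).mul ((S.continuous_scaledCoupling l j).comp continuous_snd)

theorem IsKernel.exists_kernelCoupling_le (hK : S.IsKernel K) :
    ∃ M : ℝ, 0 ≤ M ∧ ∀ i j z ζ, |S.kernelCoupling K i j z ζ| ≤ M := by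
  obtain ⟨M, hM0, hM⟩ := hK.exists_kernelExt_le
  obtain ⟨N, hN0, hN⟩ := S.exists_scaledCoupling_le
  refine ⟨∑ _l : Fin 2, M * N, by positivity, fun i j z ζ => ?_⟩
  refine (Finset.abs_sum_le_sum_abs _ _).trans (Finset.sum_le_sum fun l _ => ?_)
  rw [abs_mul]
  exact mul_le_mul (hM _ _ _ _) (hN _ _ _) (abs_nonneg _) hM0

/-- The kernel equation along a pair of characteristics, in the direction of time. -/
theorem IsKernel.hasDerivWithinAt_characteristic (hK : S.IsKernel K) (i j : Fin 2) {c d a b : ℝ}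
    (hab : a ≤ b) (hmem : ∀ s ∈ Icc a b, 0 ≤ S.characteristic j d s ∧
      S.characteristic j d s ≤ S.characteristic i c s ∧ S.characteristic i c s ≤ 1) :
    ∀ s ∈ Icc a b, HasDerivWithinAt (fun s => S.speed j (S.characteristic j d s) *
        kernelExt K i j (S.characteristic i c s) (S.characteristic j d s))
      (-(S.speed j (S.characteristic j d s) *
        S.kernelCoupling K i j (S.characteristic i c s) (S.characteristic j d s))) (Icc a b) s := by
  -- The kernel equation follows curves with velocity +Λ, whereas characteristics in forward time
  -- have velocity -Λ. The pair is therefore run backward, and multiplication by `travelSign j`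
  -- turns Λⱼⱼ into the positive speed.
  have hneg : ∀ {s}, s ∈ Icc (-b) (-a) → -s ∈ Icc a b := fun hs =>
    ⟨by linarith [hs.2], by linarith [hs.1]⟩
  have hI : ∀ s ∈ Icc a b, S.characteristic i c s ∈ Icc (0 : ℝ) 1 := fun s hs =>
    ⟨(hmem s hs).1.trans (hmem s hs).2.1, (hmem s hs).2.2⟩
  have hJ : ∀ s ∈ Icc a b, S.characteristic j d s ∈ Icc (0 : ℝ) 1 := fun s hs =>
    ⟨(hmem s hs).1, (hmem s hs).2.1.trans (hmem s hs).2.2⟩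
  have hrev : ∀ (k : Fin 2) (e s : ℝ), HasDerivAt (fun s => S.characteristic k e (-s))
      (travelSign k * S.speed k (S.characteristic k e (-s))) s := fun k e s => by
    simpa [Function.comp_def] using
      (S.hasDerivAt_characteristic k e (-s)).comp s (hasDerivAt_neg s)
  have key := hK.pde i j (-b) (-a) (fun s => S.characteristic i c (-s))
    (fun s => S.characteristic j d (-s)) (neg_le_neg hab) fun s hs => by
      refine ⟨hmem _ (hneg hs), ?_, ?_⟩
      · rw [S.Lam_diag i (hI _ (hneg hs))]; exact (hrev i c s).hasDerivWithinAt
      · rw [S.Lam_diag j (hJ _ (hneg hs))]; exact (hrev j d s).hasDerivWithinAt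
  intro s hs
  have hs' : -s ∈ Icc (-b) (-a) := ⟨neg_le_neg hs.2, neg_le_neg hs.1⟩
  have h1 := ((key (-s) hs').comp s (hasDerivAt_neg s).hasDerivWithinAt (s := Icc a b)
    (fun t ht => ⟨neg_le_neg ht.2, neg_le_neg ht.1⟩)).const_mul (travelSign j)
  have hval : travelSign j * (S.Lam (S.characteristic j d s) j j *
      (K (S.characteristic i c s) (S.characteristic j d s) *
        S.Atilde (S.characteristic j d s)) i j * -1)
      = -(S.speed j (S.characteristic j d s) *
        S.kernelCoupling K i j (S.characteristic i c s) (S.characteristic j d s)) := by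
    rw [S.Lam_diag j (hJ s hs), kernelCoupling, Matrix.mul_apply]
    have : ∀ l, kernelExt K i l (S.characteristic i c s) (S.characteristic j d s) *
        S.scaledCoupling l j (S.characteristic j d s)
        = K (S.characteristic i c s) (S.characteristic j d s) i l *
          S.Atilde (S.characteristic j d s) l j := fun l => by
      rw [kernelExt_of_mem K i l (hmem s hs).1 (hmem s hs).2.1 (hmem s hs).2.2, scaledCoupling,
        unitClamp_of_mem (hJ s hs)]
    simp only [this]
    linear_combination (-(S.speed j (S.characteristic j d s) *
      ∑ l, K (S.characteristic i c s) (S.characteristic j d s) i l *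
          S.Atilde (S.characteristic j d s) l j)) * travelSign_mul_self j
  have hfun : ∀ t ∈ Icc a b, S.speed j (S.characteristic j d t) *
        kernelExt K i j (S.characteristic i c t) (S.characteristic j d t)
      = travelSign j * (K (S.characteristic i c t) (S.characteristic j d t) i j *
        S.Lam (S.characteristic j d t) j j) := by
    intro t ht
    rw [kernelExt_of_mem K i j (hmem t ht).1 (hmem t ht).2.1 (hmem t ht).2.2,
      S.Lam_diag j (hJ t ht)]
    linear_combination (-(S.speed j (S.characteristic j d t) *
      K (S.characteristic i c t) (S.characteristic j d t) i j)) * travelSign_mul_self j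
  simp only [neg_neg, Function.comp_def] at h1
  rw [hval] at h1
  exact h1.congr hfun (hfun s hs)

/-- The change of one entry of the Volterra integral along a characteristic. -/
theorem IsKernel.integral_kernelExt_mul_sub_eq (hK : S.IsKernel K) {y f : ℝ → ℝ → Fin 2 → ℝ}
    (hy : IsExtendedTrajectory y) (hf : IsExtendedTrajectory f) (hyf : S.Transports f y)
    (i j : Fin 2) {c a b : ℝ} (ha : 0 ≤ a) (hab : a ≤ b)
    (hγ : ∀ s ∈ Icc a b, S.characteristic i c s ∈ Icc (0 : ℝ) 1) :
    (∫ ζ in 0..S.characteristic i c b, kernelExt K i j (S.characteristic i c b) ζ * y ζ b j)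
      - ∫ ζ in 0..S.characteristic i c a, kernelExt K i j (S.characteristic i c a) ζ * y ζ a j
      = ∫ s in a..b, ((travelSign j * S.speed j (S.characteristic i c s)
            + -(travelSign i * S.speed i (S.characteristic i c s)))
            * (kernelExt K i j (S.characteristic i c s) (S.characteristic i c s)
              * y (S.characteristic i c s) s j)
          - travelSign j * S.speed j 0 * (kernelExt K i j (S.characteristic i c s) 0 * y 0 s j)
          + ∫ ζ in 0..S.characteristic i c s,
              (kernelExt K i j (S.characteristic i c s) ζ * f ζ s j
                - S.kernelCoupling K i j (S.characteristic i c s) ζ * y ζ s j)) := by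
  obtain ⟨Λ, hΛ⟩ := S.exists_speed_le
  obtain ⟨M, hM0, hM⟩ := hK.exists_kernelExt_le
  obtain ⟨N, hN0, hN⟩ := hK.exists_kernelCoupling_le
  obtain ⟨Y, hY⟩ := hy.2 b
  obtain ⟨Φ, hΦ⟩ := hf.2 b
  have hYc : ∀ z, ∀ t ≤ b, |y z t j| ≤ Y := fun z t ht => (norm_le_pi_norm (y z t) j).trans (hY z t ht)
  have hΦc : ∀ z, ∀ t ≤ b, |f z t j| ≤ Φ := fun z t ht => (norm_le_pi_norm (f z t) j).trans (hΦ z t ht)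
  have hY0 : 0 ≤ Y := (abs_nonneg _).trans (hYc 0 b le_rfl)
  have hΦ0 : 0 ≤ Φ := (abs_nonneg _).trans (hΦc 0 b le_rfl)
  set γ := S.characteristic i c with hγdef
  have hγc : Continuous γ := S.continuous_characteristic i c
  have hcurve : Measurable fun p : ℝ × ℝ => (γ p.2, p.1) :=
    (hγc.measurable.comp measurable_snd).prodMk measurable_fst
  have hkm : Measurable fun p : ℝ × ℝ => kernelExt K i j (γ p.2) p.1 :=
    (hK.continuous_kernelExt i j).measurable.comp hcurve
  have hkcm : Measurable fun p : ℝ × ℝ => S.kernelCoupling K i j (γ p.2) p.1 :=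
    (hK.continuous_kernelCoupling i j).measurable.comp hcurve
  -- This is zero for j = i, where γ is itself a characteristic of the j-th family, and λ₁ + λ₂ for
  -- j ≠ i. Labels of the j-th family thus never cross the moving end in the wrong direction.
  have hsign : ∀ s, 0 ≤ S.speed j (γ s) + travelSign j * -(travelSign i * S.speed i (γ s)) := by
    intro s
    have h0 := S.speed_pos 0 (γ s)
    have h1 := S.speed_pos 1 (γ s)
    fin_cases i <;> fin_cases j <;> simp [travelSign] <;> linarith
  refine integral_moving_interval_sub_eq
    (g := fun ζ s => kernelExt K i j (γ s) ζ * y ζ s j)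
    (h := fun ζ s => kernelExt K i j (γ s) ζ * f ζ s j - S.kernelCoupling K i j (γ s) ζ * y ζ s j)
    (B := M * Y + (M * Φ + N * Y)) (Λ := Λ)
    (travelSign_eq j) hab (S.continuous_speed j) (S.speed_pos j) (hΛ j) (S.phi_zero j)
    (S.hasDerivAt_phi j) (S.hasDerivAt_characteristic i c) (fun s hs => (hγ s hs).1)
    (fun s _ => hsign s) (hkm.mul (hy.measurable_coord j))
    ((hkm.mul (hf.measurable_coord j)).sub (hkcm.mul (hy.measurable_coord j))) ?_ ?_ ?_
  · intro s hs ζ _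
    rw [abs_mul]
    have := mul_le_mul (hM i j (γ s) ζ) (hYc ζ s hs.2) (abs_nonneg _) hM0
    nlinarith [mul_nonneg hM0 hΦ0, mul_nonneg hN0 hY0]
  · intro s hs ζ _
    refine (abs_sub _ _).trans ?_
    rw [abs_mul, abs_mul]
    have h1 := mul_le_mul (hM i j (γ s) ζ) (hΦc ζ s hs.2) (abs_nonneg _) hM0
    have h2 := mul_le_mul (hN i j (γ s) ζ) (hYc ζ s hs.2) (abs_nonneg _) hN0
    nlinarith [mul_nonneg hM0 hY0]
  · intro d s₁ h₁ s₂ h₂ h12 hin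
    change ∀ s ∈ Icc s₁ s₂, S.characteristic j d s ∈ Icc 0 (γ s) at hin
    change S.speed j (S.characteristic j d s₂) * (kernelExt K i j (γ s₂) (S.characteristic j d s₂)
        * y (S.characteristic j d s₂) s₂ j) - S.speed j (S.characteristic j d s₁) *
        (kernelExt K i j (γ s₁) (S.characteristic j d s₁) * y (S.characteristic j d s₁) s₁ j)
      = ∫ s in s₁..s₂, S.speed j (S.characteristic j d s) *
        (kernelExt K i j (γ s) (S.characteristic j d s) * f (S.characteristic j d s) s j
          - S.kernelCoupling K i j (γ s) (S.characteristic j d s) * y (S.characteristic j d s) s j)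
    set ρ := S.characteristic j d with hρ
    have hρc : Continuous ρ := S.continuous_characteristic j d
    have hsub : ∀ s ∈ Icc s₁ s₂, s ∈ Icc a b := fun s hs => ⟨h₁.1.trans hs.1, hs.2.trans h₂.2⟩
    have hu : Continuous fun s => -(S.speed j (ρ s) * S.kernelCoupling K i j (γ s) (ρ s)) :=
      (((S.continuous_speed j).comp hρc).mul
        ((hK.continuous_kernelCoupling i j).comp (hγc.prodMk hρc))).neg
    have hv : IntervalIntegrable (fun s => f (ρ s) s j) volume s₁ s₂ :=
      intervalIntegrable_of_measurable_of_abs_le (B := Φ)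
        ((hf.measurable_coord j).comp (hρc.measurable.prodMk measurable_id)) fun s hs => by
          rw [uIcc_of_le h12] at hs
          exact hΦc _ _ (hsub s hs).2
    have hder : ∀ s ∈ Icc s₁ s₂, ∀ t ∈ Icc s₁ s,
        HasDerivWithinAt (fun s => S.speed j (ρ s) * kernelExt K i j (γ s) (ρ s))
          (-(S.speed j (ρ t) * S.kernelCoupling K i j (γ t) (ρ t))) (Icc s₁ s) t := by
      intro s hs
      refine hK.hasDerivWithinAt_characteristic i j hs.1 fun t ht => ?_
      have ht' : t ∈ Icc s₁ s₂ := ⟨ht.1, ht.2.trans hs.2⟩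
      exact ⟨(hin t ht').1, (hin t ht').2, (hγ t (hsub t ht')).2⟩
    -- The first factor changes by the kernel equation and the second by the transport of y. The
    -- result is the source of the balance law for this label.
    have := mul_sub_mul_eq_integral (U := fun s => S.speed j (ρ s) * kernelExt K i j (γ s) (ρ s))
      (V := fun s => y (ρ s) s j) h12 (hu.intervalIntegrable _ _) hv
      (fun s hs => by
        rw [eq_comm]
        refine intervalIntegral.integral_eq_sub_of_hasDerivAt_of_le hs.1
          (fun t ht => (hder s hs t ht).continuousWithinAt)
          (fun t ht => (hder s hs t (Ioo_subset_Icc_self ht)).hasDerivAt (Icc_mem_nhds ht.1 ht.2))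
          (hu.intervalIntegrable _ _))
      (fun s hs => by
        refine hyf j d s₁ s (ha.trans h₁.1) hs.1 fun t ht => ?_
        have ht' : t ∈ Icc s₁ s₂ := ⟨ht.1, ht.2.trans hs.2⟩
        exact ⟨(hin t ht').1, (hin t ht').2.trans (hγ t (hsub t ht')).2⟩)
    rw [← mul_assoc, ← mul_assoc]
    refine this.trans (intervalIntegral.integral_congr fun s _ => ?_)
    ring

end PDEODESystem

/-! ### The Volterra transformation of a transported trajectory. -/

theorem IsExtendedTrajectory.intervalIntegrable_along {y : ℝ → ℝ → Fin 2 → ℝ}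
    (hy : IsExtendedTrajectory y) (i : Fin 2) {γ : ℝ → ℝ} (hγ : Measurable γ) (a b : ℝ) :
    IntervalIntegrable (fun s => y (γ s) s i) volume a b := by
  obtain ⟨Y, hY⟩ := hy.2 (max a b)
  have hm : Measurable fun s => y (γ s) s i :=
    (hy.measurable_coord i).comp (hγ.prodMk measurable_id)
  exact intervalIntegrable_of_measurable_of_abs_le (B := Y) hm fun s hs =>
    (norm_le_pi_norm (y (γ s) s) i).trans (hY _ _ hs.2)

namespace PDEODESystem

variable {n : ℕ} {S : PDEODESystem n} {K : ℝ → ℝ → Matrix (Fin 2) (Fin 2) ℝ}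

/-- The Volterra integral operator with kernel `K`. -/
noncomputable def volterra (K : ℝ → ℝ → Matrix (Fin 2) (Fin 2) ℝ) (y : ℝ → ℝ → Fin 2 → ℝ)
    (z t : ℝ) (i : Fin 2) : ℝ :=
  ∫ ζ in 0..z, ∑ j, kernelExt K i j z ζ * y ζ t j

/-- The coupling by the scaled coupling coefficients. -/
noncomputable def applyCoupling (S : PDEODESystem n) (w : ℝ → ℝ → Fin 2 → ℝ) (z t : ℝ)
    (i : Fin 2) : ℝ :=
  ∑ j, S.scaledCoupling i j z * w z t j

/-- The defect in the transport equation of the transformed state that is caused by an error `e` in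
the coupling term. -/
noncomputable def couplingDefect (S : PDEODESystem n) (K : ℝ → ℝ → Matrix (Fin 2) (Fin 2) ℝ)
    (e : ℝ → ℝ → Fin 2 → ℝ) (z t : ℝ) (i : Fin 2) : ℝ :=
  -(∑ j, S.scaledCoupling i j z * e z t j)
    + ∫ ζ in 0..z, ∑ j, S.kernelCoupling K i j z ζ * e ζ t j

/-- The boundary term `K(z,0) Λ(0) y(0,t)`. -/
noncomputable def boundarySource (S : PDEODESystem n) (K : ℝ → ℝ → Matrix (Fin 2) (Fin 2) ℝ)
    (y : ℝ → ℝ → Fin 2 → ℝ) (z t : ℝ) (i : Fin 2) : ℝ :=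
  ∑ j, travelSign j * S.speed j 0 * (kernelExt K i j z 0 * y 0 t j)

theorem intervalIntegrable_mul_coord {k : ℝ → ℝ → ℝ} (hk : Continuous (Function.uncurry k)) {M : ℝ}
    (hkM : ∀ z ζ, |k z ζ| ≤ M) {y : ℝ → ℝ → Fin 2 → ℝ} (hy : IsExtendedTrajectory y) (j : Fin 2)
    (z t a b : ℝ) : IntervalIntegrable (fun ζ => k z ζ * y ζ t j) volume a b := by
  obtain ⟨Y, hY⟩ := hy.2 t
  refine intervalIntegrable_of_measurable_of_abs_le (B := M * Y)
    ((hk.measurable.comp measurable_prodMk_left).mul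
      ((hy.measurable_coord j).comp measurable_prodMk_right)) fun ζ _ => ?_
  rw [abs_mul]
  exact mul_le_mul (hkM _ _) ((norm_le_pi_norm (y ζ t) j).trans (hY ζ t le_rfl)) (abs_nonneg _)
    ((abs_nonneg _).trans (hkM z ζ))

theorem IsKernel.intervalIntegrable_kernelExt_mul (hK : S.IsKernel K) {y : ℝ → ℝ → Fin 2 → ℝ}
    (hy : IsExtendedTrajectory y) (i j : Fin 2) (z t a b : ℝ) :
    IntervalIntegrable (fun ζ => kernelExt K i j z ζ * y ζ t j) volume a b := by
  obtain ⟨M, -, hM⟩ := hK.exists_kernelExt_le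
  exact intervalIntegrable_mul_coord (hK.continuous_kernelExt i j) (hM i j) hy j z t a b

theorem IsKernel.intervalIntegrable_kernelCoupling_mul (hK : S.IsKernel K) {y : ℝ → ℝ → Fin 2 → ℝ}
    (hy : IsExtendedTrajectory y) (i j : Fin 2) (z t a b : ℝ) :
    IntervalIntegrable (fun ζ => S.kernelCoupling K i j z ζ * y ζ t j) volume a b := by
  obtain ⟨M, -, hM⟩ := hK.exists_kernelCoupling_le
  exact intervalIntegrable_mul_coord (hK.continuous_kernelCoupling i j) (hM i j) hy j z t a b

theorem isExtendedTrajectory_applyCoupling {w : ℝ → ℝ → Fin 2 → ℝ} (hw : IsExtendedTrajectory w) :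
    IsExtendedTrajectory (S.applyCoupling w) := by
  obtain ⟨M, hM0, hM⟩ := S.exists_scaledCoupling_le
  refine IsExtendedTrajectory.of_coord (fun i => ?_) fun i T => ?_
  · unfold applyCoupling Function.uncurry
    exact Finset.measurable_sum _ fun j _ =>
      ((S.continuous_scaledCoupling i j).measurable.comp measurable_fst).mul (hw.measurable_coord j)
  · obtain ⟨Y, hY⟩ := hw.2 T
    refine ⟨∑ _j : Fin 2, M * Y, fun z t ht => ?_⟩
    refine (Finset.abs_sum_le_sum_abs _ _).trans (Finset.sum_le_sum fun j _ => ?_)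
    rw [abs_mul]
    exact mul_le_mul (hM _ _ _) ((norm_le_pi_norm (w z t) j).trans (hY z t ht)) (abs_nonneg _) hM0

/-- The values of the kernel on the diagonal produce the scaled coupling. -/
theorem IsKernel.sum_diagonal_mul (hK : S.IsKernel K) (i : Fin 2) {z : ℝ}
    (hz : z ∈ Icc (0 : ℝ) 1) (v : Fin 2 → ℝ) :
    (travelSign 0 * S.speed 0 z + -(travelSign i * S.speed i z)) * (kernelExt K i 0 z z * v 0)
      + (travelSign 1 * S.speed 1 z + -(travelSign i * S.speed i z)) * (kernelExt K i 1 z z * v 1)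
      = ∑ j, S.scaledCoupling i j z * v j := by
  rw [kernelExt_of_mem K i 0 hz.1 le_rfl hz.2, kernelExt_of_mem K i 1 hz.1 le_rfl hz.2,
    Fin.sum_univ_two]
  have hpos := S.lam_pos 0 _ hz
  have hpos1 := S.lam_pos 1 _ hz
  have hne : S.lam 0 z + S.lam 1 z ≠ 0 := by positivity
  have hd0 : S.Atilde z 0 0 = 0 := by simp [Atilde]
  have hd1 : S.Atilde z 1 1 = 0 := by simp [Atilde]
  rw [S.speed_of_mem 0 hz, S.speed_of_mem 1 hz, scaledCoupling, scaledCoupling,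
    unitClamp_of_mem hz]
  fin_cases i
  · simp only [Fin.zero_eta, travelSign, Matrix.cons_val_zero, Matrix.cons_val_one]
    rw [S.speed_of_mem 0 hz, hK.bc12 _ hz, hd0]
    field_simp
    ring
  · simp only [Fin.mk_one, travelSign, Matrix.cons_val_zero, Matrix.cons_val_one]
    rw [S.speed_of_mem 1 hz, hK.bc21 _ hz, hd1]
    field_simp
    ring

theorem IsKernel.intervalIntegrable_rate (hK : S.IsKernel K) {y f : ℝ → ℝ → Fin 2 → ℝ}
    (hy : IsExtendedTrajectory y) (hf : IsExtendedTrajectory f) (i j : Fin 2) {γ : ℝ → ℝ}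
    (hγc : Continuous γ) {a b : ℝ} (hab : a ≤ b) (hγ : ∀ s ∈ Icc a b, γ s ∈ Icc (0 : ℝ) 1) :
    IntervalIntegrable (fun s => (travelSign j * S.speed j (γ s)
            + -(travelSign i * S.speed i (γ s))) * (kernelExt K i j (γ s) (γ s) * y (γ s) s j)
          - travelSign j * S.speed j 0 * (kernelExt K i j (γ s) 0 * y 0 s j)
          + ∫ ζ in 0..γ s, (kernelExt K i j (γ s) ζ * f ζ s j
                - S.kernelCoupling K i j (γ s) ζ * y ζ s j)) volume a b := by
  obtain ⟨M, hM0, hM⟩ := hK.exists_kernelExt_le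
  obtain ⟨N, hN0, hN⟩ := hK.exists_kernelCoupling_le
  obtain ⟨Y, hY⟩ := hy.2 b
  obtain ⟨Φ, hΦ⟩ := hf.2 b
  have hYc : ∀ z, ∀ t ≤ b, |y z t j| ≤ Y := fun z t ht =>
    (norm_le_pi_norm (y z t) j).trans (hY z t ht)
  have hΦc : ∀ z, ∀ t ≤ b, |f z t j| ≤ Φ := fun z t ht =>
    (norm_le_pi_norm (f z t) j).trans (hΦ z t ht)
  have hY0 : 0 ≤ Y := (abs_nonneg _).trans (hYc 0 b le_rfl)
  have hΦ0 : 0 ≤ Φ := (abs_nonneg _).trans (hΦc 0 b le_rfl)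
  have hcurve : Measurable fun p : ℝ × ℝ => (γ p.1, p.2) :=
    (hγc.measurable.comp measurable_fst).prodMk measurable_snd
  have hyγ := hy.intervalIntegrable_along j hγc.measurable a b
  have hy0 := hy.intervalIntegrable_along j (measurable_const (a := (0 : ℝ))) a b
  have hsp : ∀ k, Continuous fun s => S.speed k (γ s) := fun k => (S.continuous_speed k).comp hγc
  have hkγ : Continuous fun s => kernelExt K i j (γ s) (γ s) :=
    (hK.continuous_kernelExt i j).comp (hγc.prodMk hγc)
  have hk0 : Continuous fun s => kernelExt K i j (γ s) 0 :=
    (hK.continuous_kernelExt i j).comp (hγc.prodMk continuous_const)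
  have hcoef : Continuous fun s => travelSign j * S.speed j (γ s)
      + -(travelSign i * S.speed i (γ s)) :=
    ((hsp j).const_mul _).add ((hsp i).const_mul _).neg
  have h1 : IntervalIntegrable (fun s => (travelSign j * S.speed j (γ s)
      + -(travelSign i * S.speed i (γ s))) * (kernelExt K i j (γ s) (γ s) * y (γ s) s j))
      volume a b :=
    (hyγ.continuousOn_mul hkγ.continuousOn).continuousOn_mul hcoef.continuousOn
  have h2 : IntervalIntegrable (fun s => travelSign j * S.speed j 0 *
      (kernelExt K i j (γ s) 0 * y 0 s j)) volume a b :=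
    (hy0.continuousOn_mul hk0.continuousOn).const_mul _
  refine (h1.sub h2).add ?_
  refine intervalIntegrable_of_measurable_of_abs_le (B := (M * Φ + N * Y) * 1) ?_ ?_
  · refine measurable_intervalIntegral_param ?_ measurable_const hγc.measurable
    exact (((hK.continuous_kernelExt i j).measurable.comp hcurve).mul
        ((hf.measurable_coord j).comp measurable_swap)).sub
        (((hK.continuous_kernelCoupling i j).measurable.comp hcurve).mul
        ((hy.measurable_coord j).comp measurable_swap))
  · intro s hs
    rw [uIcc_of_le hab] at hs
    have hlen : |γ s - 0| ≤ 1 := by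
        rw [sub_zero, abs_of_nonneg (hγ s hs).1]; exact (hγ s hs).2
    rw [← Real.norm_eq_abs]
    refine (intervalIntegral.norm_integral_le_of_norm_le_const (C := M * Φ + N * Y)
        fun ζ _ => ?_).trans (mul_le_mul_of_nonneg_left hlen (by positivity))
    rw [Real.norm_eq_abs]
    refine (abs_sub _ _).trans ?_
    rw [abs_mul, abs_mul]
    exact add_le_add (mul_le_mul (hM i j (γ s) ζ) (hΦc ζ s hs.2) (abs_nonneg _) hM0)
        (mul_le_mul (hN i j (γ s) ζ) (hYc ζ s hs.2) (abs_nonneg _) hN0)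

/-- If `y` is transported with the source `Ã w`, then `y - ∫ K y` is transported with the boundary
term as source, up to the defect caused by `y - w`. -/
theorem IsKernel.transports_sub_volterra (hK : S.IsKernel K) {y w : ℝ → ℝ → Fin 2 → ℝ}
    (hy : IsExtendedTrajectory y) (hw : IsExtendedTrajectory w)
    (hyw : S.Transports (S.applyCoupling w) y) :
    S.Transports (fun z t i => S.boundarySource K y z t i
        + S.couplingDefect K (fun z t i => y z t i - w z t i) z t i)
      (fun z t i => y z t i - volterra K y z t i) := by
  intro i c a b ha hab hγ
  have hf := isExtendedTrajectory_applyCoupling (S := S) hw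
  have hinc := hyw i c a b ha hab hγ
  have hflux := fun j => hK.integral_kernelExt_mul_sub_eq hy hf hyw i j ha hab hγ
  set γ := S.characteristic i c with hγdef
  have hγc : Continuous γ := S.continuous_characteristic i c
  have hγm : Measurable fun s : ℝ => (γ s, s) := hγc.measurable.prodMk measurable_id
  have hk : ∀ j z t a b, IntervalIntegrable (fun ζ => kernelExt K i j z ζ * y ζ t j) volume a b :=
    fun j => hK.intervalIntegrable_kernelExt_mul hy i j
  have hkf : ∀ j z t a b, IntervalIntegrable
      (fun ζ => kernelExt K i j z ζ * S.applyCoupling w ζ t j) volume a b :=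
    fun j => hK.intervalIntegrable_kernelExt_mul hf i j
  have hkc : ∀ j z t a b, IntervalIntegrable
      (fun ζ => S.kernelCoupling K i j z ζ * y ζ t j) volume a b :=
    fun j => hK.intervalIntegrable_kernelCoupling_mul hy i j
  have hvol : ∀ s, volterra K y (γ s) s i = (∫ ζ in 0..γ s, kernelExt K i 0 (γ s) ζ * y ζ s 0)
      + ∫ ζ in 0..γ s, kernelExt K i 1 (γ s) ζ * y ζ s 1 := by
    intro s
    simp only [volterra, Fin.sum_univ_two]
    exact intervalIntegral.integral_add (hk 0 _ _ _ _) (hk 1 _ _ _ _)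
  have hfint := hf.intervalIntegrable_along i hγc.measurable a b
  have hrate := fun j => hK.intervalIntegrable_rate hy hf i j hγc hab hγ
  have hsplit : y (γ b) b i - volterra K y (γ b) b i - (y (γ a) a i - volterra K y (γ a) a i)
      = ∫ s in a..b, (S.applyCoupling w (γ s) s i - (((travelSign 0 * S.speed 0 (γ s)
            + -(travelSign i * S.speed i (γ s))) * (kernelExt K i 0 (γ s) (γ s) * y (γ s) s 0)
          - travelSign 0 * S.speed 0 0 * (kernelExt K i 0 (γ s) 0 * y 0 s 0)
          + ∫ ζ in 0..γ s, (kernelExt K i 0 (γ s) ζ * S.applyCoupling w ζ s 0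
                - S.kernelCoupling K i 0 (γ s) ζ * y ζ s 0))
          + ((travelSign 1 * S.speed 1 (γ s)
            + -(travelSign i * S.speed i (γ s))) * (kernelExt K i 1 (γ s) (γ s) * y (γ s) s 1)
          - travelSign 1 * S.speed 1 0 * (kernelExt K i 1 (γ s) 0 * y 0 s 1)
          + ∫ ζ in 0..γ s, (kernelExt K i 1 (γ s) ζ * S.applyCoupling w ζ s 1
                - S.kernelCoupling K i 1 (γ s) ζ * y ζ s 1)))) := by
    rw [intervalIntegral.integral_sub hfint ((hrate 0).add (hrate 1)),
      intervalIntegral.integral_add (hrate 0) (hrate 1), ← hflux 0, ← hflux 1, ← hinc, hvol, hvol]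
    ring
  rw [hsplit]
  refine intervalIntegral.integral_congr fun s hs => ?_
  rw [uIcc_of_le hab] at hs
  have hz := hγ s hs
  simp only
  -- The flux on the diagonal is Ãy and the source of y is Ãw, which leaves -Ã(y - w). In the
  -- interior, KÃw from the source of y meets KÃy from the kernel equation, which leaves the
  -- integral of KÃ(y - w). Together they form the defect.
  have hdiag := hK.sum_diagonal_mul i hz (y (γ s) s)
  have hinner : (∫ ζ in 0..γ s, ∑ j, S.kernelCoupling K i j (γ s) ζ * (y ζ s j - w ζ s j))
      = -((∫ ζ in 0..γ s, (kernelExt K i 0 (γ s) ζ * S.applyCoupling w ζ s 0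
                - S.kernelCoupling K i 0 (γ s) ζ * y ζ s 0))
        + ∫ ζ in 0..γ s, (kernelExt K i 1 (γ s) ζ * S.applyCoupling w ζ s 1
                - S.kernelCoupling K i 1 (γ s) ζ * y ζ s 1)) := by
    rw [← intervalIntegral.integral_add ((hkf 0 _ _ _ _).sub (hkc 0 _ _ _ _))
      ((hkf 1 _ _ _ _).sub (hkc 1 _ _ _ _)), ← intervalIntegral.integral_neg]
    refine intervalIntegral.integral_congr fun ζ _ => ?_
    simp only [kernelCoupling, applyCoupling, Fin.sum_univ_two]
    ring
  simp only [boundarySource, couplingDefect]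
  rw [hinner]
  have hsub : ∑ j, S.scaledCoupling i j (γ s) * (y (γ s) s j - w (γ s) s j)
      = (∑ j, S.scaledCoupling i j (γ s) * y (γ s) s j) - S.applyCoupling w (γ s) s i := by
    simp only [applyCoupling, ← Finset.sum_sub_distrib, mul_sub]
  rw [hsub, ← hdiag, Fin.sum_univ_two]
  ring

end PDEODESystem

/-! ### Volterra equations of the second kind. -/

/-- Each integration against the weight exp(μζ) gains a factor 1/μ, so a large μ makes the integral
operators below contractive whatever the size of their kernels. -/
theorem abs_integral_le_exp {q : ℝ → ℝ} {C μ y z : ℝ} (hz : y ≤ z) (hμ : 0 < μ)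
    (hC : 0 ≤ C) (hq : ∀ ζ ∈ Icc y z, |q ζ| ≤ C * Real.exp (μ * ζ)) :
    |∫ ζ in y..z, q ζ| ≤ C / μ * Real.exp (μ * z) := by
  have hd : ∀ ζ, HasDerivAt (fun ζ => C / μ * Real.exp (μ * ζ)) (C * Real.exp (μ * ζ)) ζ := fun ζ => by
    have := (((hasDerivAt_id ζ).const_mul μ).exp).const_mul (C / μ)
    refine this.congr_deriv ?_
    simp only [id, mul_one]
    field_simp
  have hc : Continuous fun ζ => C * Real.exp (μ * ζ) := by fun_prop
  have h1 : ∫ ζ in y..z, C * Real.exp (μ * ζ) = C / μ * Real.exp (μ * z) - C / μ * Real.exp (μ * y) :=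
    intervalIntegral.integral_eq_sub_of_hasDerivAt (fun ζ _ => hd ζ) (hc.intervalIntegrable _ _)
  have h2 := intervalIntegral.norm_integral_le_of_norm_le (f := q) (μ := volume) hz
    (Filter.Eventually.of_forall fun ζ (hζ : ζ ∈ Ioc y z) => hq ζ (Ioc_subset_Icc_self hζ))
    (hc.intervalIntegrable _ _)
  rw [h1] at h2
  refine h2.trans (sub_le_self _ (by positivity))

theorem abs_sum_fin_two_mul_le {k v : Fin 2 → ℝ} {M B : ℝ} (hM : 0 ≤ M) (hk : ∀ j, |k j| ≤ M)
    (hv : ∀ j, |v j| ≤ B) : |∑ j, k j * v j| ≤ 2 * M * B := by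
  refine (Finset.abs_sum_le_sum_abs _ _).trans ?_
  have : ∀ j, |k j * v j| ≤ M * B := fun j => by
    rw [abs_mul]; exact mul_le_mul (hk j) (hv j) (abs_nonneg _) hM
  rw [Fin.sum_univ_two]
  linarith [this 0, this 1]

theorem IsExtendedTrajectory.sub {y w : ℝ → ℝ → Fin 2 → ℝ} (hy : IsExtendedTrajectory y)
    (hw : IsExtendedTrajectory w) : IsExtendedTrajectory fun z t i => y z t i - w z t i := by
  refine ⟨hy.1.sub hw.1, fun T => ?_⟩
  obtain ⟨Y, hY⟩ := hy.2 T
  obtain ⟨W, hW⟩ := hw.2 T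
  exact ⟨Y + W, fun z t ht => (norm_sub_le (y z t) (w z t)).trans (add_le_add (hY z t ht) (hW z t ht))⟩

/-- A trajectory is bounded by a nondecreasing function of time. -/
theorem IsExtendedTrajectory.exists_monotone_bound {y : ℝ → ℝ → Fin 2 → ℝ}
    (hy : IsExtendedTrajectory y) : ∃ W : ℝ → ℝ, Monotone W ∧ (∀ t, 0 ≤ W t) ∧ ∀ z t, ‖y z t‖ ≤ W t := by
  choose M hM using hy.2
  refine ⟨fun t => ∑ k ∈ Finset.range (⌈t⌉₊ + 1), |M k|, fun s t hst => ?_,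
    fun t => Finset.sum_nonneg fun _ _ => abs_nonneg _, fun z t => ?_⟩
  · refine Finset.sum_le_sum_of_subset_of_nonneg ?_ fun _ _ _ => abs_nonneg _
    exact Finset.range_mono (Nat.succ_le_succ (Nat.ceil_mono hst))
  · refine ((hM ⌈t⌉₊ z t (Nat.le_ceil t)).trans (le_abs_self _)).trans ?_
    exact Finset.single_le_sum (f := fun k : ℕ => |M k|) (fun _ _ => abs_nonneg _)
      (Finset.mem_range.2 (Nat.lt_succ_self _))

theorem abs_integral_sum_mul_le {k : Fin 2 → ℝ → ℝ} {M B μ : ℝ} (hM0 : 0 ≤ M)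
    (hM : ∀ j ζ, |k j ζ| ≤ M) (hB : 0 ≤ B) (hμ : 0 < μ) {e : ℝ → ℝ → Fin 2 → ℝ} {z t : ℝ}
    (hz : 0 ≤ z) (he : ∀ ζ ∈ Icc 0 z, ‖e ζ t‖ ≤ B * Real.exp (μ * ζ)) :
    |∫ ζ in 0..z, ∑ j, k j ζ * e ζ t j| ≤ 2 * M * B / μ * Real.exp (μ * z) := by
  refine abs_integral_le_exp hz hμ (by positivity) fun ζ hζ => ?_
  rw [mul_assoc]
  exact abs_sum_fin_two_mul_le hM0 (fun j => hM j ζ)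
    fun j => (norm_le_pi_norm (e ζ t) j).trans (he ζ hζ)

theorem IsExtendedTrajectory.integral_sum_mul {y : ℝ → ℝ → Fin 2 → ℝ} (hy : IsExtendedTrajectory y)
    {k : Fin 2 → Fin 2 → ℝ → ℝ → ℝ} (hk : ∀ i j, Continuous (Function.uncurry (k i j))) {M : ℝ}
    (hM0 : 0 ≤ M) (hM : ∀ i j z ζ, |k i j z ζ| ≤ M) :
    IsExtendedTrajectory fun z t i =>
      ∫ ζ in 0..unitClamp z, ∑ j, k i j (unitClamp z) ζ * y ζ t j := by
  refine IsExtendedTrajectory.of_coord (fun i => ?_) fun i T => ?_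
  · have hm : Measurable (Function.uncurry fun (p : ℝ × ℝ) ζ =>
        ∑ j, k i j (unitClamp p.1) ζ * y ζ p.2 j) := by
      refine Finset.measurable_sum _ fun j _ => Measurable.mul ?_ ?_
      · exact (hk i j).measurable.comp
          ((continuous_unitClamp.measurable.comp (measurable_fst.comp measurable_fst)).prodMk
            measurable_snd)
      · exact (hy.measurable_coord j).comp (measurable_snd.prodMk (measurable_snd.comp measurable_fst))
    exact measurable_intervalIntegral_param hm measurable_const
      (continuous_unitClamp.measurable.comp measurable_fst)
  · obtain ⟨Y, hY⟩ := hy.2 T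
    have hY0 : ∀ t ≤ T, 0 ≤ Y := fun t ht => (norm_nonneg _).trans (hY 0 t ht)
    refine ⟨2 * M * Y / 1 * Real.exp (1 * 1), fun z t ht => ?_⟩
    have := hY0 t ht
    refine (abs_integral_sum_mul_le hM0 (fun j ζ => hM i j (unitClamp z) ζ) this one_pos
      (unitClamp_mem z).1 (fun ζ hζ => ?_)).trans ?_
    · refine (hY ζ t ht).trans (le_mul_of_one_le_right this (Real.one_le_exp ?_))
      simpa using hζ.1
    · have h1 := (unitClamp_mem z).2
      gcongr

namespace PDEODESystem

variable {n : ℕ} {S : PDEODESystem n} {K : ℝ → ℝ → Matrix (Fin 2) (Fin 2) ℝ}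

theorem IsKernel.volterra_sub (hK : S.IsKernel K) {y w : ℝ → ℝ → Fin 2 → ℝ}
    (hy : IsExtendedTrajectory y) (hw : IsExtendedTrajectory w) (z t : ℝ) (i : Fin 2) :
    volterra K (fun z t i => y z t i - w z t i) z t i = volterra K y z t i - volterra K w z t i := by
  have h1 := fun j => hK.intervalIntegrable_kernelExt_mul hy i j z t 0 z
  have h2 := fun j => hK.intervalIntegrable_kernelExt_mul hw i j z t 0 z
  simp only [volterra, Fin.sum_univ_two]
  rw [← intervalIntegral.integral_sub ((h1 0).add (h1 1)) ((h2 0).add (h2 1))]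
  refine intervalIntegral.integral_congr fun ζ _ => ?_
  ring

theorem abs_volterra_le {M B μ : ℝ} (hM0 : 0 ≤ M) (hM : ∀ i j z ζ, |kernelExt K i j z ζ| ≤ M)
    (hB : 0 ≤ B) (hμ : 0 < μ) {e : ℝ → ℝ → Fin 2 → ℝ} {z t : ℝ} (hz : 0 ≤ z)
    (he : ∀ ζ ∈ Icc 0 z, ‖e ζ t‖ ≤ B * Real.exp (μ * ζ)) (i : Fin 2) :
    |volterra K e z t i| ≤ 2 * M * B / μ * Real.exp (μ * z) :=
  abs_integral_sum_mul_le hM0 (fun j ζ => hM i j z ζ) hB hμ hz he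

theorem IsKernel.isExtendedTrajectory_volterra (hK : S.IsKernel K) {y : ℝ → ℝ → Fin 2 → ℝ}
    (hy : IsExtendedTrajectory y) :
    IsExtendedTrajectory fun z t i => volterra K y (unitClamp z) t i := by
  obtain ⟨M, hM0, hM⟩ := hK.exists_kernelExt_le
  exact hy.integral_sum_mul hK.continuous_kernelExt hM0 hM

/-- The Volterra integral equation of the second kind has a solution among the trajectories. -/
theorem IsKernel.exists_sub_volterra_eq (hK : S.IsKernel K) {v : ℝ → ℝ → Fin 2 → ℝ}
    (hv : IsExtendedTrajectory v) : ∃ y, IsExtendedTrajectory y ∧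
      ∀ z ∈ Icc (0 : ℝ) 1, ∀ t i, y z t i - volterra K y z t i = v z t i := by
  obtain ⟨M, hM0, hM⟩ := hK.exists_kernelExt_le
  obtain ⟨W, hWm, hW0, hW⟩ := hv.exists_monotone_bound
  -- The two columns of K give the operator the norm 2M/μ ≤ 1/2 in the weight exp(μz). The
  -- additional factor W t admits growth of the right-hand side in time. It is harmless because the
  -- operator acts at a fixed time.
  set μ : ℝ := 4 * M + 1 with hμd
  have hμ : 0 < μ := by positivity
  have hfrac : 2 * M / μ ≤ 1 / 2 := by
    rw [div_le_div_iff₀ hμ two_pos]; linarith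
  have hexp1 : ∀ z, 1 ≤ Real.exp (μ * unitClamp z) := fun z =>
    Real.one_le_exp (mul_nonneg hμ.le (unitClamp_mem z).1)
  have hstep : ∀ (e : ℝ → ℝ → Fin 2 → ℝ) (B : ℝ), 0 ≤ B →
      (∀ z t, ‖e z t‖ ≤ B * (Real.exp (μ * unitClamp z) * W t)) →
      ∀ z t, ‖fun i => volterra K e (unitClamp z) t i‖
        ≤ B / 2 * (Real.exp (μ * unitClamp z) * W t) := by
    intro e B hB he z t
    have hWt := hW0 t
    rw [pi_norm_le_iff_of_nonneg (by positivity)]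
    intro i
    refine (abs_volterra_le hM0 hM (mul_nonneg hB hWt) hμ (unitClamp_mem z).1
      (fun ζ hζ => ?_) i).trans ?_
    · have := he ζ t
      rw [unitClamp_of_mem ⟨hζ.1, hζ.2.trans (unitClamp_mem z).2⟩] at this
      linarith
    · have h3 : 0 ≤ B * W t * Real.exp (μ * unitClamp z) := by positivity
      calc 2 * M * (B * W t) / μ * Real.exp (μ * unitClamp z)
          = 2 * M / μ * (B * W t * Real.exp (μ * unitClamp z)) := by ring
        _ ≤ 1 / 2 * (B * W t * Real.exp (μ * unitClamp z)) := mul_le_mul_of_nonneg_right hfrac h3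
        _ = _ := by ring
  obtain ⟨f, hfP, hf⟩ := exists_fixedPoint_of_weighted_contraction (α := ℝ × ℝ) (E := Fin 2 → ℝ)
    (w := fun p => Real.exp (μ * unitClamp p.1) * W p.2)
    (P := fun f => IsExtendedTrajectory fun z t => f (z, t))
    (V := fun f p i => volterra K (fun z t => f (z, t)) (unitClamp p.1) p.2 i)
    (g := fun p => v p.1 p.2) (M := 1 / 2)
    (fun p => mul_nonneg (Real.exp_pos _).le (hW0 _)) hv
    (fun f hf => by
      have h1 := hK.isExtendedTrajectory_volterra hf
      refine ⟨hv.1.add h1.1, fun T => ?_⟩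
      obtain ⟨Y, hY⟩ := hv.2 T
      obtain ⟨Z, hZ⟩ := h1.2 T
      exact ⟨Y + Z, fun z t ht => (norm_add_le _ _).trans (add_le_add (hY z t ht) (hZ z t ht))⟩)
    (fun p => hstep v 1 zero_le_one (fun z t => by
      rw [one_mul]
      exact (hW z t).trans (le_mul_of_one_le_left (hW0 t) (hexp1 z))) p.1 p.2)
    (fun f h hf hh B hB hfh p => by
      have := hstep (fun z t i => f (z, t) i - h (z, t) i) B hB (fun z t => hfh (z, t)) p.1 p.2
      have e : (fun i => volterra K (fun z t i => f (z, t) i - h (z, t) i) (unitClamp p.1) p.2 i)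
          = (fun i => volterra K (fun z t => f (z, t)) (unitClamp p.1) p.2 i)
            - fun i => volterra K (fun z t => h (z, t)) (unitClamp p.1) p.2 i :=
        funext fun i => hK.volterra_sub hf hh _ _ i
      rw [e] at this
      exact this)
    (fun F f B hF hFf => by
      constructor
      · refine measurable_of_tendsto_metrizable (f := fun n p => F n p) (fun n => (hF n).1) ?_
        rw [tendsto_pi_nhds]
        intro p
        rw [tendsto_iff_norm_sub_tendsto_zero]
        refine squeeze_zero (fun n => norm_nonneg _) (fun n => hFf n p) ?_
        simpa using ((tendsto_pow_atTop_nhds_zero_of_lt_one (r := (1 / 2 : ℝ)) (by norm_num)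
          (by norm_num)).const_mul B).mul_const (Real.exp (μ * unitClamp p.1) * W p.2)
      · intro T
        obtain ⟨Y, hY⟩ := (hF 0).2 T
        refine ⟨Y + |B| * (Real.exp μ * W T), fun z t ht => ?_⟩
        have h1 := hFf 0 (z, t)
        rw [pow_zero, mul_one] at h1
        have h2 : f (z, t) = F 0 (z, t) - (F 0 (z, t) - f (z, t)) := by abel
        change ‖f (z, t)‖ ≤ _
        rw [h2]
        refine (norm_sub_le _ _).trans (add_le_add (hY z t ht) (h1.trans ?_))
        have h3 : μ * unitClamp z ≤ μ := mul_le_of_le_one_right hμ.le (unitClamp_mem z).2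
        have h4 := hW0 t
        exact mul_le_mul (le_abs_self _) (mul_le_mul (Real.exp_le_exp.2 h3) (hWm ht) h4
          (Real.exp_pos _).le) (by positivity) (abs_nonneg _))
  refine ⟨fun z t => f (z, t), hfP, fun z hz t i => ?_⟩
  have := congrFun (hf (z, t)) i
  simp only [Pi.add_apply, unitClamp_of_mem hz] at this
  exact sub_eq_iff_eq_add.2 this

/-- Solutions of the Volterra integral equation are bounded by the right-hand side. -/
theorem IsKernel.exists_norm_le_of_sub_volterra (hK : S.IsKernel K) : ∃ C : ℝ, 0 < C ∧
    ∀ y, IsExtendedTrajectory y → ∀ t B, (∀ z ∈ Icc (0 : ℝ) 1, ∀ i,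
      |y z t i - volterra K y z t i| ≤ B) → ∀ z ∈ Icc (0 : ℝ) 1, ‖y z t‖ ≤ C * B := by
  obtain ⟨M, hM0, hM⟩ := hK.exists_kernelExt_le
  set μ : ℝ := 4 * M + 1 with hμd
  have hμ : 0 < μ := by positivity
  have hfrac : 2 * M / μ ≤ 1 / 2 := by
    rw [div_le_div_iff₀ hμ two_pos]; linarith
  refine ⟨2 * Real.exp μ, by positivity, fun y hy t B hB z hz => ?_⟩
  have hB0 : 0 ≤ B := (abs_nonneg _).trans (hB 0 ⟨le_rfl, zero_le_one⟩ 0)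
  obtain ⟨Y, hY⟩ := hy.2 t
  have hY0 : 0 ≤ Y := (norm_nonneg _).trans (hY 0 t le_rfl)
  have hexp1 : ∀ z ∈ Icc (0 : ℝ) 1, 1 ≤ Real.exp (μ * z) := fun z hz =>
    Real.one_le_exp (mul_nonneg hμ.le hz.1)
  have key := norm_le_two_mul_of_contraction (w := fun z => Real.exp (μ * z)) (D := Icc (0 : ℝ) 1)
    (f := fun z => y z t) (M := B) (B := Y) (fun _ _ => (Real.exp_pos _).le) hB0
    (fun z hz => (hY z t le_rfl).trans (le_mul_of_one_le_right hY0 (hexp1 z hz)))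
    (fun B' hB' hy' z hz => by
      rw [pi_norm_le_iff_of_nonneg (by positivity)]
      intro i
      have h1 := abs_volterra_le hM0 hM hB' hμ hz.1
        (fun ζ hζ => hy' ζ ⟨hζ.1, hζ.2.trans hz.2⟩) i
      have h2 := hB z hz i
      have h3 : y z t i = (y z t i - volterra K y z t i) + volterra K y z t i := by ring
      rw [Real.norm_eq_abs, h3]
      refine (abs_add_le _ _).trans ?_
      have h4 : B ≤ B * Real.exp (μ * z) := le_mul_of_one_le_right hB0 (hexp1 z hz)
      have h5 : 2 * M * B' / μ * Real.exp (μ * z) ≤ B' / 2 * Real.exp (μ * z) := by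
        refine mul_le_mul_of_nonneg_right ?_ (Real.exp_pos _).le
        calc 2 * M * B' / μ = 2 * M / μ * B' := by ring
          _ ≤ 1 / 2 * B' := mul_le_mul_of_nonneg_right hfrac hB'
          _ = _ := by ring
      linarith)
  refine (key z hz).trans ?_
  have : Real.exp (μ * z) ≤ Real.exp μ :=
    Real.exp_le_exp.2 (mul_le_of_le_one_right hμ.le hz.2)
  nlinarith

/-! ### Scaling, boundary conditions and the passage from (1) to (2). -/

/-- The scaled trajectory `E x`, extended to the plane. -/
noncomputable def scaledTrajectory (S : PDEODESystem n) (x : ℝ → ℝ → Fin 2 → ℝ) (z t : ℝ)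
    (i : Fin 2) : ℝ :=
  S.scaling i (unitClamp z) * extendTrajectory x z t i

theorem scaledTrajectory_of_mem (x : ℝ → ℝ → Fin 2 → ℝ) {z t : ℝ} (hz : z ∈ Icc (0 : ℝ) 1)
    (ht : 0 ≤ t) (i : Fin 2) : S.scaledTrajectory x z t i = S.scaling i z * x z t i := by
  rw [scaledTrajectory, unitClamp_of_mem hz, extendTrajectory_of_mem x hz ht]

theorem IsExtendedTrajectory.coef_mul {k : Fin 2 → ℝ → ℝ} (hk : ∀ i, Continuous (k i))
    {y : ℝ → ℝ → Fin 2 → ℝ} (hy : IsExtendedTrajectory y) :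
    IsExtendedTrajectory fun z t i => k i (unitClamp z) * y z t i := by
  refine IsExtendedTrajectory.of_coord (fun i => ?_) fun i T => ?_
  · exact (((hk i).comp continuous_unitClamp).measurable.comp measurable_fst).mul
      (hy.measurable_coord i)
  · obtain ⟨M, hM⟩ := (hk i).continuousOn.exists_abs_comp_unitClamp_le
    obtain ⟨Y, hY⟩ := hy.2 T
    refine ⟨M * Y, fun z t ht => ?_⟩
    rw [abs_mul]
    exact mul_le_mul (hM z) ((norm_le_pi_norm (y z t) i).trans (hY z t ht)) (abs_nonneg _)
      ((abs_nonneg _).trans (hM z))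

theorem isExtendedTrajectory_scaledTrajectory {x : ℝ → ℝ → Fin 2 → ℝ} (hx : IsStateTrajectory x) :
    IsExtendedTrajectory (S.scaledTrajectory x) :=
  IsExtendedTrajectory.coef_mul S.continuous_scaling hx.extend

/-- Relates the vector-valued integral to its components, which is legitimate because each component
is integrable. Since y need only agree with the scaled state on the interval, the formula serves
both for given solutions and for trajectories built from the Volterra equation. -/
theorem IsKernel.transform_apply (hK : S.IsKernel K) {y : ℝ → ℝ → Fin 2 → ℝ}
    (hy : IsExtendedTrajectory y) {w : ℝ → Fin 2 → ℝ} {t : ℝ}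
    (hw : ∀ z ∈ Icc (0 : ℝ) 1, ∀ i, S.scaling i z * w z i = y z t i) {z : ℝ}
    (hz : z ∈ Icc (0 : ℝ) 1) (i : Fin 2) :
    S.transform K w z i = y z t i - volterra K y z t i := by
  have hcoord : ∀ ζ ∈ Icc 0 z, ∀ k, (K z ζ *ᵥ (S.E ζ *ᵥ w ζ)) k
      = ∑ j, kernelExt K k j z ζ * y ζ t j := by
    intro ζ hζ k
    have hζ' : ζ ∈ Icc (0 : ℝ) 1 := ⟨hζ.1, hζ.2.trans hz.2⟩
    simp only [Matrix.mulVec, dotProduct]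
    refine Finset.sum_congr rfl fun j _ => ?_
    rw [kernelExt_of_mem K k j hζ.1 hζ.2 hz.2, ← hw ζ hζ' j, ← S.E_mulVec _ j hζ']
    rfl
  have hint : IntervalIntegrable (fun ζ => fun k => ∑ j, kernelExt K k j z ζ * y ζ t j)
      volume 0 z := by
    rw [intervalIntegrable_iff]
    refine Integrable.of_eval fun k => ?_
    rw [← IntegrableOn, ← intervalIntegrable_iff]
    simp only [Fin.sum_univ_two]
    exact (hK.intervalIntegrable_kernelExt_mul hy k 0 z t 0 z).add
      (hK.intervalIntegrable_kernelExt_mul hy k 1 z t 0 z)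
  have hI : ∫ ζ in (0 : ℝ)..z, K z ζ *ᵥ (S.E ζ *ᵥ w ζ)
      = ∫ ζ in (0 : ℝ)..z, (fun k => ∑ j, kernelExt K k j z ζ * y ζ t j) := by
    refine intervalIntegral.integral_congr fun ζ hζ => ?_
    rw [uIcc_of_le hz.1] at hζ
    exact funext fun k => hcoord ζ hζ k
  have hproj := (ContinuousLinearMap.proj (R := ℝ) (φ := fun _ : Fin 2 => ℝ) i).intervalIntegral_comp_comm
    hint
  rw [transform, Pi.sub_apply, S.E_mulVec _ i hz, hw z hz i, hI]
  congr 1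
  exact hproj.symm

end PDEODESystem

namespace PDEODESystem

variable {n : ℕ} {S : PDEODESystem n} {K : ℝ → ℝ → Matrix (Fin 2) (Fin 2) ℝ}

/-- The exponents in Ã are chosen so that ÃE = E(A - diag A): in each off-diagonal product one of
the two exponentials cancels and the factor of the row remains. -/
theorem sum_scaledCoupling_mul_scaling (i : Fin 2) {z : ℝ} (hz : z ∈ Icc (0 : ℝ) 1)
    (v : Fin 2 → ℝ) :
    ∑ j, S.scaledCoupling i j z * (S.scaling j z * v j)
      = S.scaling i z * ((∑ j, S.coupling i j z * v j) - S.coupling i i z * v i) := by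
  have h0 := S.alpha_eq 0 hz
  have h1 := S.alpha_eq 1 hz
  simp only [Fin.sum_univ_two, scaledCoupling, scaling, coupling, unitClamp_of_mem hz, Atilde,
    travelSign] at *
  rw [← h0, ← h1]
  fin_cases i
  · have : Real.exp (S.alpha 0 z + S.alpha 1 z) * Real.exp (-S.alpha 1 z) = Real.exp (S.alpha 0 z) := by
      rw [← Real.exp_add]; congr 1; ring
    simp [h0.symm]
    linear_combination S.A z 0 1 * v 1 * this
  · have : Real.exp (-S.alpha 0 z - S.alpha 1 z) * Real.exp (S.alpha 0 z) = Real.exp (-S.alpha 1 z) := by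
      rw [← Real.exp_add]; congr 1; ring
    simp [h1.symm]
    linear_combination S.A z 1 0 * v 0 * this

theorem mulVec_A_apply (v : Fin 2 → ℝ) (i : Fin 2) {z : ℝ} (hz : z ∈ Icc (0 : ℝ) 1) :
    (S.A z *ᵥ v) i = ∑ j, S.coupling i j z * v j := by
  simp only [coupling, unitClamp_of_mem hz, Matrix.mulVec, dotProduct]

/-- The scaling removes the diagonal coupling. -/
theorem transports_scaledTrajectory {x : ℝ → ℝ → Fin 2 → ℝ} (hx : IsStateTrajectory x)
    (h : S.Transports (fun z t => S.A z *ᵥ x z t) x) :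
    S.Transports (S.applyCoupling (S.scaledTrajectory x)) (S.scaledTrajectory x) := by
  intro i c a b ha hab hγ
  have hxe := hx.extend
  have hγc := S.continuous_characteristic i c
  have hin := fun s hs => (S.scaledTrajectory_of_mem x (hγ s hs) (ha.trans hs.1))
  set γ := S.characteristic i c with hγdef
  have hu : Continuous fun s => -(S.coupling i i (γ s) * S.scaling i (γ s)) :=
    (((S.continuous_coupling i i).comp hγc).mul ((S.continuous_scaling i).comp hγc)).neg
  have hU : ∀ s, HasDerivAt (fun s => S.scaling i (γ s)) (-(S.coupling i i (γ s) * S.scaling i (γ s))) s :=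
    fun s => by
      -- The logarithmic derivative of the scaling times the velocity of the characteristic is -Aᵢᵢ.
      -- This is what removes the diagonal coupling.
      refine ((S.hasDerivAt_scaling i (γ s)).comp s (S.hasDerivAt_characteristic i c s)).congr_deriv ?_
      have := (S.speed_pos i (γ s)).ne'
      rw [← hγdef]
      field_simp
      linear_combination (-S.scaling i (γ s) * S.coupling i i (γ s)) * travelSign_mul_self i
  have hv : IntervalIntegrable (fun s => ∑ j, S.coupling i j (γ s) * extendTrajectory x (γ s) s j)
      volume a b := by
    simp only [Fin.sum_univ_two]
    exact ((hxe.intervalIntegrable_along 0 hγc.measurable a b).continuousOn_mul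
      ((S.continuous_coupling i 0).comp hγc).continuousOn).add
      ((hxe.intervalIntegrable_along 1 hγc.measurable a b).continuousOn_mul
      ((S.continuous_coupling i 1).comp hγc).continuousOn)
  have key := mul_sub_mul_eq_integral (U := fun s => S.scaling i (γ s))
    (V := fun s => extendTrajectory x (γ s) s i) hab (hu.intervalIntegrable _ _) hv
    (fun s _ => (intervalIntegral.integral_eq_sub_of_hasDerivAt (fun t _ => hU t)
      (hu.intervalIntegrable _ _)).symm)
    (fun s hs => by
      have hsub : ∀ t ∈ Icc a s, t ∈ Icc a b := fun t ht => ⟨ht.1, ht.2.trans hs.2⟩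
      rw [extendTrajectory_of_mem x (hγ s hs) (ha.trans hs.1),
        extendTrajectory_of_mem x (hγ a (left_mem_Icc.2 hab)) ha,
        h i c a s ha hs.1 fun t ht => hγ t (hsub t ht)]
      refine intervalIntegral.integral_congr fun t ht => ?_
      rw [uIcc_of_le hs.1] at ht
      simp only [extendTrajectory_of_mem x (hγ t (hsub t ht)) (ha.trans ht.1)]
      exact mulVec_A_apply _ _ (hγ t (hsub t ht)))
  rw [hin b (right_mem_Icc.2 hab) i, hin a (left_mem_Icc.2 hab) i,
    ← extendTrajectory_of_mem x (hγ b (right_mem_Icc.2 hab)) (ha.trans hab),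
    ← extendTrajectory_of_mem x (hγ a (left_mem_Icc.2 hab)) ha, key]
  refine intervalIntegral.integral_congr fun s hs => ?_
  rw [uIcc_of_le hab] at hs
  have := sum_scaledCoupling_mul_scaling (S := S) i (hγ s hs) (extendTrajectory x (γ s) s)
  simp only [applyCoupling, scaledTrajectory, unitClamp_of_mem (hγ s hs)]
  rw [this]
  ring

/-- Undoing the scaling restores the diagonal coupling. -/
theorem Transports.unscale {y x : ℝ → ℝ → Fin 2 → ℝ} (hy : IsExtendedTrajectory y)
    (h : S.Transports (S.applyCoupling y) y)
    (hxy : ∀ z ∈ Icc (0 : ℝ) 1, ∀ t, 0 ≤ t → ∀ i, S.scaling i z * x z t i = y z t i) :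
    S.Transports (fun z t => S.A z *ᵥ x z t) x := by
  intro i c a b ha hab hγ
  have hγc := S.continuous_characteristic i c
  have hx : ∀ z ∈ Icc (0 : ℝ) 1, ∀ t, 0 ≤ t → ∀ i, x z t i = (S.scaling i z)⁻¹ * y z t i :=
    fun z hz t ht i => by rw [← hxy z hz t ht i, inv_mul_cancel_left₀ (S.scaling_pos i z).ne']
  set γ := S.characteristic i c with hγdef
  have hinv : Continuous fun s => (S.scaling i (γ s))⁻¹ :=
    ((S.continuous_scaling i).comp hγc).inv₀ fun s => (S.scaling_pos i (γ s)).ne'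
  have hu : Continuous fun s => S.coupling i i (γ s) * (S.scaling i (γ s))⁻¹ :=
    ((S.continuous_coupling i i).comp hγc).mul hinv
  have hU : ∀ s, HasDerivAt (fun s => (S.scaling i (γ s))⁻¹)
      (S.coupling i i (γ s) * (S.scaling i (γ s))⁻¹) s := fun s => by
    have h1 := ((S.hasDerivAt_scaling i (γ s)).comp s (S.hasDerivAt_characteristic i c s)).inv
      (S.scaling_pos i (γ s)).ne'
    refine h1.congr_deriv ?_
    have := (S.speed_pos i (γ s)).ne'
    have := (S.scaling_pos i (γ s)).ne'
    rw [← hγdef]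
    simp only [Function.comp]
    field_simp
    linear_combination S.coupling i i (γ s) * travelSign_mul_self i
  have hv := (isExtendedTrajectory_applyCoupling (S := S) hy).intervalIntegrable_along i
    hγc.measurable a b
  have key := mul_sub_mul_eq_integral (U := fun s => (S.scaling i (γ s))⁻¹)
    (V := fun s => y (γ s) s i) hab (hu.intervalIntegrable _ _) hv
    (fun s _ => (intervalIntegral.integral_eq_sub_of_hasDerivAt (fun t _ => hU t)
      (hu.intervalIntegrable _ _)).symm)
    (fun s hs => h i c a s ha hs.1 fun t ht => hγ t ⟨ht.1, ht.2.trans hs.2⟩)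
  rw [hx _ (hγ b (right_mem_Icc.2 hab)) b (ha.trans hab), hx _ (hγ a (left_mem_Icc.2 hab)) a ha, key]
  refine intervalIntegral.integral_congr fun s hs => ?_
  rw [uIcc_of_le hab] at hs
  have h1 := sum_scaledCoupling_mul_scaling (S := S) i (hγ s hs) (x (γ s) s)
  simp only [hxy _ (hγ s hs) s (ha.trans hs.1)] at h1
  have h2 := hxy _ (hγ s hs) s (ha.trans hs.1) i
  simp only [applyCoupling]
  rw [h1, ← h2, mulVec_A_apply _ _ (hγ s hs)]
  have := (S.scaling_pos i (γ s)).ne'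
  field_simp
  ring

/-- The boundary condition at `z = 0` turns the boundary term into the term `C ξ`. -/
theorem IsKernel.boundarySource_eq (hK : S.IsKernel K) (hq0 : S.q0 ≠ 0) {y : ℝ → ℝ → Fin 2 → ℝ}
    {v : Fin n → ℝ} {z t : ℝ} (hz : z ∈ Icc (0 : ℝ) 1)
    (hy : y 0 t 1 = S.q0 * y 0 t 0 + S.c ⬝ᵥ v) (i : Fin 2) :
    S.boundarySource K y z t i = (S.Cmat K z *ᵥ v) i := by
  have h0 : (0 : ℝ) ∈ Icc (0 : ℝ) 1 := ⟨le_rfl, zero_le_one⟩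
  have hC : (S.Cmat K z *ᵥ v) i = K z 0 i 1 * -S.lam 1 0 * (S.c ⬝ᵥ v) := by
    rw [Cmat, ← Matrix.mulVec_mulVec, Matrix.vecMulVec_mulVec]
    simp [Matrix.mulVec, dotProduct, Matrix.mul_apply, Fin.sum_univ_two, Lam]
  have hl0 := (S.lam_pos 0 0 h0).ne'
  have hl1 := (S.lam_pos 1 0 h0).ne'
  rw [hC, boundarySource, Fin.sum_univ_two, hy, kernelExt_of_mem K i 0 le_rfl hz.1 hz.2,
    kernelExt_of_mem K i 1 le_rfl hz.1 hz.2, S.speed_of_mem 0 h0, S.speed_of_mem 1 h0]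
  fin_cases i
  · simp only [Fin.zero_eta, travelSign, Matrix.cons_val_zero, Matrix.cons_val_one]
    rw [hK.bc11 z hz]
    field_simp
    ring
  · simp only [Fin.mk_one, travelSign, Matrix.cons_val_zero, Matrix.cons_val_one]
    rw [hK.bc22 z hz]
    field_simp
    ring

/-- The boundary condition at `z = 1` and its transform. -/
theorem IsKernel.boundary_residual_eq (hK : S.IsKernel K) {y x : ℝ → ℝ → Fin 2 → ℝ}
    (hy : IsExtendedTrajectory y) {t : ℝ}
    (hxy : ∀ z ∈ Icc (0 : ℝ) 1, ∀ i, S.scaling i z * x z t i = y z t i) (u : ℝ → ℝ) :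
    y 1 t 0 - volterra K y 1 t 0 - (S.q1bar * (y 1 t 1 - volterra K y 1 t 1) + S.newInput K u x t)
      = S.scaling 0 1 * (x 1 t 0 - (S.q1 * x 1 t 1 + u t)) := by
  have h1 : (1 : ℝ) ∈ Icc (0 : ℝ) 1 := ⟨zero_le_one, le_rfl⟩
  have hI : ∫ z in (0 : ℝ)..1, (![-1, S.q1bar] : Fin 2 → ℝ) ⬝ᵥ (K 1 z *ᵥ (S.E z *ᵥ x z t))
      = -volterra K y 1 t 0 + S.q1bar * volterra K y 1 t 1 := by
    have hint : ∀ i, IntervalIntegrable (fun ζ => ∑ j, kernelExt K i j 1 ζ * y ζ t j) volume 0 1 := by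
      intro i
      simp only [Fin.sum_univ_two]
      exact (hK.intervalIntegrable_kernelExt_mul hy i 0 1 t 0 1).add
        (hK.intervalIntegrable_kernelExt_mul hy i 1 1 t 0 1)
    have hneg : IntervalIntegrable (fun ζ => -∑ j, kernelExt K 0 j 1 ζ * y ζ t j) volume 0 1 :=
      (hint 0).neg
    rw [volterra, volterra, ← intervalIntegral.integral_const_mul, ← intervalIntegral.integral_neg,
      ← intervalIntegral.integral_add hneg ((hint 1).const_mul _)]
    refine intervalIntegral.integral_congr fun z hz => ?_
    rw [uIcc_of_le zero_le_one] at hz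
    have hE : S.E z *ᵥ x z t = y z t := funext fun j => by rw [S.E_mulVec _ j hz, hxy z hz j]
    simp only [hE]
    simp [Matrix.mulVec, dotProduct, Fin.sum_univ_two, kernelExt_of_mem K _ _ hz.1 hz.2 le_rfl]
  have e0 : S.scaling 0 1 = Real.exp (S.alpha 0 1) := by
    simp [scaling, travelSign, S.alpha_eq 0 h1]
  have e1 : S.scaling 1 1 = Real.exp (-S.alpha 1 1) := by
    simp [scaling, travelSign, S.alpha_eq 1 h1]
  have e2 : Real.exp (S.alpha 0 1 + S.alpha 1 1) * Real.exp (-S.alpha 1 1) = Real.exp (S.alpha 0 1) := by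
    rw [← Real.exp_add]; congr 1; ring
  rw [newInput, hI, ← hxy 1 h1 0, ← hxy 1 h1 1, e0, e1, q1bar]
  linear_combination -(S.q1 * x 1 t 1) * e2

theorem volterra_zero (y : ℝ → ℝ → Fin 2 → ℝ) (t : ℝ) (i : Fin 2) : volterra K y 0 t i = 0 := by
  simp [volterra]

/-- Solutions of the original system are mapped to solutions of the transport form. -/
theorem IsKernel.isTransportSolution (hK : S.IsKernel K) (hq0 : S.q0 ≠ 0) {ξ₀ : Fin n → ℝ}
    {x₀ : ℝ → Fin 2 → ℝ} {u : ℝ → ℝ} {ξ : ℝ → Fin n → ℝ} {x : ℝ → ℝ → Fin 2 → ℝ}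
    (h : S.IsSolution ξ₀ x₀ u ξ x) :
    S.IsTransportSolution K ξ₀ (S.transform K x₀) (S.newInput K u x) ξ
      (fun z t => S.transform K (fun ζ => x ζ t) z) := by
  have h0 : (0 : ℝ) ∈ Icc (0 : ℝ) 1 := ⟨le_rfl, zero_le_one⟩
  have h1 : (1 : ℝ) ∈ Icc (0 : ℝ) 1 := ⟨zero_le_one, le_rfl⟩
  set y := S.scaledTrajectory x with hydef
  have hy : IsExtendedTrajectory y := isExtendedTrajectory_scaledTrajectory h.traj
  have hxy : ∀ z ∈ Icc (0 : ℝ) 1, ∀ t, 0 ≤ t → ∀ i, S.scaling i z * x z t i = y z t i :=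
    fun z hz t ht i => (scaledTrajectory_of_mem x hz ht i).symm
  have hyT := transports_scaledTrajectory h.traj ((S.solvesTransport_iff _ _).1 h.pde)
  have htr : ∀ z ∈ Icc (0 : ℝ) 1, ∀ t, 0 ≤ t → ∀ i, S.transform K (fun ζ => x ζ t) z i
      = y z t i - volterra K y z t i := fun z hz t ht i =>
    hK.transform_apply hy (fun z hz i => hxy z hz t ht i) hz i
  have htr0 : ∀ t, 0 ≤ t → ∀ i, S.transform K (fun ζ => x ζ t) 0 i = x 0 t i := fun t ht i => by
    rw [htr 0 h0 t ht, volterra_zero, sub_zero, ← hxy 0 h0 t ht, scaling_zero, one_mul]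
  refine ⟨?_, h.cont, ?_, ?_, ?_, ?_, ?_⟩
  · refine (hy.sub (hK.isExtendedTrajectory_volterra hy)).isStateTrajectory fun z hz t ht => ?_
    funext i
    rw [htr z hz t ht, unitClamp_of_mem hz]
  · intro z hz
    funext i
    rw [htr z hz 0 le_rfl, hK.transform_apply hy (t := 0) (fun z hz i => ?_) hz i]
    rw [← h.init z hz, hxy z hz 0 le_rfl]
  · intro t ht
    rw [h.ode t ht]
    congr 1
    refine intervalIntegral.integral_congr fun s hs => ?_
    rw [uIcc_of_le ht] at hs
    simp only [htr0 s hs.1]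
  · intro t ht
    simp only [htr0 t ht.le]
    exact h.bc0 t ht
  · rw [S.solvesTransport_iff]
    -- The source is Ãy with the trajectory y itself, so the error and its defect vanish.
    refine (hK.transports_sub_volterra hy hy hyT).congr S (fun z hz t ht => ?_)
      fun z hz t ht => funext fun i => htr z hz t ht i
    funext i
    have hb : y 0 t 1 = S.q0 * y 0 t 0 + S.c ⬝ᵥ ξ t := by
      rw [← hxy 0 h0 t ht.le, ← hxy 0 h0 t ht.le, scaling_zero, scaling_zero, one_mul, one_mul]
      exact h.bc0 t ht
    rw [hK.boundarySource_eq hq0 hz hb]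
    simp [couplingDefect]
  · intro t ht
    simp only [htr 1 h1 t ht.le]
    have := hK.boundary_residual_eq hy (fun z hz i => hxy z hz t ht.le i) u
    rw [h.bc1 t ht, sub_self, mul_zero] at this
    linarith

end PDEODESystem

/-! ### The passage back: trajectories rebuilt from their data at z = 0 and t = 0. -/

theorem travelSign_zero : travelSign 0 = 1 := rfl

theorem travelSign_one : travelSign 1 = -1 := rfl

theorem IsExtendedTrajectory.comp_unitClamp {y : ℝ → ℝ → Fin 2 → ℝ} (hy : IsExtendedTrajectory y) :
    IsExtendedTrajectory fun z t => y (unitClamp z) t := by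
  refine ⟨?_, fun T => ?_⟩
  · exact hy.1.comp ((continuous_unitClamp.measurable.comp measurable_fst).prodMk measurable_snd)
  · obtain ⟨M, hM⟩ := hy.2 T
    exact ⟨M, fun z t ht => hM (unitClamp z) t ht⟩

namespace PDEODESystem

variable {n : ℕ} {S : PDEODESystem n} {K : ℝ → ℝ → Matrix (Fin 2) (Fin 2) ℝ}

/-- The time at which the `i`-th characteristic with label `c` is at its data point: the
characteristics of the first family are followed forward in time to `z = 0`, those of the second
family backward to `z = 0` or to `t = 0`. -/
noncomputable def entryTime (i : Fin 2) (c : ℝ) : ℝ := if i = 0 then c else max (-c) 0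

theorem measurable_entryTime (i : Fin 2) : Measurable (entryTime i) := by
  unfold entryTime
  split_ifs
  · exact measurable_id
  · exact measurable_neg.max measurable_const

theorem measurable_characteristic (S : PDEODESystem n) (i : Fin 2) {α : Type*} [MeasurableSpace α]
    {c s : α → ℝ} (hc : Measurable c) (hs : Measurable s) :
    Measurable fun p => S.characteristic i (c p) (s p) :=
  (S.phi i).symm.continuous.measurable.comp (hc.sub (measurable_const.mul hs))

/-- The label of the `i`-th characteristic through `(z, t)`. -/
noncomputable def label (S : PDEODESystem n) (i : Fin 2) (z t : ℝ) : ℝ :=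
  S.phi i z + travelSign i * t

theorem characteristic_label (i : Fin 2) (z t : ℝ) : S.characteristic i (S.label i z t) t = z := by
  simp [characteristic, label]

theorem label_characteristic (i : Fin 2) (c s : ℝ) : S.label i (S.characteristic i c s) s = c := by
  simp [characteristic, label]

/-- The value transported with source `f` along a characteristic from its data point. -/
noncomputable def transportedValue (S : PDEODESystem n) (y f : ℝ → ℝ → Fin 2 → ℝ) (i : Fin 2)
    (c t : ℝ) : ℝ :=
  y (S.characteristic i c (entryTime i c)) (entryTime i c) i
    + ∫ s in entryTime i c..t, f (S.characteristic i c s) s i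

/-- The trajectory that is transported with source `f` and coincides with `y` at the data points. -/
noncomputable def transportedTrajectory (S : PDEODESystem n) (y f : ℝ → ℝ → Fin 2 → ℝ) (z t : ℝ)
    (i : Fin 2) : ℝ :=
  S.transportedValue y f i (S.label i (unitClamp z) (max 0 t)) (max 0 t)

theorem transportedTrajectory_of_mem (y f : ℝ → ℝ → Fin 2 → ℝ) {z t : ℝ} (hz : z ∈ Icc (0 : ℝ) 1)
    (ht : 0 ≤ t) (i : Fin 2) :
    S.transportedTrajectory y f z t i = S.transportedValue y f i (S.label i z t) t := by
  rw [transportedTrajectory, unitClamp_of_mem hz, max_eq_right ht]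

/-- Following the first family to z = 0 looks into the future, but by at most its travel time across
[0, 1]. Values rebuilt up to a time T therefore depend on data over a bounded time interval. -/
theorem entryTime_label_mem (i : Fin 2) {z t : ℝ} (hz : z ∈ Icc (0 : ℝ) 1) (ht : 0 ≤ t) :
    entryTime i (S.label i z t) ∈ Icc 0 (t + S.phi 0 1) := by
  have h0 := S.phi_nonneg i hz.1
  have h2 := S.phi_nonneg 0 zero_le_one
  fin_cases i
  · have h1 := (S.phi 0).monotone hz.2
    simp only [entryTime, label, travelSign, Fin.zero_eta, if_true, Matrix.cons_val_zero, mem_Icc]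
      at *
    constructor <;> linarith
  · simp only [entryTime, label, travelSign, Fin.mk_one, one_ne_zero, if_false, Matrix.cons_val_one,
      mem_Icc] at *
    exact ⟨le_max_right _ _, max_le (by simp at *; linarith) (by linarith)⟩

theorem isExtendedTrajectory_transportedTrajectory {y f : ℝ → ℝ → Fin 2 → ℝ}
    (hy : IsExtendedTrajectory y) (hf : IsExtendedTrajectory f) :
    IsExtendedTrajectory (S.transportedTrajectory y f) := by
  refine IsExtendedTrajectory.of_coord (fun i => ?_) fun i T => ?_
  · have ht : Measurable fun p : ℝ × ℝ => max 0 p.2 := measurable_const.max measurable_snd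
    have hl : Measurable fun p : ℝ × ℝ => S.label i (unitClamp p.1) (max 0 p.2) :=
      (((S.phi i).continuous.comp continuous_unitClamp).measurable.comp measurable_fst).add
        (measurable_const.mul ht)
    have he := (measurable_entryTime i).comp hl
    refine Measurable.add ?_ ?_
    · exact (hy.measurable_coord i).comp ((S.measurable_characteristic i hl he).prodMk he)
    · refine measurable_intervalIntegral_param ?_ he ht
      exact (hf.measurable_coord i).comp
        ((S.measurable_characteristic i (hl.comp measurable_fst) measurable_snd).prodMk measurable_snd)
  · obtain ⟨Y, hY⟩ := hy.2 (max 0 T + S.phi 0 1)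
    obtain ⟨Φ, hΦ⟩ := hf.2 (max 0 T + S.phi 0 1)
    have hT : 0 ≤ max 0 T + S.phi 0 1 := add_nonneg (le_max_left _ _) (S.phi_nonneg 0 zero_le_one)
    have hΦ0 : 0 ≤ Φ := (norm_nonneg _).trans (hΦ 0 _ le_rfl)
    refine ⟨Y + Φ * (max 0 T + S.phi 0 1), fun z t ht => ?_⟩
    have h1 : max 0 t ≤ max 0 T := max_le_max le_rfl ht
    have h2 := entryTime_label_mem (S := S) i (unitClamp_mem z) (le_max_left 0 t)
    set τ := entryTime i (S.label i (unitClamp z) (max 0 t)) with hτ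
    have h3 : τ ≤ max 0 T + S.phi 0 1 := by linarith [h2.2]
    have h5 : max 0 t ≤ max 0 T + S.phi 0 1 := by linarith [S.phi_nonneg 0 zero_le_one]
    refine (abs_add_le _ _).trans (add_le_add ?_ ?_)
    · exact (norm_le_pi_norm (y _ _) i).trans (hY _ _ h3)
    · rw [← Real.norm_eq_abs]
      refine (intervalIntegral.norm_integral_le_of_norm_le_const (C := Φ) fun s hs => ?_).trans ?_
      · exact (norm_le_pi_norm (f _ _) i).trans (hΦ _ _ (hs.2.trans (max_le h3 h5)))
      · refine mul_le_mul_of_nonneg_left ?_ hΦ0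
        rw [← hτ, abs_le]
        constructor <;> linarith [h2.1, le_max_left 0 t]

/-- The label is constant along a characteristic, so two values on it share the data point and
differ only in the upper limit of the integral. -/
theorem transports_transportedTrajectory {y f : ℝ → ℝ → Fin 2 → ℝ} (hf : IsExtendedTrajectory f) :
    S.Transports f (S.transportedTrajectory y f) := by
  intro i c a b ha hab hγ
  have hint : ∀ s t, IntervalIntegrable (fun s => f (S.characteristic i c s) s i) volume s t :=
    hf.intervalIntegrable_along i (S.continuous_characteristic i c).measurable
  rw [transportedTrajectory_of_mem y f (hγ b (right_mem_Icc.2 hab)) (ha.trans hab),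
    transportedTrajectory_of_mem y f (hγ a (left_mem_Icc.2 hab)) ha, label_characteristic,
    label_characteristic, transportedValue, transportedValue, add_sub_add_left_eq_sub]
  exact intervalIntegral.integral_interval_sub_left (hint _ _) (hint _ _)

/-- Position replaces time as the variable: the weight has the derivative of modulus μλᵢ exp(μγ)
along the characteristic, and Λλᵢ ≥ 1. Integrals in time thus gain the same factor 1/μ as integrals
in z. -/
theorem integral_exp_characteristic_le {Λ μ : ℝ} (hΛ : ∀ i z, (S.speed i z)⁻¹ ≤ Λ) (hμ : 0 < μ)
    (i : Fin 2) (c : ℝ) {a b : ℝ} (hab : a ≤ b) :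
    ∫ s in a..b, Real.exp (μ * S.characteristic i c s)
      ≤ travelSign i * (Λ / μ * (Real.exp (μ * S.characteristic i c a)
          - Real.exp (μ * S.characteristic i c b))) := by
  have hc := S.continuous_characteristic i c
  have hsc := (S.continuous_speed i).comp hc
  have hd : ∀ s, HasDerivAt (fun s => -travelSign i * (Λ / μ) * Real.exp (μ * S.characteristic i c s))
      (Λ * S.speed i (S.characteristic i c s) * Real.exp (μ * S.characteristic i c s)) s := by
    intro s
    refine ((((S.hasDerivAt_characteristic i c s).const_mul μ).exp).const_mul _).congr_deriv ?_
    field_simp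
    linear_combination (Λ * S.speed i (S.characteristic i c s)) * travelSign_mul_self i
  have hcont : Continuous fun s =>
      Λ * S.speed i (S.characteristic i c s) * Real.exp (μ * S.characteristic i c s) :=
    (continuous_const.mul hsc).mul (Real.continuous_exp.comp (continuous_const.mul hc))
  have h1 := intervalIntegral.integral_eq_sub_of_hasDerivAt (fun s _ => hd s)
    (hcont.intervalIntegrable a b)
  have h2 : ∫ s in a..b, Real.exp (μ * S.characteristic i c s)
      ≤ ∫ s in a..b, Λ * S.speed i (S.characteristic i c s) * Real.exp (μ * S.characteristic i c s) := by
    refine intervalIntegral.integral_mono_on hab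
      ((Real.continuous_exp.comp (continuous_const.mul hc)).intervalIntegrable _ _)
      (hcont.intervalIntegrable _ _) fun s _ => ?_
    refine le_mul_of_one_le_left (Real.exp_pos _).le ?_
    have hp := S.speed_pos i (S.characteristic i c s)
    have := mul_le_mul_of_nonneg_right (hΛ i (S.characteristic i c s)) hp.le
    rwa [inv_mul_cancel₀ hp.ne'] at this
  refine h2.trans (h1.le.trans (le_of_eq ?_))
  ring

theorem IsKernel.isExtendedTrajectory_couplingDefect (hK : S.IsKernel K) {e : ℝ → ℝ → Fin 2 → ℝ}
    (he : IsExtendedTrajectory e) :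
    IsExtendedTrajectory fun z t i => S.couplingDefect K e (unitClamp z) t i := by
  obtain ⟨N, hN0, hN⟩ := hK.exists_kernelCoupling_le
  have h1 := he.integral_sum_mul hK.continuous_kernelCoupling hN0 hN
  have h2 := (isExtendedTrajectory_applyCoupling (S := S) he).comp_unitClamp
  have h3 : (fun z t i => S.couplingDefect K e (unitClamp z) t i) = fun z t i =>
      (∫ ζ in 0..unitClamp z, ∑ j, S.kernelCoupling K i j (unitClamp z) ζ * e ζ t j)
        - S.applyCoupling e (unitClamp z) t i := by
    funext z t i
    rw [couplingDefect, applyCoupling]; ring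
  rw [h3]
  exact h1.sub h2

theorem IsKernel.intervalIntegrable_boundarySource (hK : S.IsKernel K) {y : ℝ → ℝ → Fin 2 → ℝ}
    (hy : IsExtendedTrajectory y) (i : Fin 2) {γ : ℝ → ℝ} (hγ : Continuous γ) (a b : ℝ) :
    IntervalIntegrable (fun s => S.boundarySource K y (γ s) s i) volume a b := by
  have h : ∀ j, IntervalIntegrable
      (fun s => travelSign j * S.speed j 0 * (kernelExt K i j (γ s) 0 * y 0 s j)) volume a b := by
    intro j
    have hk : Continuous fun s => kernelExt K i j (γ s) 0 :=
      (hK.continuous_kernelExt i j).comp (hγ.prodMk continuous_const)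
    exact ((hy.intervalIntegrable_along j (measurable_const (a := (0 : ℝ))) a b).continuousOn_mul
      hk.continuousOn).const_mul _
  simp only [boundarySource, Fin.sum_univ_two]
  exact (h 0).add (h 1)

/-- The characteristic between `(z, t)` and its data point stays in a set on which the error can be
estimated by Volterra's method. -/
theorem exists_path_of_label (i : Fin 2) {z t : ℝ} (hz : z ∈ Icc (0 : ℝ) 1) (ht : 0 ≤ t) :
    ∃ a b, a ≤ b ∧ 0 ≤ a ∧ ((a = t ∧ b = entryTime i (S.label i z t) ∧ i = 0)
        ∨ (a = entryTime i (S.label i z t) ∧ b = t ∧ i = 1)) ∧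
      ∀ s ∈ Icc a b, 0 ≤ S.characteristic i (S.label i z t) s ∧
        S.characteristic i (S.label i z t) s ≤ z ∧
        s + S.phi 0 (S.characteristic i (S.label i z t) s) ≤ t + S.phi 0 z := by
  have hzφ := S.phi_nonneg i hz.1
  set c := S.label i z t with hc
  set γ := S.characteristic i c with hγ
  set τ := entryTime i c with hτ
  have hphi : ∀ s, S.phi i (γ s) = S.phi i z + travelSign i * t - travelSign i * s := fun s => by
    simp [hγ, characteristic, hc, label]
  have hle_of : ∀ s, S.phi i (γ s) ≤ S.phi i z → γ s ≤ z := fun s h => (S.phi i).le_iff_le.1 h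
  have hge_of : ∀ s, 0 ≤ S.phi i (γ s) → 0 ≤ γ s := fun s h => by
    rw [← S.phi_zero i] at h; exact (S.phi i).le_iff_le.1 h
  rcases (show i = 0 ∨ i = 1 by fin_cases i <;> simp) with hi | hi
  · subst hi
    have hτe : τ = S.phi 0 z + t := by simp [hτ, entryTime, hc, label, travelSign_zero]
    simp only [travelSign_zero, one_mul] at hphi
    refine ⟨t, τ, by linarith, ht, Or.inl ⟨rfl, rfl, rfl⟩, fun s hs => ?_⟩
    have h1 := hge_of s (by rw [hphi]; linarith [hs.2])
    have h2 := hle_of s (by rw [hphi]; linarith [hs.1])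
    exact ⟨h1, h2, by rw [hphi]; linarith⟩
  · subst hi
    have hτe : τ = max (t - S.phi 1 z) 0 := by
      simp [hτ, entryTime, hc, label, travelSign_one]; ring_nf
    simp only [travelSign_one, neg_one_mul] at hphi
    refine ⟨τ, t, ?_, ?_, Or.inr ⟨rfl, rfl, rfl⟩, fun s hs => ?_⟩
    · rw [hτe]; exact max_le (by linarith) ht
    · rw [hτe]; exact le_max_right _ _
    have h3 : t - S.phi 1 z ≤ s := (le_max_left _ _).trans (hτe ▸ hs.1)
    have h1 := hge_of s (by rw [hphi]; linarith)
    have h2 := hle_of s (by rw [hphi]; linarith [hs.2])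
    have h6 := (S.phi 0).monotone h2
    exact ⟨h1, h2, by linarith [hs.2]⟩

/-- The homogeneous problem for the error has only the trivial solution. -/
theorem IsKernel.eq_zero_of_transports_couplingDefect (hK : S.IsKernel K)
    {e : ℝ → ℝ → Fin 2 → ℝ} (he : IsExtendedTrajectory e)
    (hT : S.Transports (S.couplingDefect K e) fun z t i => e z t i - volterra K e z t i)
    (h0 : ∀ i, ∀ z ∈ Icc (0 : ℝ) 1, ∀ t, 0 ≤ t →
      e (S.characteristic i (S.label i z t) (entryTime i (S.label i z t)))
        (entryTime i (S.label i z t)) i = 0) :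
    ∀ z ∈ Icc (0 : ℝ) 1, ∀ t, 0 ≤ t → e z t = 0 := by
  obtain ⟨M, hM0, hM⟩ := hK.exists_kernelExt_le
  obtain ⟨N, hN0, hN⟩ := hK.exists_kernelCoupling_le
  obtain ⟨A, hA0, hA⟩ := S.exists_scaledCoupling_le
  obtain ⟨Λ, hΛ0, hΛ⟩ := S.exists_inv_speed_le
  intro z₁ hz₁ t₁ ht₁
  -- The set `D` of points with t + φ₁(z) ≤ T, φ₁ being the travel time of the first component, is a
  -- domain of dependence. It is closed under decreasing z at fixed t and contains the paths from
  -- its points to their data points. All its times are at most T, so e is bounded on it.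
  set T := t₁ + S.phi 0 z₁ with hTdef
  set Q := 2 * A + 2 * N with hQ
  -- The Volterra integrals at the point and at its data point contribute 2M/μ each, and the defect,
  -- bounded by Q, contributes QΛ/μ. The sum is at most 1/2. The summand 1 makes μ ≥ 1, so that the
  -- integral part of the defect fits into Q.
  set μ : ℝ := 2 * (4 * M + Q * Λ) + 1 with hμd
  have hμ1 : 1 ≤ μ := by
    have : 0 ≤ 2 * (4 * M + Q * Λ) := by positivity
    linarith
  have hμ : 0 < μ := by linarith
  set D : Set (ℝ × ℝ) := {p | p.1 ∈ Icc (0 : ℝ) 1 ∧ 0 ≤ p.2 ∧ p.2 + S.phi 0 p.1 ≤ T} with hD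
  obtain ⟨Y, hY⟩ := he.2 T
  have hbd : ∀ p ∈ D, ‖e p.1 p.2‖ ≤ |Y| * Real.exp (μ * p.1) := by
    intro p hp
    have h1 : p.2 ≤ T := by linarith [hp.2.2, S.phi_nonneg 0 hp.1.1]
    exact ((hY _ _ h1).trans (le_abs_self _)).trans (le_mul_of_one_le_right (abs_nonneg _)
      (Real.one_le_exp (mul_nonneg hμ.le hp.1.1)))
  have hdown : ∀ {z t : ℝ}, (z, t) ∈ D → ∀ ζ ∈ Icc 0 z, (ζ, t) ∈ D := fun {z t} hp ζ hζ =>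
    ⟨⟨hζ.1, hζ.2.trans hp.1.2⟩, hp.2.1, by
      have := (S.phi 0).monotone hζ.2
      have h2 := hp.2.2
      simp only at h2 ⊢
      linarith⟩
  have hmain := norm_le_two_mul_of_contraction (w := fun p : ℝ × ℝ => Real.exp (μ * p.1)) (D := D)
    (f := fun p => e p.1 p.2) (M := 0) (B := |Y|) (fun _ _ => (Real.exp_pos _).le) le_rfl hbd ?_
    (z₁, t₁) ⟨hz₁, ht₁, le_rfl⟩
  · simpa using hmain
  rintro B hB hBe ⟨z, t⟩ hp
  have hz := hp.1
  have ht := hp.2.1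
  simp only at hz ht ⊢
  rw [zero_add, pi_norm_le_iff_of_nonneg (by positivity)]
  intro i
  rw [Real.norm_eq_abs]
  have hvol : ∀ {z t : ℝ}, (z, t) ∈ D → |volterra K e z t i| ≤ 2 * M * B / μ * Real.exp (μ * z) :=
    fun {z t} hp => abs_volterra_le hM0 hM hB hμ hp.1.1 (fun ζ hζ => hBe (ζ, t) (hdown hp ζ hζ)) i
  have hdef : ∀ {z t : ℝ}, (z, t) ∈ D → |S.couplingDefect K e z t i| ≤ Q * B * Real.exp (μ * z) := by
    intro z t hp
    have h1 := abs_integral_sum_mul_le (k := fun j ζ => S.kernelCoupling K i j z ζ) hN0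
      (fun j ζ => hN i j z ζ) hB hμ hp.1.1 (fun ζ hζ => hBe (ζ, t) (hdown hp ζ hζ))
    have h2 : |∑ j, S.scaledCoupling i j z * e z t j| ≤ 2 * A * (B * Real.exp (μ * z)) :=
      abs_sum_fin_two_mul_le hA0 (fun j => hA i j z)
        fun j => (norm_le_pi_norm (e z t) j).trans (hBe (z, t) hp)
    have h3 : 2 * N * B / μ * Real.exp (μ * z) ≤ 2 * N * B * Real.exp (μ * z) :=
      mul_le_mul_of_nonneg_right (div_le_self (by positivity) hμ1) (Real.exp_pos _).le
    rw [couplingDefect]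
    refine (abs_add_le _ _).trans ?_
    rw [abs_neg, hQ]
    linarith
  obtain ⟨a, b, hab, ha, hcase, hpath⟩ := exists_path_of_label (S := S) i hz ht
  set c := S.label i z t with hc
  set γ := S.characteristic i c with hγ
  set τ := entryTime i c with hτ
  have hγt : γ t = z := characteristic_label i z t
  have hin : ∀ s ∈ Icc a b, (γ s, s) ∈ D ∧ γ s ≤ z := fun s hs =>
    ⟨⟨⟨(hpath s hs).1, (hpath s hs).2.1.trans hz.2⟩, ha.trans hs.1,
      (hpath s hs).2.2.trans hp.2.2⟩, (hpath s hs).2.1⟩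
  have hinc := hT i c a b ha hab fun s hs => (hin s hs).1.1
  have hexp := integral_exp_characteristic_le (S := S) hΛ hμ i c hab
  have hQΛ : 0 ≤ Λ / μ := by positivity
  have hbound : |∫ s in a..b, S.couplingDefect K e (γ s) s i| ≤ Q * B * (Λ / μ * Real.exp (μ * z)) := by
    have hQ0 : 0 ≤ Q * B := by positivity
    have h1 := intervalIntegral.norm_integral_le_of_norm_le (μ := volume)
      (f := fun s => S.couplingDefect K e (γ s) s i)
      (g := fun s => Q * B * Real.exp (μ * γ s)) hab
      (Filter.Eventually.of_forall fun s hs => hdef (hin s (Ioc_subset_Icc_self hs)).1)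
      ((continuous_const.mul (Real.continuous_exp.comp (continuous_const.mul
        (S.continuous_characteristic i c)))).intervalIntegrable _ _)
    rw [intervalIntegral.integral_const_mul] at h1
    refine h1.trans (mul_le_mul_of_nonneg_left (hexp.trans ?_) hQ0)
    have e1 := Real.exp_pos (μ * γ a)
    have e2 := Real.exp_pos (μ * γ b)
    rcases hcase with ⟨rfl, -, rfl⟩ | ⟨-, rfl, rfl⟩
    · simp only [travelSign_zero, one_mul]
      rw [← hγ, hγt]
      exact mul_le_mul_of_nonneg_left (by linarith) hQΛ
    · simp only [travelSign_one, neg_one_mul]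
      rw [← hγ, hγt, ← mul_neg]
      exact mul_le_mul_of_nonneg_left (by linarith) hQΛ
  have hτD : (γ τ, τ) ∈ D ∧ γ τ ≤ z := by
    rcases hcase with ⟨-, rfl, -⟩ | ⟨rfl, -, -⟩
    · exact hin _ (right_mem_Icc.2 hab)
    · exact hin _ (left_mem_Icc.2 hab)
  have hentry : e (γ τ) τ i = 0 := h0 i z hz t ht
  -- The first family reaches its data point forward in time and the second backward, so the
  -- increment enters with either sign. At the data point only the Volterra integral survives, since
  -- e vanishes there.
  have hdiff : |(e z t i - volterra K e z t i) - (e (γ τ) τ i - volterra K e (γ τ) τ i)|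
      ≤ Q * B * (Λ / μ * Real.exp (μ * z)) := by
    rcases hcase with ⟨h1, h2, -⟩ | ⟨h1, h2, -⟩
    · rw [abs_sub_comm]
      rw [h1, h2, ← hγ, hγt] at hinc
      rw [h1, h2] at hbound
      rw [hinc]; exact hbound
    · rw [h1, h2, ← hγ, hγt] at hinc
      rw [h1, h2] at hbound
      rw [hinc]; exact hbound
  rw [hentry, zero_sub, sub_neg_eq_add] at hdiff
  have hv1 := hvol hp
  have hv2 : |volterra K e (γ τ) τ i| ≤ 2 * M * B / μ * Real.exp (μ * z) := by
    refine (hvol hτD.1).trans (mul_le_mul_of_nonneg_left ?_ (by positivity))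
    exact Real.exp_le_exp.2 (mul_le_mul_of_nonneg_left hτD.2 hμ.le)
  have hdec : e z t i = (e z t i - volterra K e z t i + volterra K e (γ τ) τ i)
      + volterra K e z t i - volterra K e (γ τ) τ i := by ring
  have htri : |e z t i| ≤ |e z t i - volterra K e z t i + volterra K e (γ τ) τ i|
      + |volterra K e z t i| + |volterra K e (γ τ) τ i| := by
    conv_lhs => rw [hdec]
    exact (abs_sub _ _).trans (add_le_add (abs_add_le _ _) le_rfl)
  have hfin : Q * B * (Λ / μ * Real.exp (μ * z)) + 2 * M * B / μ * Real.exp (μ * z)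
      + 2 * M * B / μ * Real.exp (μ * z) ≤ B / 2 * Real.exp (μ * z) := by
    have h1 : Q * B * (Λ / μ * Real.exp (μ * z)) + 2 * M * B / μ * Real.exp (μ * z)
      + 2 * M * B / μ * Real.exp (μ * z) = (4 * M + Q * Λ) / μ * (B * Real.exp (μ * z)) := by
      field_simp; ring
    have h2 : (4 * M + Q * Λ) / μ ≤ 1 / 2 := by
      rw [div_le_div_iff₀ hμ two_pos]; linarith
    rw [h1]
    refine (mul_le_mul_of_nonneg_right h2 (by positivity)).trans (le_of_eq ?_)
    ring
  linarith

/-- If `y - ∫ K y` is transported with the boundary term of `y` as source, then `y` is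
transported with the source `Ã y`. -/
theorem IsKernel.transports_of_sub_volterra (hK : S.IsKernel K) {y : ℝ → ℝ → Fin 2 → ℝ}
    (hy : IsExtendedTrajectory y)
    (hT : S.Transports (S.boundarySource K y) fun z t i => y z t i - volterra K y z t i) :
    S.Transports (S.applyCoupling y) y := by
  have hf := isExtendedTrajectory_applyCoupling (S := S) hy
  set f := S.applyCoupling y with hfdef
  -- The comparison trajectory w is transported with the source Ãy by construction and shares the
  -- data of y. It remains to show w = y.
  have hys := isExtendedTrajectory_transportedTrajectory (S := S) hy hf
  have hyT := transports_transportedTrajectory (S := S) (y := y) hf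
  set w := S.transportedTrajectory y f with hw
  have h01 : (0 : ℝ) ∈ Icc (0 : ℝ) 1 := ⟨le_rfl, zero_le_one⟩
  have hdata : ∀ i, ∀ z ∈ Icc (0 : ℝ) 1, ∀ t, 0 ≤ t → entryTime i (S.label i z t) = t →
      w z t i = y z t i := by
    intro i z hz t ht h
    rw [hw, transportedTrajectory_of_mem y f hz ht, transportedValue, h, characteristic_label,
      intervalIntegral.integral_same, add_zero]
  -- Every point of z = 0 is its own data point for both families. Hence w and y have the same
  -- boundary source K(z,0)Λ(0)y(0,t), which cancels in the equation for w - y.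
  have hzero : ∀ i t, 0 ≤ t → w 0 t i = y 0 t i := by
    intro i t ht
    refine hdata i 0 h01 t ht ?_
    fin_cases i
    · simp [entryTime, label, S.phi_zero, travelSign]
    · simp [entryTime, label, S.phi_zero, travelSign, ht]
  have he := hys.sub hy
  set e := fun z t i => w z t i - y z t i with hedef
  have hsub := fun z t i => hK.volterra_sub hys hy z t i
  have hdT : S.Transports (S.couplingDefect K e) fun z t i => e z t i - volterra K e z t i := by
    intro i c a b ha hab hγ
    have h1 := hK.transports_sub_volterra hys hy hyT i c a b ha hab hγ
    have h2 := hT i c a b ha hab hγ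
    have hγc := S.continuous_characteristic i c
    have hbs : ∀ s ∈ uIcc a b, S.boundarySource K w (S.characteristic i c s) s i
        = S.boundarySource K y (S.characteristic i c s) s i := by
      intro s hs
      rw [uIcc_of_le hab] at hs
      simp only [boundarySource, hzero _ s (ha.trans hs.1)]
    have hcd : IntervalIntegrable (fun s => S.couplingDefect K e (S.characteristic i c s) s i)
        volume a b := by
      refine ((hK.isExtendedTrajectory_couplingDefect he).intervalIntegrable_along i
        hγc.measurable a b).congr fun s hs => ?_
      rw [uIoc_of_le hab] at hs
      simp only [unitClamp_of_mem (hγ s (Ioc_subset_Icc_self hs))]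
    simp only at h1 h2
    rw [intervalIntegral.integral_add (hK.intervalIntegrable_boundarySource hys i hγc a b) hcd,
      intervalIntegral.integral_congr hbs, ← h2] at h1
    simp only [hedef, hsub] at h1 ⊢
    linarith
  have hentry : ∀ i, ∀ z ∈ Icc (0 : ℝ) 1, ∀ t, 0 ≤ t →
      e (S.characteristic i (S.label i z t) (entryTime i (S.label i z t)))
        (entryTime i (S.label i z t)) i = 0 := by
    intro i z hz t ht
    have hm := entryTime_label_mem (S := S) i hz ht
    have hmem : S.characteristic i (S.label i z t) (entryTime i (S.label i z t)) ∈ Icc (0 : ℝ) 1 := by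
      obtain ⟨a, b, hab, -, hcase, hin⟩ := exists_path_of_label (S := S) i hz ht
      have := hin (entryTime i (S.label i z t)) (by
        rcases hcase with ⟨-, h, -⟩ | ⟨h, -, -⟩
        · rw [← h]; exact right_mem_Icc.2 hab
        · rw [← h]; exact left_mem_Icc.2 hab)
      exact ⟨this.1, this.2.1.trans hz.2⟩
    refine sub_eq_zero.2 (hdata i _ hmem _ hm.1 ?_)
    rw [label_characteristic]
  have hzero' := hK.eq_zero_of_transports_couplingDefect he hdT hentry
  refine hyT.congr S (fun _ _ _ _ => rfl) fun z hz t ht => funext fun i => ?_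
  have := congrFun (hzero' z hz t ht) i
  exact (sub_eq_zero.1 this).symm

end PDEODESystem

/-! ### Existence of the kernel. -/

theorem continuous_intervalIntegral_param {α : Type*} [TopologicalSpace α]
    {f : α → ℝ → ℝ} (hf : Continuous (Function.uncurry f)) {l u : α → ℝ} (hl : Continuous l)
    (hu : Continuous u) : Continuous fun x => ∫ t in l x..u x, f x t := by
  have hi : ∀ x a b, IntervalIntegrable (f x) volume a b := fun x a b =>
    (hf.comp (Continuous.prodMk_right x)).intervalIntegrable a b
  have h : (fun x => ∫ t in l x..u x, f x t)
      = fun x => (∫ t in (0 : ℝ)..u x, f x t) - ∫ t in (0 : ℝ)..l x, f x t := by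
    funext x
    rw [intervalIntegral.integral_interval_sub_left (hi _ _ _) (hi _ _ _)]
  rw [h]
  exact (intervalIntegral.continuous_parametric_intervalIntegral_of_continuous hf hu).sub
    (intervalIntegral.continuous_parametric_intervalIntegral_of_continuous hf hl)

theorem hasDerivWithinAt_integral_comp {h : ℝ → ℝ} (hh : Continuous h) {u : ℝ → ℝ} {u' s k : ℝ}
    {t : Set ℝ} (hu : HasDerivWithinAt u u' t s) :
    HasDerivWithinAt (fun s => ∫ σ in k..u s, h σ) (h (u s) * u') t s :=
  (intervalIntegral.integral_hasDerivAt_right (hh.intervalIntegrable k (u s))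
    hh.aestronglyMeasurable.stronglyMeasurableAtFilter hh.continuousAt).comp_hasDerivWithinAt s hu

/-- The retraction of the plane onto the triangle `0 ≤ ζ ≤ z ≤ 1`. -/
def triangleClamp (p : ℝ × ℝ) : ℝ × ℝ := (unitClamp p.1, max 0 (min p.2 (unitClamp p.1)))

theorem continuous_triangleClamp : Continuous triangleClamp := by
  have := continuous_unitClamp
  unfold triangleClamp
  fun_prop

theorem triangleClamp_mem (p : ℝ × ℝ) : 0 ≤ (triangleClamp p).2 ∧
    (triangleClamp p).2 ≤ (triangleClamp p).1 ∧ (triangleClamp p).1 ≤ 1 :=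
  ⟨le_max_left _ _, max_le (unitClamp_mem _).1 (min_le_right _ _), (unitClamp_mem _).2⟩

theorem triangleClamp_of_mem {p : ℝ × ℝ} (h0 : 0 ≤ p.2) (h1 : p.2 ≤ p.1) (h2 : p.1 ≤ 1) :
    triangleClamp p = p := by
  rw [triangleClamp, unitClamp_of_mem ⟨h0.trans h1, h2⟩, min_eq_left h1, max_eq_right h0]

namespace PDEODESystem

variable {n : ℕ} {S : PDEODESystem n}

/-- Along characteristics on which z and ζ move in opposite directions, φᵢ(z) + φⱼ(ζ) is constant.
The inverse of this sum, taken on the diagonal, locates the point where such a characteristic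
starts. -/
theorem exists_sum_phi (S : PDEODESystem n) (i j : Fin 2) :
    ∃ e : ℝ ≃o ℝ, ∀ z, e z = S.phi i z + S.phi j z := by
  have hmono : StrictMono fun z => S.phi i z + S.phi j z :=
    (S.phi i).strictMono.add (S.phi j).strictMono
  have hcont : Continuous fun z => S.phi i z + S.phi j z :=
    (S.phi i).continuous.add (S.phi j).continuous
  have hsurj : Function.Surjective fun z => S.phi i z + S.phi j z :=
    hcont.surjective ((S.phi i).tendsto_atTop.atTop_add_atTop (S.phi j).tendsto_atTop)
      ((S.phi i).tendsto_atBot.atBot_add_atBot (S.phi j).tendsto_atBot)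
  exact ⟨hmono.orderIsoOfSurjective _ hsurj, fun z => rfl⟩

/-- The integral along the characteristics that are parallel to the diagonal. -/
noncomputable def parallelIntegral (S : PDEODESystem n) (i : Fin 2) (g : ℝ → ℝ) (b : ℝ × ℝ → ℝ)
    (p : ℝ × ℝ) : ℝ :=
  ∫ σ in (0 : ℝ)..S.phi i p.2, g ((S.phi i).symm σ) *
    b ((S.phi i).symm (S.phi i p.1 - S.phi i p.2 + σ), (S.phi i).symm σ)

/-- The integral along the characteristics that start on the diagonal. -/
noncomputable def transversalIntegral (S : PDEODESystem n) (i j : Fin 2) (e : ℝ ≃o ℝ) (g : ℝ → ℝ)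
    (a : ℝ × ℝ → ℝ) (p : ℝ × ℝ) : ℝ :=
  ∫ τ in S.phi i (e.symm (S.phi i p.1 + S.phi j p.2))..S.phi i p.1,
    g ((S.phi j).symm (S.phi i p.1 + S.phi j p.2 - τ)) *
      a ((S.phi i).symm τ, (S.phi j).symm (S.phi i p.1 + S.phi j p.2 - τ))

theorem continuous_parallelIntegral (i : Fin 2) {g : ℝ → ℝ} (hg : Continuous g) {b : ℝ × ℝ → ℝ}
    (hb : Continuous b) : Continuous (S.parallelIntegral i g b) := by
  have h1 := (S.phi i).continuous
  have h2 := (S.phi i).symm.continuous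
  refine continuous_intervalIntegral_param ?_ continuous_const (h1.comp continuous_snd)
  unfold Function.uncurry
  fun_prop

theorem continuous_transversalIntegral (i j : Fin 2) (e : ℝ ≃o ℝ) {g : ℝ → ℝ} (hg : Continuous g)
    {a : ℝ × ℝ → ℝ} (ha : Continuous a) : Continuous (S.transversalIntegral i j e g a) := by
  have h1 := (S.phi i).continuous
  have h2 := (S.phi i).symm.continuous
  have h3 := (S.phi j).continuous
  have h4 := (S.phi j).symm.continuous
  have h5 := e.symm.continuous
  refine continuous_intervalIntegral_param ?_ ?_ ?_
  · unfold Function.uncurry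
    fun_prop
  · fun_prop
  · fun_prop

/-- At the parameter σ the first coordinate has travel time φᵢ(z) - φᵢ(ζ) + σ. The weight, measured
in travel time, is thus an exponential in σ that ends at its value in (z, ζ), and one integration
gains 1/μ. -/
theorem abs_parallelIntegral_sub_le (i : Fin 2) {g : ℝ → ℝ} (hg : Continuous g) {G B μ : ℝ}
    (hG : ∀ z, |g z| ≤ G) (hB : 0 ≤ B) (hμ : 0 < μ) {b b' : ℝ × ℝ → ℝ} (hb : Continuous b)
    (hb' : Continuous b')
    (hbb : ∀ z ζ, 0 ≤ ζ → ζ ≤ z → z ≤ 1 → |b (z, ζ) - b' (z, ζ)| ≤ B * Real.exp (μ * S.phi i z))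
    {z ζ : ℝ} (h0 : 0 ≤ ζ) (h1 : ζ ≤ z) (h2 : z ≤ 1) :
    |S.parallelIntegral i g b (z, ζ) - S.parallelIntegral i g b' (z, ζ)|
      ≤ G * B / μ * Real.exp (μ * S.phi i z) := by
  have hG0 : 0 ≤ G := (abs_nonneg _).trans (hG 0)
  have c2 := (S.phi i).symm.continuous
  have hint : ∀ b : ℝ × ℝ → ℝ, Continuous b → IntervalIntegrable (fun σ => g ((S.phi i).symm σ) *
      b ((S.phi i).symm (S.phi i z - S.phi i ζ + σ), (S.phi i).symm σ)) volume 0 (S.phi i ζ) :=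
    fun b hb => Continuous.intervalIntegrable (by fun_prop) _ _
  rw [parallelIntegral, parallelIntegral, ← intervalIntegral.integral_sub (hint b hb) (hint b' hb')]
  have hφ := (S.phi i).monotone h1
  have key := abs_integral_le_exp (q := fun σ => g ((S.phi i).symm σ) *
      b ((S.phi i).symm (S.phi i z - S.phi i ζ + σ), (S.phi i).symm σ) - g ((S.phi i).symm σ) *
      b' ((S.phi i).symm (S.phi i z - S.phi i ζ + σ), (S.phi i).symm σ))
    (C := G * B * Real.exp (μ * (S.phi i z - S.phi i ζ))) (S.phi_nonneg i h0) hμ (by positivity)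
    (fun σ hσ => by
      rw [← mul_sub, abs_mul, mul_assoc, mul_assoc, ← Real.exp_add]
      refine mul_le_mul (hG _) ?_ (abs_nonneg _) hG0
      refine (hbb _ _ (S.phi_symm_nonneg i hσ.1) ((S.phi i).symm.monotone (by linarith))
        (((S.phi i).symm_apply_le).2 ?_)).trans (le_of_eq ?_)
      · exact (by linarith [hσ.2] : _ ≤ S.phi i z).trans ((S.phi i).monotone h2)
      · rw [(S.phi i).apply_symm_apply]; ring_nf)
  refine key.trans (le_of_eq ?_)
  rw [mul_div_right_comm, mul_assoc, ← Real.exp_add]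
  ring_nf

/-- Here the integration variable is itself the travel time of the first coordinate and grows from
the diagonal to z, so the integral gains 1/μ directly. -/
theorem abs_transversalIntegral_sub_le (i j : Fin 2) {e : ℝ ≃o ℝ}
    (he : ∀ z, e z = S.phi i z + S.phi j z) {g : ℝ → ℝ} (hg : Continuous g) {G B μ : ℝ}
    (hG : ∀ z, |g z| ≤ G) (hB : 0 ≤ B) (hμ : 0 < μ) {a a' : ℝ × ℝ → ℝ} (ha : Continuous a)
    (ha' : Continuous a')
    (haa : ∀ z ζ, 0 ≤ ζ → ζ ≤ z → z ≤ 1 → |a (z, ζ) - a' (z, ζ)| ≤ B * Real.exp (μ * S.phi i z))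
    {z ζ : ℝ} (h0 : 0 ≤ ζ) (h1 : ζ ≤ z) (h2 : z ≤ 1) :
    |S.transversalIntegral i j e g a (z, ζ) - S.transversalIntegral i j e g a' (z, ζ)|
      ≤ G * B / μ * Real.exp (μ * S.phi i z) := by
  have hG0 : 0 ≤ G := (abs_nonneg _).trans (hG 0)
  have c2 := (S.phi i).symm.continuous
  have c4 := (S.phi j).symm.continuous
  set c := S.phi i z + S.phi j ζ with hc
  set m := e.symm c with hm
  have hem : S.phi i m + S.phi j m = c := by rw [← he, hm, e.apply_symm_apply]
  have hmz : m ≤ z := by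
    rw [hm, e.symm_apply_le, he, hc]
    linarith [(S.phi j).monotone h1]
  have hint : ∀ a : ℝ × ℝ → ℝ, Continuous a → IntervalIntegrable (fun τ =>
      g ((S.phi j).symm (c - τ)) * a ((S.phi i).symm τ, (S.phi j).symm (c - τ)))
      volume (S.phi i m) (S.phi i z) :=
    fun a ha => Continuous.intervalIntegrable (by fun_prop) _ _
  rw [transversalIntegral, transversalIntegral]
  simp only [← hc, ← hm]
  rw [← intervalIntegral.integral_sub (hint a ha) (hint a' ha')]
  refine abs_integral_le_exp ((S.phi i).monotone hmz) hμ (by positivity) fun τ hτ => ?_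
  rw [← mul_sub, abs_mul, mul_assoc]
  refine mul_le_mul (hG _) ?_ (abs_nonneg _) hG0
  refine (haa _ _ (S.phi_symm_nonneg j ?_) ?_ (((S.phi i).symm_apply_le).2
    (hτ.2.trans ((S.phi i).monotone h2)))).trans (le_of_eq ?_)
  · linarith [hτ.2, S.phi_nonneg j h0]
  · have h3 : (S.phi j).symm (c - τ) ≤ m := ((S.phi j).symm_apply_le).2 (by linarith [hτ.1])
    exact h3.trans (((S.phi i).le_symm_apply).2 hτ.1)
  · rw [(S.phi i).apply_symm_apply]

/-- A row of the kernel equations: the diagonal entry `a` is prescribed at `ζ = 0`, the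
off-diagonal entry `b` on the diagonal. -/
theorem exists_row (S : PDEODESystem n) (i j : Fin 2) (κ : ℝ) {ga gb d : ℝ → ℝ}
    (hga : Continuous ga) (hgb : Continuous gb) (hd : Continuous d) {G : ℝ}
    (hGa : ∀ z, |ga z| ≤ G) (hGb : ∀ z, |gb z| ≤ G) (hGd : ∀ z, |d z| ≤ G) :
    ∃ a b : ℝ × ℝ → ℝ, Continuous a ∧ Continuous b ∧
      (∀ z ∈ Icc (0 : ℝ) 1, a (z, 0) = κ * b (z, 0)) ∧ (∀ z ∈ Icc (0 : ℝ) 1, b (z, z) = d z) ∧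
      (∀ (α β θ : ℝ) (p r : ℝ → ℝ), (∀ s ∈ Icc α β, (0 ≤ r s ∧ r s ≤ p s ∧ p s ≤ 1) ∧
          HasDerivWithinAt p (θ * S.speed i (p s)) (Icc α β) s ∧
          HasDerivWithinAt r (θ * S.speed i (r s)) (Icc α β) s) →
        ∀ s ∈ Icc α β, HasDerivWithinAt (fun s => a (p s, r s)) (θ * (ga (r s) * b (p s, r s)))
          (Icc α β) s) ∧
      ∀ (α β θ : ℝ) (p r : ℝ → ℝ), (∀ s ∈ Icc α β, (0 ≤ r s ∧ r s ≤ p s ∧ p s ≤ 1) ∧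
          HasDerivWithinAt p (θ * S.speed i (p s)) (Icc α β) s ∧
          HasDerivWithinAt r (-θ * S.speed j (r s)) (Icc α β) s) →
        ∀ s ∈ Icc α β, HasDerivWithinAt (fun s => b (p s, r s)) (θ * (gb (r s) * a (p s, r s)))
          (Icc α β) s := by
  obtain ⟨e, he⟩ := S.exists_sum_phi i j
  have hG0 : 0 ≤ G := (abs_nonneg _).trans (hGa 0)
  have c1 := (S.phi i).continuous
  have c2 := (S.phi i).symm.continuous
  have c3 := (S.phi j).continuous
  have c4 := (S.phi j).symm.continuous
  have c5 := e.symm.continuous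
  have c6 := continuous_triangleClamp
  -- The equation for a contains κ times a transversal integral plus a parallel one, each of
  -- relative size G/μ.
  set μ : ℝ := 2 * ((|κ| + 1) * G) + 1 with hμd
  have hμ : 0 < μ := by positivity
  have hfrac : (|κ| + 1) * G / μ ≤ 1 / 2 := by
    rw [div_le_div_iff₀ hμ two_pos]; linarith
  -- The position on ζ = 0 at which the characteristic through p parallel to the diagonal starts.
  set foot : ℝ × ℝ → ℝ := fun p => (S.phi i).symm (S.phi i p.1 - S.phi i p.2) with hfoot
  have cfoot : Continuous foot := by simp only [hfoot]; fun_prop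
  have hfoot0 : ∀ z ζ, ζ ≤ z → 0 ≤ foot (z, ζ) := fun z ζ h =>
    S.phi_symm_nonneg i (sub_nonneg.2 ((S.phi i).monotone h))
  have hfootz : ∀ z ζ, 0 ≤ ζ → foot (z, ζ) ≤ z := fun z ζ h =>
    ((S.phi i).symm_apply_le).2 (by simpa using S.phi_nonneg i h)
  set Vt : (ℝ × ℝ → ℝ × ℝ) → ℝ × ℝ → ℝ := fun f => S.transversalIntegral i j e gb fun p => (f p).1
    with hVt
  set Vp : (ℝ × ℝ → ℝ × ℝ) → ℝ × ℝ → ℝ := fun f => S.parallelIntegral i ga fun p => (f p).2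
    with hVp
  have cVt : ∀ f, Continuous f → Continuous (Vt f) := fun f hf =>
    continuous_transversalIntegral i j e hgb hf.fst
  have cVp : ∀ f, Continuous f → Continuous (Vp f) := fun f hf =>
    continuous_parallelIntegral i hga hf.snd
  set d' : ℝ × ℝ → ℝ := fun p => d (e.symm (S.phi i p.1 + S.phi j p.2)) with hd'
  have cd' : Continuous d' := by simp only [hd']; fun_prop
  -- The boundary value κb at the foot is replaced by the integral equation for b. A bare κb would
  -- gain no factor 1/μ, and the map would not contract for large κ.
  set V : (ℝ × ℝ → ℝ × ℝ) → ℝ × ℝ → ℝ × ℝ := fun f p =>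
    (κ * Vt f (foot (triangleClamp p), 0) + Vp f (triangleClamp p), Vt f (triangleClamp p)) with hV
  have cV : ∀ f, Continuous f → Continuous (V f) := fun f hf => by
    have := cVt f hf
    have := cVp f hf
    simp only [hV]; fun_prop
  set g : ℝ × ℝ → ℝ × ℝ := fun p => (κ * d' (foot (triangleClamp p), 0), d' (triangleClamp p)) with hg
  have cg : Continuous g := by simp only [hg]; fun_prop
  set w : ℝ × ℝ → ℝ := fun p => Real.exp (μ * S.phi i (triangleClamp p).1) with hw
  have hw0 : ∀ p, 0 ≤ w p := fun p => (Real.exp_pos _).le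
  have hw1 : ∀ p, 1 ≤ w p := fun p => Real.one_le_exp
    (mul_nonneg hμ.le (S.phi_nonneg i ((triangleClamp_mem p).1.trans (triangleClamp_mem p).2.1)))
  have hstep : ∀ f h, Continuous f → Continuous h → ∀ B, 0 ≤ B → (∀ p, ‖f p - h p‖ ≤ B * w p) →
      ∀ p, ‖V f p - V h p‖ ≤ B / 2 * w p := by
    intro f h hf hh B hB hfh p
    have hq := triangleClamp_mem p
    set q := triangleClamp p with hqdef
    have hpt : ∀ z ζ, 0 ≤ ζ → ζ ≤ z → z ≤ 1 →
        ‖f (z, ζ) - h (z, ζ)‖ ≤ B * Real.exp (μ * S.phi i z) := by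
      intro z ζ h0 h1 h2
      have := hfh (z, ζ)
      simp only [hw] at this
      rwa [triangleClamp_of_mem (p := (z, ζ)) h0 h1 h2] at this
    have hVtb : ∀ z ζ, 0 ≤ ζ → ζ ≤ z → z ≤ 1 →
        |Vt f (z, ζ) - Vt h (z, ζ)| ≤ G * B / μ * Real.exp (μ * S.phi i z) :=
      fun z ζ h0 h1 h2 => abs_transversalIntegral_sub_le i j he hgb hGb hB hμ hf.fst hh.fst
        (fun z ζ h0 h1 h2 => (norm_fst_le (f (z, ζ) - h (z, ζ))).trans (hpt z ζ h0 h1 h2)) h0 h1 h2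
    have hVpb : |Vp f q - Vp h q| ≤ G * B / μ * Real.exp (μ * S.phi i q.1) :=
      abs_parallelIntegral_sub_le i hga hGa hB hμ hf.snd hh.snd
        (fun z ζ h0 h1 h2 => (norm_snd_le (f (z, ζ) - h (z, ζ))).trans (hpt z ζ h0 h1 h2))
        hq.1 hq.2.1 hq.2.2
    have hfz : foot q ≤ q.1 := hfootz q.1 q.2 hq.1
    have h3 := hVtb q.1 q.2 hq.1 hq.2.1 hq.2.2
    have h4 : |Vt f (foot q, 0) - Vt h (foot q, 0)| ≤ G * B / μ * Real.exp (μ * S.phi i q.1) := by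
      refine (hVtb (foot q) 0 le_rfl (hfoot0 q.1 q.2 hq.2.1) (hfz.trans hq.2.2)).trans ?_
      refine mul_le_mul_of_nonneg_left (Real.exp_le_exp.2 ?_) (by positivity)
      exact mul_le_mul_of_nonneg_left ((S.phi i).monotone hfz) hμ.le
    have hX : 0 ≤ G * B / μ * Real.exp (μ * S.phi i q.1) := by positivity
    have hfin : (|κ| + 1) * (G * B / μ * Real.exp (μ * S.phi i q.1)) ≤ B / 2 * w p := by
      calc (|κ| + 1) * (G * B / μ * Real.exp (μ * S.phi i q.1))
          = (|κ| + 1) * G / μ * (B * Real.exp (μ * S.phi i q.1)) := by ring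
        _ ≤ 1 / 2 * (B * Real.exp (μ * S.phi i q.1)) :=
          mul_le_mul_of_nonneg_right hfrac (by positivity)
        _ = B / 2 * w p := by simp only [hw, ← hqdef]; ring
    rw [Prod.norm_def]
    refine max_le ?_ ?_
    · have e1 : (V f p - V h p).1 = κ * (Vt f (foot q, 0) - Vt h (foot q, 0)) + (Vp f q - Vp h q) := by
        simp only [hV, Prod.fst_sub, ← hqdef]; ring
      rw [e1, Real.norm_eq_abs]
      refine (abs_add_le _ _).trans (le_trans ?_ hfin)
      rw [abs_mul, add_mul, one_mul]
      exact add_le_add (mul_le_mul_of_nonneg_left h4 (abs_nonneg _)) hVpb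
    · have e2 : (V f p - V h p).2 = Vt f (q.1, q.2) - Vt h (q.1, q.2) := by
        simp only [hV, Prod.snd_sub, ← hqdef]
      rw [e2, Real.norm_eq_abs]
      refine h3.trans (le_trans ?_ hfin)
      exact le_mul_of_one_le_left hX (by linarith [abs_nonneg κ])
  have hV0 : ∀ p, V (fun _ => 0) p = 0 := fun p => by
    simp [hV, hVt, hVp, transversalIntegral, parallelIntegral]
  have hgb' : ∀ p, ‖g p‖ ≤ (|κ| + 1) * G := by
    intro p
    rw [Prod.norm_def]
    refine max_le ?_ ?_
    · simp only [hg, Real.norm_eq_abs, abs_mul]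
      have := mul_le_mul_of_nonneg_left (hGd (e.symm (S.phi i (foot (triangleClamp p)) + S.phi j 0)))
        (abs_nonneg κ)
      simp only [hd']
      linarith
    · simp only [hg, hd', Real.norm_eq_abs]
      refine (hGd _).trans (le_mul_of_one_le_left hG0 (by linarith [abs_nonneg κ]))
  obtain ⟨f, hfc, hf⟩ := exists_fixedPoint_of_weighted_contraction (P := Continuous) (V := V) (g := g)
    (w := w) (M := (|κ| + 1) * G / 2) hw0 cg (fun f hf => cg.add (cV f hf))
    (fun p => by
      have := hstep g (fun _ => 0) cg continuous_const ((|κ| + 1) * G) (by positivity) (fun p => by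
        rw [sub_zero]
        exact (hgb' p).trans (le_mul_of_one_le_right (by positivity) (hw1 p))) p
      rwa [hV0, sub_zero] at this)
    hstep
    (fun F f B hF hFf => by
      have hwM : ∀ p, w p ≤ Real.exp (μ * S.phi i 1) := fun p =>
        Real.exp_le_exp.2 (mul_le_mul_of_nonneg_left
          ((S.phi i).monotone (triangleClamp_mem p).2.2) hμ.le)
      have ht : TendstoUniformly F f Filter.atTop := by
        rw [Metric.tendstoUniformly_iff]
        intro ε hε
        have hlim : Filter.Tendsto (fun n : ℕ => |B| * (1 / 2 : ℝ) ^ n * Real.exp (μ * S.phi i 1))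
            Filter.atTop (nhds 0) := by
          simpa using ((tendsto_pow_atTop_nhds_zero_of_lt_one (r := (1 / 2 : ℝ)) (by norm_num)
            (by norm_num)).const_mul |B|).mul_const (Real.exp (μ * S.phi i 1))
        filter_upwards [hlim.eventually_lt_const hε] with n hn p
        rw [dist_comm, dist_eq_norm]
        refine ((hFf n p).trans ?_).trans_lt hn
        have h1 : B * (1 / 2) ^ n ≤ |B| * (1 / 2) ^ n :=
          mul_le_mul_of_nonneg_right (le_abs_self B) (by positivity)
        exact mul_le_mul h1 (hwM p) (hw0 p) (by positivity)
      exact ht.continuous (Filter.Eventually.of_forall hF).frequently)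
  have htri : ∀ z ζ, 0 ≤ ζ → ζ ≤ z → z ≤ 1 → f (z, ζ)
      = (κ * (d' (foot (z, ζ), 0) + Vt f (foot (z, ζ), 0)) + Vp f (z, ζ),
        d' (z, ζ) + Vt f (z, ζ)) := by
    intro z ζ h0 h1 h2
    rw [hf (z, ζ)]
    simp only [hg, hV, triangleClamp_of_mem (p := (z, ζ)) h0 h1 h2, Prod.mk_add_mk]
    rw [mul_add, add_assoc]
  have hb : ∀ z ζ, 0 ≤ ζ → ζ ≤ z → z ≤ 1 → (f (z, ζ)).2 = d' (z, ζ) + Vt f (z, ζ) :=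
    fun z ζ h0 h1 h2 => by rw [htri z ζ h0 h1 h2]
  have ha : ∀ z ζ, 0 ≤ ζ → ζ ≤ z → z ≤ 1 →
      (f (z, ζ)).1 = κ * (f (foot (z, ζ), 0)).2 + Vp f (z, ζ) :=
    fun z ζ h0 h1 h2 => by
      rw [hb _ 0 le_rfl (hfoot0 z ζ h1) ((hfootz z ζ h0).trans h2), htri z ζ h0 h1 h2]
  refine ⟨fun p => (f p).1, fun p => (f p).2, hfc.fst, hfc.snd, ?_, ?_, ?_, ?_⟩
  · intro z hz
    simp only
    rw [ha z 0 le_rfl hz.1 hz.2]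
    simp [hfoot, hVp, parallelIntegral, S.phi_zero]
  · intro z hz
    simp only
    rw [hb z z hz.1 le_rfl hz.2]
    simp [hd', hVt, transversalIntegral, ← he]
  · intro α β θ p r hpr s hs
    have hp := S.phi_eq_of_hasDerivWithinAt fun s hs => (hpr s hs).2.1
    have hr := S.phi_eq_of_hasDerivWithinAt fun s hs => (hpr s hs).2.2
    -- This difference is conserved along the pair, so foot and integrand are fixed and only the
    -- upper limit moves. The derivative is then that of an integral with a moving limit.
    set k := S.phi i (p α) - S.phi i (r α) with hk
    have hkc : ∀ s ∈ Icc α β, S.phi i (p s) - S.phi i (r s) = k := fun s hs => by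
      rw [hp s hs, hr s hs]; ring
    set H : ℝ → ℝ := fun σ => ga ((S.phi i).symm σ) *
      (f ((S.phi i).symm (k + σ), (S.phi i).symm σ)).2 with hH
    have cH : Continuous H := by simp only [hH]; fun_prop
    have hval : ∀ s ∈ Icc α β, (f (p s, r s)).1
        = κ * (f ((S.phi i).symm k, 0)).2 + ∫ σ in (0 : ℝ)..S.phi i (r α) + θ * (s - α), H σ := by
      intro s hs
      rw [ha _ _ (hpr s hs).1.1 (hpr s hs).1.2.1 (hpr s hs).1.2.2]
      simp only [hfoot, hVp, parallelIntegral, hkc s hs, hH]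
      rw [hr s hs]
    have hu : HasDerivWithinAt (fun s => S.phi i (r α) + θ * (s - α)) θ (Icc α β) s := by
      simpa using ((((hasDerivAt_id s).sub_const α).const_mul θ).const_add
        (S.phi i (r α))).hasDerivWithinAt (s := Icc α β)
    have hder := (hasDerivWithinAt_integral_comp (k := 0) cH hu).const_add
      (κ * (f ((S.phi i).symm k, 0)).2)
    refine (hder.congr hval (hval s hs)).congr_deriv ?_
    rw [← hr s hs]
    simp only [hH, (S.phi i).symm_apply_apply, ← hkc s hs, sub_add_cancel]
    ring
  · intro α β θ p r hpr s hs
    have hp := S.phi_eq_of_hasDerivWithinAt fun s hs => (hpr s hs).2.1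
    have hr := S.phi_eq_of_hasDerivWithinAt fun s hs => (hpr s hs).2.2
    -- This sum is conserved along the pair, so the starting point on the diagonal is fixed and
    -- again only the upper limit moves.
    set c := S.phi i (p α) + S.phi j (r α) with hc
    have hcc : ∀ s ∈ Icc α β, S.phi i (p s) + S.phi j (r s) = c := fun s hs => by
      rw [hp s hs, hr s hs]; ring
    set H : ℝ → ℝ := fun τ => gb ((S.phi j).symm (c - τ)) *
      (f ((S.phi i).symm τ, (S.phi j).symm (c - τ))).1 with hH
    have cH : Continuous H := by simp only [hH]; fun_prop
    have hval : ∀ s ∈ Icc α β, (f (p s, r s)).2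
        = d (e.symm c) + ∫ σ in S.phi i (e.symm c)..S.phi i (p α) + θ * (s - α), H σ := by
      intro s hs
      rw [hb _ _ (hpr s hs).1.1 (hpr s hs).1.2.1 (hpr s hs).1.2.2]
      simp only [hd', hVt, transversalIntegral, hcc s hs, hH]
      rw [hp s hs]
    have hu : HasDerivWithinAt (fun s => S.phi i (p α) + θ * (s - α)) θ (Icc α β) s := by
      simpa using ((((hasDerivAt_id s).sub_const α).const_mul θ).const_add
        (S.phi i (p α))).hasDerivWithinAt (s := Icc α β)
    have hder := (hasDerivWithinAt_integral_comp (k := S.phi i (e.symm c)) cH hu).const_add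
      (d (e.symm c))
    refine (hder.congr hval (hval s hs)).congr_deriv ?_
    rw [← hp s hs]
    simp only [hH, (S.phi i).symm_apply_apply, ← hcc s hs, add_sub_cancel_left,
      (S.phi j).symm_apply_apply]
    ring

end PDEODESystem

theorem unitClamp_unitClamp (z : ℝ) : unitClamp (unitClamp z) = unitClamp z :=
  unitClamp_of_mem (unitClamp_mem z)

namespace PDEODESystem

variable {n : ℕ}

/-- The kernel equations of the row `i` of the kernel, in terms of the absolute values
`a = |Λᵢᵢ| Kᵢᵢ` and `b = |Λⱼⱼ| Kᵢⱼ`. -/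
theorem exists_kernel_row (S : PDEODESystem n) (i j : Fin 2) (κ : ℝ) :
    ∃ a b : ℝ × ℝ → ℝ, Continuous a ∧ Continuous b ∧
      (∀ z ∈ Icc (0 : ℝ) 1, a (z, 0) = κ * b (z, 0)) ∧
      (∀ z ∈ Icc (0 : ℝ) 1, b (z, z)
        = -(travelSign i * S.speed j z * S.scaledCoupling i j z / (S.speed i z + S.speed j z))) ∧
      (∀ (α β θ : ℝ) (p r : ℝ → ℝ), (∀ s ∈ Icc α β, (0 ≤ r s ∧ r s ≤ p s ∧ p s ≤ 1) ∧
          HasDerivWithinAt p (θ * S.speed i (p s)) (Icc α β) s ∧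
          HasDerivWithinAt r (θ * S.speed i (r s)) (Icc α β) s) →
        ∀ s ∈ Icc α β, HasDerivWithinAt (fun s => a (p s, r s))
          (θ * (travelSign i * S.speed i (r s) / S.speed j (r s) * S.scaledCoupling j i (r s)
            * b (p s, r s))) (Icc α β) s) ∧
      ∀ (α β θ : ℝ) (p r : ℝ → ℝ), (∀ s ∈ Icc α β, (0 ≤ r s ∧ r s ≤ p s ∧ p s ≤ 1) ∧
          HasDerivWithinAt p (θ * S.speed i (p s)) (Icc α β) s ∧
          HasDerivWithinAt r (-θ * S.speed j (r s)) (Icc α β) s) →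
        ∀ s ∈ Icc α β, HasDerivWithinAt (fun s => b (p s, r s))
          (θ * (travelSign i * S.speed j (r s) / S.speed i (r s) * S.scaledCoupling i j (r s)
            * a (p s, r s))) (Icc α β) s := by
  have hc := S.continuous_speed
  have hA := S.continuous_scaledCoupling
  have hga : Continuous fun z => travelSign i * S.speed i z / S.speed j z * S.scaledCoupling j i z :=
    ((continuous_const.mul (hc i)).div (hc j) fun z => (S.speed_pos j z).ne').mul (hA j i)
  have hgb : Continuous fun z => travelSign i * S.speed j z / S.speed i z * S.scaledCoupling i j z :=
    ((continuous_const.mul (hc j)).div (hc i) fun z => (S.speed_pos i z).ne').mul (hA i j)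
  have hd : Continuous fun z =>
      -(travelSign i * S.speed j z * S.scaledCoupling i j z / (S.speed i z + S.speed j z)) :=
    (((continuous_const.mul (hc j)).mul (hA i j)).div ((hc i).add (hc j))
      fun z => (add_pos (S.speed_pos i z) (S.speed_pos j z)).ne').neg
  obtain ⟨M₁, h₁⟩ := hga.continuousOn.exists_abs_comp_unitClamp_le
  obtain ⟨M₂, h₂⟩ := hgb.continuousOn.exists_abs_comp_unitClamp_le
  obtain ⟨M₃, h₃⟩ := hd.continuousOn.exists_abs_comp_unitClamp_le
  simp only [speed, scaledCoupling, unitClamp_unitClamp] at h₁ h₂ h₃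
  exact S.exists_row i j κ hga hgb hd (G := max M₁ (max M₂ M₃))
    (fun z => (h₁ z).trans (le_max_left _ _))
    (fun z => (h₂ z).trans ((le_max_left _ _).trans (le_max_right _ _)))
    (fun z => (h₃ z).trans ((le_max_right _ _).trans (le_max_right _ _)))

/-- Because Ã has zero diagonal, the equation for each entry of K contains only the other entry of
the same row, and the conditions at ζ = 0 also relate entries of one row. In the variables λK these
conditions have the factors q₀ and 1/q₀. -/
theorem exists_isKernel (S : PDEODESystem n) (hq0 : S.q0 ≠ 0) :
    ∃ K : ℝ → ℝ → Matrix (Fin 2) (Fin 2) ℝ, S.IsKernel K := by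
  obtain ⟨a₀, b₀, ha₀, hb₀, hab₀, hd₀, hp₀, ht₀⟩ := S.exists_kernel_row 0 1 S.q0
  obtain ⟨a₁, b₁, ha₁, hb₁, hab₁, hd₁, hp₁, ht₁⟩ := S.exists_kernel_row 1 0 S.q0⁻¹
  have h0 : (0 : ℝ) ∈ Icc (0 : ℝ) 1 := ⟨le_rfl, zero_le_one⟩
  have hl := fun i => (S.lam_pos i 0 h0).ne'
  have hs := fun i z => (S.speed_pos i z).ne'
  refine ⟨fun z ζ => !![a₀ (z, ζ) / S.speed 0 ζ, b₀ (z, ζ) / S.speed 1 ζ;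
    b₁ (z, ζ) / S.speed 0 ζ, a₁ (z, ζ) / S.speed 1 ζ], ?_, ?_, ?_, ?_, ?_, ?_⟩
  · have hc := fun i => (S.continuous_speed i).comp (continuous_snd (X := ℝ))
    intro i j
    fin_cases i <;> fin_cases j
    · exact (ha₀.div (hc 0) fun p => hs 0 p.2).continuousOn
    · exact (hb₀.div (hc 1) fun p => hs 1 p.2).continuousOn
    · exact (hb₁.div (hc 0) fun p => hs 0 p.2).continuousOn
    · exact (ha₁.div (hc 1) fun p => hs 1 p.2).continuousOn
  · intro i j α β p r hαβ hpr s hs'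
    have hr : ∀ s ∈ Icc α β, r s ∈ Icc (0 : ℝ) 1 := fun s hs =>
      ⟨(hpr s hs).1.1, (hpr s hs).1.2.1.trans (hpr s hs).1.2.2⟩
    have hp : ∀ s ∈ Icc α β, p s ∈ Icc (0 : ℝ) 1 := fun s hs =>
      ⟨(hpr s hs).1.1.trans (hpr s hs).1.2.1, (hpr s hs).1.2.2⟩
    have hcurve : ∀ s ∈ Icc α β, (0 ≤ r s ∧ r s ≤ p s ∧ p s ≤ 1) ∧
        HasDerivWithinAt p (travelSign i * S.speed i (p s)) (Icc α β) s ∧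
        HasDerivWithinAt r (travelSign j * S.speed j (r s)) (Icc α β) s := fun s hs => by
      rw [← S.Lam_diag i (hp s hs), ← S.Lam_diag j (hr s hs)]
      exact hpr s hs
    have hA : ∀ k l, S.Atilde (r s) k l = S.scaledCoupling k l (r s) := fun k l => by
      rw [scaledCoupling, unitClamp_of_mem (hr s hs')]
    have hA0 : ∀ k, S.scaledCoupling k k (r s) = 0 := fun k => by
      rw [← hA]; fin_cases k <;> simp [Atilde]
    have hs0 := hs 0 (r s)
    have hs1 := hs 1 (r s)
    -- The direction θ is the sign of Λᵢᵢ, hence 1 in the first row and -1 in the second. Entries of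
    -- the second column change sign because Λ₂₂ = -λ₂.
    fin_cases i <;> fin_cases j
    · refine ((hp₀ α β 1 p r (by simpa [travelSign] using hcurve) s hs').congr
        (fun σ hσ => ?_) ?_).congr_deriv ?_
      · simp [S.Lam_diag 0 (hr σ hσ), travelSign, div_mul_cancel₀ _ (hs 0 (r σ))]
      · simp [S.Lam_diag 0 (hr s hs'), travelSign, hs]
      · simp only [Fin.zero_eta, S.Lam_diag 0 (hr s hs'), travelSign, Matrix.mul_apply,
          Fin.sum_univ_two, hA, hA0]
        simp
        field_simp
    · refine (((ht₀ α β 1 p r (by simpa [travelSign] using hcurve) s hs').neg).congr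
        (fun σ hσ => ?_) ?_).congr_deriv ?_
      · simp [S.Lam_diag 1 (hr σ hσ), travelSign, div_mul_cancel₀ _ (hs 1 (r σ))]
      · simp [S.Lam_diag 1 (hr s hs'), travelSign, hs]
      · simp only [Fin.zero_eta, Fin.mk_one, S.Lam_diag 1 (hr s hs'), travelSign, Matrix.mul_apply,
          Fin.sum_univ_two, hA, hA0]
        simp
        field_simp
    · refine ((ht₁ α β (-1) p r (by simpa [travelSign] using hcurve) s hs').congr
        (fun σ hσ => ?_) ?_).congr_deriv ?_
      · simp [S.Lam_diag 0 (hr σ hσ), travelSign, div_mul_cancel₀ _ (hs 0 (r σ))]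
      · simp [S.Lam_diag 0 (hr s hs'), travelSign, hs]
      · simp only [Fin.zero_eta, Fin.mk_one, S.Lam_diag 0 (hr s hs'), travelSign, Matrix.mul_apply,
          Fin.sum_univ_two, hA, hA0]
        simp
        field_simp
    · refine (((hp₁ α β (-1) p r (by simpa [travelSign] using hcurve) s hs').neg).congr
        (fun σ hσ => ?_) ?_).congr_deriv ?_
      · simp [S.Lam_diag 1 (hr σ hσ), travelSign, div_mul_cancel₀ _ (hs 1 (r σ))]
      · simp [S.Lam_diag 1 (hr s hs'), travelSign, hs]
      · simp only [Fin.mk_one, S.Lam_diag 1 (hr s hs'), travelSign, Matrix.mul_apply,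
          Fin.sum_univ_two, hA, hA0]
        simp
        field_simp
  · intro z hz
    have := hl 0
    have := hl 1
    simp [hab₀ z hz, S.speed_of_mem _ h0]
    field_simp
  · intro z hz
    have h1 := S.lam_pos 0 z hz
    have h2 := S.lam_pos 1 z hz
    simp [hd₀ z hz, S.speed_of_mem _ hz, travelSign, scaledCoupling, unitClamp_of_mem hz]
    field_simp
  · intro z hz
    have h1 := S.lam_pos 0 z hz
    have h2 := S.lam_pos 1 z hz
    simp [hd₁ z hz, S.speed_of_mem _ hz, travelSign, scaledCoupling, unitClamp_of_mem hz]
    field_simp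
    ring
  · intro z hz
    have := hl 0
    have := hl 1
    simp [hab₁ z hz, S.speed_of_mem _ h0]
    field_simp

end PDEODESystem

/-! ### Bijectivity, bounds and the passage from (2) to (1). -/

namespace PDEODESystem

variable {n : ℕ} {S : PDEODESystem n} {K : ℝ → ℝ → Matrix (Fin 2) (Fin 2) ℝ}

/-- The inverse of the scaling, extended to the plane. -/
noncomputable def unscaledTrajectory (S : PDEODESystem n) (y : ℝ → ℝ → Fin 2 → ℝ) (z t : ℝ)
    (i : Fin 2) : ℝ :=
  (S.scaling i (unitClamp z))⁻¹ * y z t i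

theorem scaling_mul_unscaledTrajectory (y : ℝ → ℝ → Fin 2 → ℝ) {z : ℝ} (hz : z ∈ Icc (0 : ℝ) 1)
    (t : ℝ) (i : Fin 2) : S.scaling i z * S.unscaledTrajectory y z t i = y z t i := by
  rw [unscaledTrajectory, unitClamp_of_mem hz, mul_inv_cancel_left₀ (S.scaling_pos i z).ne']

theorem isStateTrajectory_unscaledTrajectory {y : ℝ → ℝ → Fin 2 → ℝ}
    (hy : IsExtendedTrajectory y) : IsStateTrajectory (S.unscaledTrajectory y) :=
  (IsExtendedTrajectory.coef_mul (fun i => (S.continuous_scaling i).inv₀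
    fun z => (S.scaling_pos i z).ne') hy).isStateTrajectory fun _ _ _ _ => rfl

theorem IsKernel.transform_eq_sub_volterra (hK : S.IsKernel K) {x : ℝ → ℝ → Fin 2 → ℝ}
    (hx : IsStateTrajectory x) {t : ℝ} (ht : 0 ≤ t) {z : ℝ} (hz : z ∈ Icc (0 : ℝ) 1) (i : Fin 2) :
    S.transform K (fun ζ => x ζ t) z i
      = S.scaledTrajectory x z t i - volterra K (S.scaledTrajectory x) z t i :=
  hK.transform_apply (isExtendedTrajectory_scaledTrajectory hx)
    (fun _ hz i => (scaledTrajectory_of_mem x hz ht i).symm) hz i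

theorem exists_scaling_le (S : PDEODESystem n) : ∃ D : ℝ, 0 < D ∧ ∀ i, ∀ z ∈ Icc (0 : ℝ) 1,
    S.scaling i z ≤ D ∧ (S.scaling i z)⁻¹ ≤ D := by
  choose M hM using fun i => (S.continuous_scaling i).continuousOn.exists_abs_comp_unitClamp_le
  choose N hN using fun i => ((S.continuous_scaling i).inv₀
    fun z => (S.scaling_pos i z).ne').continuousOn.exists_abs_comp_unitClamp_le
  refine ⟨max (max (M 0) (M 1)) (max (N 0) (N 1)), ?_, fun i z hz => ?_⟩
  · exact ((abs_pos.2 (S.scaling_pos 0 _).ne').trans_le (hM 0 0)).trans_le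
      ((le_max_left _ _).trans (le_max_left _ _))
  · have h1 := (le_abs_self _).trans (hM i z)
    have h2 := (le_abs_self _).trans (hN i z)
    rw [unitClamp_of_mem hz] at h1 h2
    fin_cases i
    · exact ⟨h1.trans ((le_max_left _ _).trans (le_max_left _ _)),
        h2.trans ((le_max_left _ _).trans (le_max_right _ _))⟩
    · exact ⟨h1.trans ((le_max_right _ _).trans (le_max_left _ _)),
        h2.trans ((le_max_right _ _).trans (le_max_right _ _))⟩

theorem IsKernel.isState_transform (hK : S.IsKernel K) {w : ℝ → Fin 2 → ℝ} (hw : IsState w) :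
    IsState (S.transform K w) := by
  have hx := hw.isStateTrajectory
  have hy := isExtendedTrajectory_scaledTrajectory (S := S) hx
  refine (((hy.sub (hK.isExtendedTrajectory_volterra hy)).isStateTrajectory
    fun _ _ _ _ => rfl).isState le_rfl).congr fun z hz => funext fun i => ?_
  rw [hK.transform_eq_sub_volterra hx le_rfl hz]
  simp only [unitClamp_of_mem hz]

theorem IsKernel.exists_norm_transform_le (hK : S.IsKernel K) : ∃ C : ℝ, 0 < C ∧ ∀ w, IsState w →
    ∀ M : ℝ, (∀ z ∈ Icc (0 : ℝ) 1, ‖w z‖ ≤ M) →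
      ∀ z ∈ Icc (0 : ℝ) 1, ‖S.transform K w z‖ ≤ C * M := by
  obtain ⟨N, hN0, hN⟩ := hK.exists_kernelExt_le
  obtain ⟨D, hD0, hD⟩ := S.exists_scaling_le
  refine ⟨D + 2 * N * D * Real.exp 1, by positivity, fun w hw M hM z hz => ?_⟩
  have hM0 : 0 ≤ M := (norm_nonneg _).trans (hM z hz)
  have hx := hw.isStateTrajectory
  have hy : ∀ ζ ∈ Icc (0 : ℝ) 1, ‖S.scaledTrajectory (fun z _ => w z) ζ 0‖ ≤ D * M := fun ζ hζ => by
    rw [pi_norm_le_iff_of_nonneg (by positivity)]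
    intro i
    rw [scaledTrajectory_of_mem _ hζ le_rfl, norm_mul,
      Real.norm_of_nonneg (S.scaling_pos i ζ).le]
    exact mul_le_mul (hD i ζ hζ).1 ((norm_le_pi_norm (w ζ) i).trans (hM ζ hζ)) (norm_nonneg _) hD0.le
  rw [pi_norm_le_iff_of_nonneg (by positivity)]
  intro i
  have h1 := abs_volterra_le hN0 hN (mul_nonneg hD0.le hM0) one_pos
    (e := S.scaledTrajectory fun z _ => w z) (t := 0) hz.1 (fun ζ hζ =>
      (hy ζ ⟨hζ.1, hζ.2.trans hz.2⟩).trans (le_mul_of_one_le_right (mul_nonneg hD0.le hM0)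
        (Real.one_le_exp (by simpa using hζ.1)))) i
  have h2 : Real.exp (1 * z) ≤ Real.exp 1 := Real.exp_le_exp.2 (by simpa using hz.2)
  have h3 : 2 * N * (D * M) / 1 * Real.exp (1 * z) ≤ 2 * N * (D * M) * Real.exp 1 := by
    rw [div_one]
    exact mul_le_mul_of_nonneg_left h2 (by positivity)
  have h4 := (norm_le_pi_norm (S.scaledTrajectory (fun z _ => w z) z 0) i).trans (hy z hz)
  rw [hK.transform_eq_sub_volterra hx le_rfl hz]
  refine (norm_sub_le _ _).trans ?_
  rw [Real.norm_eq_abs (volterra _ _ _ _ _)]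
  linarith

theorem IsKernel.exists_norm_le_transform (hK : S.IsKernel K) : ∃ C : ℝ, 0 < C ∧
    ∀ x, IsStateTrajectory x → ∀ t, 0 ≤ t → ∀ M : ℝ,
      (∀ z ∈ Icc (0 : ℝ) 1, ‖S.transform K (fun ζ => x ζ t) z‖ ≤ M) →
      ∀ z ∈ Icc (0 : ℝ) 1, ‖x z t‖ ≤ C * M := by
  obtain ⟨C, hC0, hC⟩ := hK.exists_norm_le_of_sub_volterra
  obtain ⟨D, hD0, hD⟩ := S.exists_scaling_le
  refine ⟨D * C, mul_pos hD0 hC0, fun x hx t ht M hM z hz => ?_⟩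
  have hM0 : 0 ≤ M := (norm_nonneg _).trans (hM z hz)
  have h := hC _ (isExtendedTrajectory_scaledTrajectory (S := S) hx) t M (fun z hz i => by
    rw [← hK.transform_eq_sub_volterra hx ht hz]
    exact (norm_le_pi_norm _ i).trans (hM z hz)) z hz
  rw [pi_norm_le_iff_of_nonneg (by positivity)]
  intro i
  have h1 : x z t i = (S.scaling i z)⁻¹ * S.scaledTrajectory x z t i := by
    rw [scaledTrajectory_of_mem x hz ht, inv_mul_cancel_left₀ (S.scaling_pos i z).ne']
  rw [h1, norm_mul, norm_inv, Real.norm_of_nonneg (S.scaling_pos i z).le, mul_assoc]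
  exact mul_le_mul (hD i z hz).2 ((norm_le_pi_norm _ i).trans h) (norm_nonneg _) hD0.le

/-- The transformation is injective on the states. -/
theorem IsKernel.eqOn_of_transform_eqOn (hK : S.IsKernel K) {w w' : ℝ → Fin 2 → ℝ}
    (hw : IsState w) (hw' : IsState w')
    (h : EqOn (S.transform K w') (S.transform K w) (Icc 0 1)) : EqOn w' w (Icc 0 1) := by
  obtain ⟨C, -, hC⟩ := hK.exists_norm_le_of_sub_volterra
  have hx := hw.isStateTrajectory
  have hx' := hw'.isStateTrajectory
  have hy := isExtendedTrajectory_scaledTrajectory (S := S) hx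
  have hy' := isExtendedTrajectory_scaledTrajectory (S := S) hx'
  intro z hz
  have key := hC _ (hy'.sub hy) 0 0 (fun z hz i => by
    rw [hK.volterra_sub hy' hy]
    have := congrFun (h hz) i
    rw [hK.transform_eq_sub_volterra hx le_rfl hz, hK.transform_eq_sub_volterra hx' le_rfl hz] at this
    refine (abs_eq_zero.2 ?_).le
    linarith) z hz
  rw [mul_zero, norm_le_zero_iff] at key
  funext i
  have h1 := congrFun key i
  simp only [scaledTrajectory_of_mem _ hz le_rfl, Pi.zero_apply] at h1
  exact mul_left_cancel₀ (S.scaling_pos i z).ne' (sub_eq_zero.1 h1)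

/-- Every trajectory is the transform of a trajectory. -/
theorem IsKernel.exists_transform_eq (hK : S.IsKernel K) {v : ℝ → ℝ → Fin 2 → ℝ}
    (hv : IsStateTrajectory v) : ∃ y, IsExtendedTrajectory y ∧
      (∀ z ∈ Icc (0 : ℝ) 1, ∀ t, 0 ≤ t → ∀ i, y z t i - volterra K y z t i = v z t i) ∧
      ∀ z ∈ Icc (0 : ℝ) 1, ∀ t, 0 ≤ t →
        S.transform K (fun ζ => S.unscaledTrajectory y ζ t) z = v z t := by
  obtain ⟨y, hy, hyv⟩ := hK.exists_sub_volterra_eq hv.extend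
  have hyv' : ∀ z ∈ Icc (0 : ℝ) 1, ∀ t, 0 ≤ t → ∀ i, y z t i - volterra K y z t i = v z t i :=
    fun z hz t ht i => by rw [hyv z hz t i, extendTrajectory_of_mem v hz ht]
  refine ⟨y, hy, hyv', fun z hz t ht => funext fun i => ?_⟩
  rw [hK.transform_apply hy (fun z hz i => scaling_mul_unscaledTrajectory y hz t i) hz, hyv' z hz t ht]

/-- Solutions of the transport form arise from solutions of the original system. -/
theorem IsKernel.exists_isSolution (hK : S.IsKernel K) (hq0 : S.q0 ≠ 0) {ξ₀ : Fin n → ℝ}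
    {xb₀ : ℝ → Fin 2 → ℝ} {ub : ℝ → ℝ} {ξ : ℝ → Fin n → ℝ} {xb : ℝ → ℝ → Fin 2 → ℝ}
    (h : S.IsTransportSolution K ξ₀ xb₀ ub ξ xb) :
    ∃ (x₀ : ℝ → Fin 2 → ℝ) (u : ℝ → ℝ) (x : ℝ → ℝ → Fin 2 → ℝ),
      S.IsSolution ξ₀ x₀ u ξ x ∧ S.Corresponds K x₀ u x xb₀ ub xb := by
  have h0 : (0 : ℝ) ∈ Icc (0 : ℝ) 1 := ⟨le_rfl, zero_le_one⟩
  have h1 : (1 : ℝ) ∈ Icc (0 : ℝ) 1 := ⟨zero_le_one, le_rfl⟩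
  obtain ⟨y, hy, hyv, htr⟩ := hK.exists_transform_eq (S := S) h.traj
  have hxy : ∀ z ∈ Icc (0 : ℝ) 1, ∀ t i, S.scaling i z * S.unscaledTrajectory y z t i = y z t i :=
    fun z hz t i => scaling_mul_unscaledTrajectory y hz t i
  set x := S.unscaledTrajectory y with hxdef
  have hy0 : ∀ t, 0 ≤ t → ∀ i, y 0 t i = xb 0 t i := fun t ht i => by
    rw [← hyv 0 h0 t ht, volterra_zero, sub_zero]
  have hx0 : ∀ t, 0 ≤ t → ∀ i, x 0 t i = xb 0 t i := fun t ht i => by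
    rw [← hy0 t ht, ← hxy 0 h0, scaling_zero, one_mul]
  -- Initial state and input are read off the reconstructed trajectory, so the condition at z = 1
  -- holds by definition. Relation (3) then follows since the defects of the two boundary conditions
  -- are proportional and both vanish.
  refine ⟨fun z => x z 0, fun t => x 1 t 0 - S.q1 * x 1 t 1, x,
    ⟨isStateTrajectory_unscaledTrajectory hy, h.cont, fun _ _ => rfl, ?_, ?_, ?_, fun t _ => by ring⟩,
    fun z hz => ?_, fun t ht => ?_, fun z hz t ht => (htr z hz t ht).symm⟩
  · intro t ht
    rw [h.ode t ht]
    congr 1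
    refine intervalIntegral.integral_congr fun s hs => ?_
    rw [uIcc_of_le ht] at hs
    simp only [hx0 s hs.1]
  · intro t ht
    simp only [hx0 t ht.le]
    exact h.bc0 t ht
  · rw [S.solvesTransport_iff]
    refine (hK.transports_of_sub_volterra hy ?_).unscale hy fun z hz t _ i => hxy z hz t i
    refine ((S.solvesTransport_iff _ _).1 h.pde).congr S (fun z hz t ht => ?_)
      fun z hz t ht => funext fun i => hyv z hz t ht i
    funext i
    refine hK.boundarySource_eq hq0 hz ?_ i
    rw [hy0 t ht.le, hy0 t ht.le]
    exact h.bc0 t ht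
  · rw [← h.init z hz]
    exact (htr z hz 0 le_rfl).symm
  · have := hK.boundary_residual_eq hy (fun z hz i => hxy z hz t i)
      fun t => x 1 t 0 - S.q1 * x 1 t 1
    rw [hyv 1 h1 t ht.le, hyv 1 h1 t ht.le, h.bc1 t ht] at this
    linarith

end PDEODESystem

theorem lemma1 {n : ℕ} (S : PDEODESystem n) (hq0 : S.q0 ≠ 0) :
    (∃ K : ℝ → ℝ → Matrix (Fin 2) (Fin 2) ℝ, S.IsKernel K) ∧
    ∀ K : ℝ → ℝ → Matrix (Fin 2) (Fin 2) ℝ, S.IsKernel K →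
      -- the state transformation is a bijection of the state space, bounded in both directions
      (∀ w, IsState w → IsState (S.transform K w)) ∧
      (∀ v, IsState v → ∃ w, IsState w ∧ EqOn (S.transform K w) v (Icc 0 1) ∧
        ∀ w', IsState w' → EqOn (S.transform K w') v (Icc 0 1) → EqOn w' w (Icc 0 1)) ∧
      (∃ C : ℝ, 0 < C ∧ ∀ w, IsState w → ∀ M : ℝ,
        ((∀ z ∈ Icc (0 : ℝ) 1, ‖w z‖ ≤ M) →
          ∀ z ∈ Icc (0 : ℝ) 1, ‖S.transform K w z‖ ≤ C * M) ∧
        ((∀ z ∈ Icc (0 : ℝ) 1, ‖S.transform K w z‖ ≤ M) →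
          ∀ z ∈ Icc (0 : ℝ) 1, ‖w z‖ ≤ C * M)) ∧
      -- it maps the solutions of the original system to solutions of the transport form
      (∀ (ξ₀ : Fin n → ℝ) (x₀ : ℝ → Fin 2 → ℝ) (u : ℝ → ℝ) (ξ : ℝ → Fin n → ℝ)
        (x : ℝ → ℝ → Fin 2 → ℝ), S.IsSolution ξ₀ x₀ u ξ x →
        S.IsTransportSolution K ξ₀ (S.transform K x₀) (S.newInput K u x) ξ
          (fun z t => S.transform K (fun ζ => x ζ t) z)) ∧
      -- every solution of the transport form arises from exactly one solution of the original system
      (∀ (ξ₀ : Fin n → ℝ) (xb₀ : ℝ → Fin 2 → ℝ) (ub : ℝ → ℝ) (ξ : ℝ → Fin n → ℝ)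
        (xb : ℝ → ℝ → Fin 2 → ℝ), S.IsTransportSolution K ξ₀ xb₀ ub ξ xb →
        ∃ (x₀ : ℝ → Fin 2 → ℝ) (u : ℝ → ℝ) (x : ℝ → ℝ → Fin 2 → ℝ),
          S.IsSolution ξ₀ x₀ u ξ x ∧ S.Corresponds K x₀ u x xb₀ ub xb ∧
          ∀ (x₀' : ℝ → Fin 2 → ℝ) (u' : ℝ → ℝ) (x' : ℝ → ℝ → Fin 2 → ℝ),
            S.IsSolution ξ₀ x₀' u' ξ x' → S.Corresponds K x₀' u' x' xb₀ ub xb →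
            EqOn x₀' x₀ (Icc 0 1) ∧ EqOn u' u (Ioi 0) ∧
            ∀ z ∈ Icc (0 : ℝ) 1, ∀ t : ℝ, 0 ≤ t → x' z t = x z t) := by
  refine ⟨S.exists_isKernel hq0, fun K hK => ⟨fun w hw => hK.isState_transform hw, ?_, ?_,
    fun ξ₀ x₀ u ξ x h => hK.isTransportSolution hq0 h, ?_⟩⟩
  · intro v hv
    obtain ⟨y, hy, -, htr⟩ := hK.exists_transform_eq hv.isStateTrajectory
    have hw := (PDEODESystem.isStateTrajectory_unscaledTrajectory (S := S) hy).isState le_rfl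
    have hwv : EqOn (S.transform K fun z => S.unscaledTrajectory y z 0) v (Icc 0 1) :=
      fun z hz => htr z hz 0 le_rfl
    exact ⟨_, hw, hwv, fun w' hw' h => hK.eqOn_of_transform_eqOn hw hw' (h.trans hwv.symm)⟩
  · obtain ⟨C₁, h₁, hC₁⟩ := hK.exists_norm_transform_le
    obtain ⟨C₂, h₂, hC₂⟩ := hK.exists_norm_le_transform
    refine ⟨C₁ + C₂, add_pos h₁ h₂, fun w hw M => ⟨fun hM z hz => ?_, fun hM z hz => ?_⟩⟩
    · have := (norm_nonneg _).trans (hM z hz)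
      refine (hC₁ w hw M hM z hz).trans ?_
      gcongr
      linarith
    · have := (norm_nonneg _).trans (hM z hz)
      refine (hC₂ _ hw.isStateTrajectory 0 le_rfl M hM z hz).trans ?_
      gcongr
      linarith
  · intro ξ₀ xb₀ ub ξ xb h
    obtain ⟨x₀, u, x, hx, hc⟩ := hK.exists_isSolution hq0 h
    refine ⟨x₀, u, x, hx, hc, fun x₀' u' x' hx' hc' => ?_⟩
    -- Uniqueness needs only injectivity of the transformation at each fixed time. Initial state and
    -- input are then determined by the trajectory.
    have heq : ∀ z ∈ Icc (0 : ℝ) 1, ∀ t : ℝ, 0 ≤ t → x' z t = x z t := fun z hz t ht =>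
      hK.eqOn_of_transform_eqOn (hx.traj.isState ht) (hx'.traj.isState ht)
        (fun z hz => (hc'.2.2 z hz t ht).symm.trans (hc.2.2 z hz t ht)) hz
    have h1 : (1 : ℝ) ∈ Icc (0 : ℝ) 1 := ⟨zero_le_one, le_rfl⟩
    refine ⟨fun z hz => ?_, fun t ht => ?_, heq⟩
    · rw [← hx'.init z hz, ← hx.init z hz, heq z hz 0 le_rfl]
    · have e := hx.bc1 t ht
      have e' := hx'.bc1 t ht
      rw [heq 1 h1 t (le_of_lt ht)] at e'
      linarith
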